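/- **Setting.** Let $d\in\mathbb N$, $p\in[1,\infty)$, $T>0$, and let $\Omega$ be $\mathbb R^d$, a smooth bounded domain of $\mathbb R^d$ (with outward unit normal $\mathbf n$ on $\partial\Omega$), or the torus $R\,\mathbb T^d=(-R,R]^d$ with its flat geodesic distance, $R>0$. Let $\mathcal P_p(\Omega)\cap L^1(\Omega)$ be the set of absolutely continuous probability measures on $\Omega$ with finite $p$-th moment and let $\mathcal W_p$ be the $p$-Wasserstein distance for the distance of $\Omega$. Let $\mathbf v^\mu,\mathbf v^\nu$ assign to each probability measure $\rho$ on $\Omega$ vector fields $\mathbf v^\mu[\rho],\mathbf v^\nu[\rho]:\Omega\to\mathbb R^d$, and consider $$\partial_t\mu+\operatorname{div}(\mu\,\mathbf v^\mu[\mu])=0,\quad(1)\qquad\qquad \partial_t\nu+\operatorname{div}(\nu\,\mathbf v^\nu[\nu])=0\quad(2)$$ on $[0,T]\times\Omega$, with the no-flux boundary conditions $\mu\,\mathbf v^\mu[\mu]\cdot\mathbf n=0$, $\nu\,\mathbf v^\nu[\nu]\cdot\mathbf n=0$ on $\partial\Omega$ if $\Omega$ is a bounded domain. Solutions are narrowly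 continuous weak solutions: for (1), $(t,x)\mapsto\mathbf v^\mu[\mu_t](x)$ is measurable, $\int_0^T\!\int_\Omega|\mathbf v^\mu[\mu_t]|\,d\mu_t\,dt<\infty$ and $\int_0^T\!\int_\Omega(\partial_t\varphi+\nabla\varphi\cdot\mathbf v^\mu[\mu_t])\,d\mu_t\,dt+\int_\Omega\varphi(0,\cdot)\,d\mu_0=0$ for all $\varphi\in C_c^\infty([0,T)\times\overline\Omega)$; likewise for (2). Write $\|f\|_{BL}=\|f\|_{L^\infty(\Omega)}+\operatorname{Lip}(f)$ and let $BL(\Omega)$ be the space of bounded Lipschitz functions. **Assumption 1 (regularity).** There are sets $\mathcal A_1\subset\mathcal A_2\subset\mathcal P_p(\Omega)\cap L^1(\Omega)$ such that for each initial datum in $\mathcal A_1$ equation (1) has a unique $\mathcal A_1$-valued solution on $[0,T]$, and for each initial datum in $\mathcal A_2$ equation (2) has a unique $\mathcal A_2$-valued solution on $[0,T]$. For every $\rho\in\mathcal A_1$ the function $|\mathbf v^\mu[\rho]-\mathbf v^\nu[\rho]|^p$ is continuous and bounded on $\Omega$. Moreover, if $\mu_t,\nu_t$ are the solutions of (1),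 (2) with the same initial datum $\mu_0=\nu_0\in\mathcal A_1$, then: 1. there are $h\in(0,T]$ and $\delta>0$ with $\mathbf v^\mu[\mu_t],\ \mathbf v^\nu[\nu_t]\in L^{2+\delta}(0,h;BL(\Omega))$; 2. there is $h\in(0,T]$ with $\mathbf v^\nu[\nu_t]-\mathbf v^\mu[\mu_t]\in L^\infty((0,h)\times\Omega)$, and for every compact $K\subset\overline\Omega$ $$\operatorname*{ess\,sup}_{0\le\tau\le h}\Big\|\,|\mathbf v^\nu[\nu_\tau]-\mathbf v^\mu[\mu_\tau]|^p-|\mathbf v^\nu[\nu_0]-\mathbf v^\mu[\mu_0]|^p\Big\|_{L^\infty(K)}\to0\quad\text{as }h\to0^+;$$ 3. if $\Omega$ is a bounded domain, there is $h\in(0,T]$ such that for a.e. $t\in[0,h]$, $\mathbf v^\mu[\mu_t]\cdot\mathbf n=0$ and $\mathbf v^\nu[\nu_t]\cdot\mathbf n\le0$ at every point of $\partial\Omega$. **Assumption 2 (absolute continuity).** Every $\mathcal A_1$-valued solution $\mu_t$ of (1) and every $\mathcal A_2$-valued solution $\nu_t$ of (2) is absolutely continuous in $\mathcal W_p$: there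 is $0\le h\in L^1(0,T)$ (depending on the solution) such that the distance between the values of the solution at times $s<t$ in $[0,T]$ is at most $\int_s^t h(u)\,du$. **Assumption 3 (Lipschitz semigroup).** Equations (1) and (2) generate semigroups on $\mathcal A_1$ and $\mathcal A_2$, respectively: the map $\mathcal S_t$ sending an initial datum to the solution at time $t$ satisfies $\mathcal S_0=\mathrm{Id}$ and $\mathcal S_t\circ\mathcal S_s=\mathcal S_{t+s}$ for $s,t,s+t\in[0,T]$. For the semigroup $\mathcal S_t$ of (2) there is a continuous function $K:[0,T]\to(0,\infty)$ such that $\mathcal W_p(\mathcal S_t\rho_1,\mathcal S_t\rho_2)\le K(t)\,\mathcal W_p(\rho_1,\rho_2)$ for all $\rho_1,\rho_2\in\mathcal A_2$ and $t\in[0,T]$. **Theorem.** Under Assumptions 1–3, let $\mu_t$ be the ($\mathcal A_1$-valued) solution of (1) and $\nu_t$ the ($\mathcal A_2$-valued) solution of (2) with the same initial datum $\mu_0=\nu_0\in\mathcal A_1$. Then for every $t\in[0,T]$ $$\mathcal W_p(\mu_t,\nu_t)\le\int_0^tK(t-s)\left(\int_\Omega\big|\mathbf v^\nu[\mu_s]-\mathbf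 v^\mu[\mu_s]\big|^p\,d\mu_s\right)^{1/p}ds .$$ -/

import Mathlib

open Set Filter Topology MeasureTheory
open scoped ENNReal ContDiff RealInnerProductSpace

noncomputable section

namespace NonlinearContinuity

/-- Euclidean space `ℝᵈ`. -/
abbrev E (d : ℕ) : Type := EuclideanSpace ℝ (Fin d)

/-! ### Spatial domains -/

/-- `g` is a smooth defining function of the open set `U` near the boundary point `x`:
`U = {g < 0}` near `x` and `∇ g (x) ≠ 0`. -/
structure IsDefiningFunctionAt {d : ℕ} (U : Set (E d)) (x : E d) (g : E d → ℝ) : Prop where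
  smooth : ContDiff ℝ ∞ g
  gradient_ne_zero : gradient g x ≠ 0
  mem_iff : ∀ᶠ y in 𝓝 x, (y ∈ U ↔ g y < 0)

/-- Smooth bounded domains: bounded, open, connected, nonempty sets with smooth boundary. -/
structure IsSmoothBoundedDomain {d : ℕ} (U : Set (E d)) : Prop where
  isOpen : IsOpen U
  isConnected : IsConnected U
  isBounded : Bornology.IsBounded U
  smooth_boundary : ∀ x ∈ frontier U, ∃ g : E d → ℝ, IsDefiningFunctionAt U x g

/-- `n` is the outward unit normal vector to `∂U` at `x`. -/
def IsOutwardUnitNormal {d : ℕ} (U : Set (E d)) (x n : E d) : Prop :=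
  ∃ g : E d → ℝ, IsDefiningFunctionAt U x g ∧ n = ‖gradient g x‖⁻¹ • gradient g x

/-- The three kinds of spatial domain `Ω`: the whole space `ℝᵈ`, a smooth bounded domain, and
the torus `R 𝕋ᵈ`, the cube `(-R, R]ᵈ` with opposite faces identified. -/
inductive SpatialDomain (d : ℕ) : Type
  | whole : SpatialDomain d
  | bounded (U : Set (E d)) (hU : IsSmoothBoundedDomain U) : SpatialDomain d
  | torus (R : ℝ) (hR : 0 < R) : SpatialDomain d

namespace SpatialDomain

variable {d : ℕ}

/-- The space of points of `Ω`. On the torus, `PiLp 2` of circles of length `2R` carries exactly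
the geodesic distance `min {|z₁ - z₂ + 2 R k| : k ∈ ℤᵈ}`. -/
def Pt : SpatialDomain d → Type
  | whole => E d
  | bounded U _ => U
  | torus R _ => PiLp 2 (fun _ : Fin d => AddCircle (2 * R))

instance instMetricSpacePt : (Ω : SpatialDomain d) → MetricSpace Ω.Pt
  | whole => inferInstanceAs (MetricSpace (E d))
  | bounded U _ => inferInstanceAs (MetricSpace U)
  | torus R _ => inferInstanceAs (MetricSpace (PiLp 2 (fun _ : Fin d => AddCircle (2 * R))))

instance instMeasurableSpacePt : (Ω : SpatialDomain d) → MeasurableSpace Ω.Pt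
  | whole => inferInstanceAs (MeasurableSpace (E d))
  | bounded U _ => inferInstanceAs (MeasurableSpace U)
  | torus R _ => inferInstanceAs (MeasurableSpace (PiLp 2 (fun _ : Fin d => AddCircle (2 * R))))

instance instBorelSpacePt : (Ω : SpatialDomain d) → BorelSpace Ω.Pt
  | whole => inferInstanceAs (BorelSpace (E d))
  | bounded U _ => inferInstanceAs (BorelSpace U)
  | torus R _ => inferInstanceAs (BorelSpace (PiLp 2 (fun _ : Fin d => AddCircle (2 * R))))

/-- The coordinates in `ℝᵈ` of a point of `Ω`; on the torus, those of its representative in the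
cube `(-R, R]ᵈ`. -/
def coord : (Ω : SpatialDomain d) → Ω.Pt → E d
  | whole => fun x => x
  | bounded U _ => fun x : U => (x : E d)
  | torus R hR => fun x : PiLp 2 (fun _ : Fin d => AddCircle (2 * R)) =>
      haveI : Fact (0 < 2 * R) := ⟨by linarith⟩
      WithLp.toLp 2 (fun i => (AddCircle.equivIoc (2 * R) (-R) (x i) : ℝ))

/-- Lebesgue measure on `Ω`; on the torus, the image of Lebesgue measure on `(-R, R]ᵈ`. -/
def vol : (Ω : SpatialDomain d) → Measure Ω.Pt
  | whole => (volume : Measure (E d))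
  | bounded U _ => (volume : Measure (E d)).comap (Subtype.val : U → E d)
  | torus R _ => Measure.map
      (fun x : E d => (WithLp.toLp 2 (fun i => ((x i : ℝ) : AddCircle (2 * R))) :
        PiLp 2 (fun _ : Fin d => AddCircle (2 * R))))
      ((volume : Measure (E d)).restrict {x | ∀ i, x i ∈ Ioc (-R) R})

/-- Spatial part of the requirement on a test function: compact support (in the case of a bounded
domain there is no condition at `∂Ω`, so that the weak formulation below contains the no-flux
boundary condition), respectively periodicity. -/
def SpatialTestCondition : SpatialDomain d → (ℝ × E d → ℝ) → Prop
  | whole, φ => HasCompactSupport φ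
  | bounded _ _, φ => HasCompactSupport φ
  | torus R _, φ => ∀ (t : ℝ) (x : E d) (k : Fin d → ℤ),
      φ (t, x + WithLp.toLp 2 (fun i => 2 * R * (k i : ℝ))) = φ (t, x)

/-- Test functions in `C_c^∞([0,T) × Ω̄)`, given as functions of the coordinates. -/
structure IsTestFunction (Ω : SpatialDomain d) (T : ℝ) (φ : ℝ × E d → ℝ) : Prop where
  smooth : ContDiff ℝ ∞ φ
  eq_zero_near_end : ∃ b < T, ∀ t, b ≤ t → ∀ x, φ (t, x) = 0
  spatial : Ω.SpatialTestCondition φ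

/-- If `Ω` is a bounded domain: at each boundary point the boundary value of the normal component
`u · n` exists and lies in `J`, where `n` is the outward unit normal. No condition otherwise. -/
def NormalComponentIn : (Ω : SpatialDomain d) → (Ω.Pt → E d) → Set ℝ → Prop
  | whole, _, _ => True
  | bounded U _, u, J => ∀ x ∈ frontier U, ∀ n : E d, IsOutwardUnitNormal U x n →
      ∃ c ∈ J, Tendsto (fun y : U => ⟪u y, n⟫) (comap (Subtype.val : U → E d) (𝓝 x)) (𝓝 c)
  | torus _ _, _, _ => True

/-- `𝒫_p(Ω) ∩ L¹(Ω)`: absolutely continuous probability measures with finite `p`-th moment. -/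
def PpL1 (Ω : SpatialDomain d) (p : ℝ) : Set (ProbabilityMeasure Ω.Pt) :=
  {ρ | (ρ : Measure Ω.Pt) ≪ Ω.vol ∧ ∫⁻ x, ‖Ω.coord x‖ₑ ^ p ∂(ρ : Measure Ω.Pt) < ⊤}

end SpatialDomain

/-! ### Wasserstein distance and bounded Lipschitz norm -/

/-- The `p`-Wasserstein distance, `𝒲_p(μ,ν)ᵖ = inf ∫ d(x,y)ᵖ dπ` over couplings `π`. -/
def wasserstein {X : Type*} [MetricSpace X] [MeasurableSpace X] (p : ℝ)
    (μ ν : ProbabilityMeasure X) : ℝ≥0∞ :=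
  (⨅ π : {π : Measure (X × X) // π.map Prod.fst = (μ : Measure X) ∧ π.map Prod.snd = (ν : Measure X)},
    ∫⁻ z, edist z.1 z.2 ^ p ∂(π : Measure (X × X))) ^ (1 / p)

/-- The norm `‖f‖_{BL} = ‖f‖_∞ + Lip f`, equal to `∞` unless `f` is bounded and Lipschitz. -/
def blNorm {X Y : Type*} [MetricSpace X] [NormedAddCommGroup Y] (f : X → Y) : ℝ≥0∞ :=
  (⨆ x, ‖f x‖ₑ) + ⨆ (x : X) (y : X) (_ : x ≠ y), edist (f x) (f y) / edist x y

/-- The curve `γ : [0,T] → (𝒫(X), 𝒲_p)` is absolutely continuous. -/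
def IsAbsContCurve {X : Type*} [MetricSpace X] [MeasurableSpace X] (p T : ℝ)
    (γ : ℝ → ProbabilityMeasure X) : Prop :=
  ∃ h : ℝ → ℝ, (∀ u, 0 ≤ h u) ∧ IntervalIntegrable h volume 0 T ∧
    ∀ s t, 0 ≤ s → s < t → t ≤ T →
      wasserstein p (γ t) (γ s) ≤ ENNReal.ofReal (∫ u in s..t, h u)

/-! ### Nonlinear continuity equations -/

variable {d : ℕ}

/-- A velocity field depending on the solution: `v ρ x` is `v[ρ](x)`. -/
abbrev Velocity (Ω : SpatialDomain d) : Type := ProbabilityMeasure Ω.Pt → Ω.Pt → E d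

/-- `μ : [0,T] → A` is a (narrowly continuous) weak solution of `∂ₜ μ + div (μ v[μ]) = 0` on
`[0,T] × Ω` with initial datum `ρ₀`, with the no-flux boundary condition `μ v[μ] · n = 0` if `Ω` is
a bounded domain. Values of `μ` outside `[0,T]` are irrelevant. -/
structure IsWeakSolution (Ω : SpatialDomain d) (T : ℝ) (v : Velocity Ω)
    (A : Set (ProbabilityMeasure Ω.Pt)) (ρ₀ : ProbabilityMeasure Ω.Pt)
    (μ : ℝ → ProbabilityMeasure Ω.Pt) : Prop where
  mem : ∀ t ∈ Icc 0 T, μ t ∈ A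
  initial : μ 0 = ρ₀
  narrowly_continuous : ContinuousOn μ (Icc 0 T)
  aemeasurable : AEMeasurable (fun z : ℝ × Ω.Pt => v (μ z.1) z.2)
    ((volume.restrict (Ioo 0 T)).prod Ω.vol)
  integrable : ∫⁻ t in Ioo 0 T, ∫⁻ x, ‖v (μ t) x‖ₑ ∂(μ t : Measure Ω.Pt) < ⊤
  weak : ∀ φ : ℝ × E d → ℝ, Ω.IsTestFunction T φ →
    (∫ t in Ioo 0 T, ∫ x, (deriv (fun s => φ (s, Ω.coord x)) t
        + ⟪gradient (fun y => φ (t, y)) (Ω.coord x), v (μ t) x⟫) ∂(μ t : Measure Ω.Pt))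
      + ∫ x, φ (0, Ω.coord x) ∂(μ 0 : Measure Ω.Pt) = 0

/-- For every initial datum in `A` there is exactly one `A`-valued solution on `[0,T]`. -/
def UniquelySolvable (Ω : SpatialDomain d) (T : ℝ) (v : Velocity Ω)
    (A : Set (ProbabilityMeasure Ω.Pt)) : Prop :=
  ∀ ρ₀ ∈ A, ∃ μ, IsWeakSolution Ω T v A ρ₀ μ ∧
    ∀ μ', IsWeakSolution Ω T v A ρ₀ μ' → EqOn μ' μ (Icc 0 T)

/-- The equation with velocity `v` generates the semigroup `S` on `A`. -/
structure GeneratesSemigroup (Ω : SpatialDomain d) (T : ℝ) (v : Velocity Ω)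
    (A : Set (ProbabilityMeasure Ω.Pt))
    (S : ℝ → ProbabilityMeasure Ω.Pt → ProbabilityMeasure Ω.Pt) : Prop where
  solution : ∀ ρ ∈ A, IsWeakSolution Ω T v A ρ (fun t => S t ρ)
  zero : ∀ ρ ∈ A, S 0 ρ = ρ
  add : ∀ s t, 0 ≤ s → 0 ≤ t → s + t ≤ T → ∀ ρ ∈ A, S t (S s ρ) = S (t + s) ρ

/-- `u ∈ L^q(0,h; BL(Ω))` for a time dependent vector field `u`. -/
def InLqBL (Ω : SpatialDomain d) (q h : ℝ) (u : ℝ → Ω.Pt → E d) : Prop :=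
  AEMeasurable (fun z : ℝ × Ω.Pt => u z.1 z.2) ((volume.restrict (Ioo 0 h)).prod Ω.vol) ∧
  AEMeasurable (fun t => blNorm (u t)) (volume.restrict (Ioo 0 h)) ∧
  ∫⁻ t in Ioo 0 h, blNorm (u t) ^ q < ⊤

/-- Regularity near the initial time of a pair of solutions `μ`, `ν` with the same initial datum.
In `diff_tendsto`, bounded sets are exactly the subsets of compact sets `K ⊆ Ω̄`. -/
structure IsRegularPair (Ω : SpatialDomain d) (p T : ℝ) (vμ vν : Velocity Ω)
    (μ ν : ℝ → ProbabilityMeasure Ω.Pt) : Prop where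
  velocity_bl : ∃ h δ : ℝ, 0 < h ∧ h ≤ T ∧ 0 < δ ∧
    InLqBL Ω (2 + δ) h (fun t => vμ (μ t)) ∧ InLqBL Ω (2 + δ) h (fun t => vν (ν t))
  diff_bounded : ∃ h : ℝ, 0 < h ∧ h ≤ T ∧
    eLpNormEssSup (fun z : ℝ × Ω.Pt => vν (ν z.1) z.2 - vμ (μ z.1) z.2)
      ((volume.restrict (Ioo 0 h)).prod Ω.vol) < ⊤
  diff_tendsto : ∀ B : Set Ω.Pt, Bornology.IsBounded B →
    Tendsto (fun h : ℝ => essSup (fun τ : ℝ =>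
        eLpNormEssSup (fun x => ‖vν (ν τ) x - vμ (μ τ) x‖ ^ p - ‖vν (ν 0) x - vμ (μ 0) x‖ ^ p)
          (Ω.vol.restrict B)) (volume.restrict (Icc 0 h)))
      (𝓝[>] 0) (𝓝 0)
  boundary : ∃ h : ℝ, 0 < h ∧ h ≤ T ∧ ∀ᵐ t ∂(volume.restrict (Icc 0 h)),
    Ω.NormalComponentIn (vμ (μ t)) {0} ∧ Ω.NormalComponentIn (vν (ν t)) (Iic 0)

end NonlinearContinuity

end

noncomputable section

namespace NonlinearContinuity

section

/-! ### A mean value inequality with upper Dini derivatives -/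

/-! Fix `t`, let `S` be the semigroup of (2) and follow the curve `s ↦ S_{t-s} μ_s`, which joins
`S_t μ_0 = ν_t` to `μ_t`. Put `G(s) = 𝒲_p(S_{t-s} μ_s, S_t μ_0)`. For `u > s`, the triangle
inequality, the identity `S_{t-s} = S_{t-u} ∘ S_{u-s}` and the Lipschitz bound give `G(u) - G(s) ≤
K(t-u) 𝒲_p(μ_u, S_{u-s} μ_s)`. So the upper right Dini derivative of `G` at `s` is at most `K(t-s)`
times the initial rate at which the two equations separate when both start from `μ_s`. Once this
rate is bounded by the `L^p(μ_s)` norm of the velocity difference at `μ_s`, the mean value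
inequality `sub_le_lintegral_of_dini_le` gives the theorem
(`wasserstein_le_lintegral_of_semigroup`).

The rate is found in `eventually_wasserstein_le`. For short times the two velocities extend to
fields `V`, `W` on `ℝᵈ`, bounded and Lipschitz in space with integrable constants
(`InLqBL.exists_caratheodoryField`), so they have flows `X`, `Y`. Both solutions are images of the
common datum under these flows, and `(X_t, Y_t)` induces a coupling. Stability of the flow, Hölder
in time and Tonelli then bound `𝒲_p`, up to a factor tending to `1`, by `t` times the `p`-th root of
an essential bound of `∫ |V_u - W_u|^p dμ_u` over `u < t`. `IsRegularPair.exists_lintegral_le`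
compares this with the value at time `0`.

The representation by flows, `IsTransported.map_flow_eq`, is proved by duality. If `ψ_s = f ∘ (flow
from s to t)`, then formally `∫ ψ_s dm_s` is constant in `s`. As `ψ_s` is only Lipschitz, it is
mollified at scale `ε`; over a short interval the integral then changes by at most `O(ε) Δ + O_ε(1)
Δ²`, where `Δ` is the increment of a continuous nondecreasing function that collects the Lipschitz
constants of the field and the metric speed of the curve. Refining partitions removes the square
(`abs_sub_le_of_quadratic_increments`), and `ε → 0` removes the rest. On a bounded domain the test
functions need not vanish at the boundary, so the two laws agree on all of `ℝᵈ`; hence at each given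
time almost every trajectory lies in `Ω`, although the extended field knows nothing of the boundary.
-/

/-- If the upper right Dini derivative of a continuous function is dominated by an integrable
measurable function `φ`, then its increments are dominated by the integral of `φ`. -/
theorem sub_le_lintegral_of_dini_le_measurable {g : ℝ → ℝ} {a b : ℝ} (hab : a ≤ b)
    (hcont : ContinuousOn g (Icc a b)) {φ : ℝ → NNReal} (hφ : Measurable φ)
    (hdini : ∀ s ∈ Ico a b, ∀ y : ℝ, (φ s : ℝ) < y →
      ∀ᶠ u in 𝓝[>] s, g u - g s ≤ (u - s) * y) :
    ENNReal.ofReal (g b - g a) ≤ ∫⁻ s in Icc a b, φ s := by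
  by_cases hfin : ∫⁻ s in Icc a b, φ s = ⊤
  · rw [hfin]; exact le_top
  refine ENNReal.le_of_forall_pos_le_add fun ε εpos _ => ?_
  -- Vitali–Carathéodory: a lower semicontinuous `G > φ` whose integral exceeds that of `φ` by at
  -- most `ε`. Near each point, `G` stays above any constant smaller than its value there.
  obtain ⟨G, hφG, Gcont, hG⟩ := exists_lt_lowerSemicontinuous_lintegral_ge
    (volume.restrict (Icc a b)) φ hφ (ENNReal.coe_pos.2 εpos).ne'
  refine le_trans ?_ hG
  have hGfin : ∫⁻ s in Icc a b, G s ≠ ⊤ :=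
    (hG.trans_lt (ENNReal.add_lt_top.2 ⟨lt_top_iff_ne_top.2 hfin, ENNReal.coe_lt_top⟩)).ne
  have hGmeas : Measurable G := Gcont.measurable
  have Gint : IntegrableOn (fun s => (G s).toReal) (Icc a b) :=
    integrable_toReal_of_lintegral_ne_top hGmeas.aemeasurable hGfin
  have Gtop : ∀ᵐ s ∂volume.restrict (Icc a b), G s < ⊤ := ae_lt_top hGmeas hGfin
  set S := {t | g t - g a ≤ ∫ u in a..t, (G u).toReal} ∩ Icc a b
  have S_closed : IsClosed S := by
    have : ContinuousOn (fun t => (g t - g a, ∫ u in a..t, (G u).toReal)) (Icc a b) := by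
      rw [← uIcc_of_le hab] at Gint hcont ⊢
      exact (hcont.sub continuousOn_const).prodMk
        (intervalIntegral.continuousOn_primitive_interval Gint)
    simp only [S, inter_comm]
    exact this.preimage_isClosed_of_isClosed isClosed_Icc OrderClosedTopology.isClosed_le'
  -- Continuous induction: the closed set `S` contains `a`, and from each of its points below `b`
  -- one can move to the right within it. A constant `y` strictly between `φ t` and `G t` separates
  -- the increment of `g` from the integral of `G`.
  have main : Icc a b ⊆ {t | g t - g a ≤ ∫ u in a..t, (G u).toReal} := by
    refine S_closed.Icc_subset_of_forall_exists_gt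
      (by simp) fun t ht v t_lt_v => ?_
    obtain ⟨y, hy1, hy2⟩ : ∃ y : NNReal, (φ t : ℝ≥0∞) < y ∧ (y : ℝ≥0∞) < G t :=
      ENNReal.lt_iff_exists_nnreal_btwn.1 (hφG t)
    have I1 : ∀ᶠ u in 𝓝[>] t, (u - t) * y ≤ ∫ w in t..u, (G w).toReal := by
      have B : ∀ᶠ u in 𝓝 t, (y : ℝ≥0∞) < G u := Gcont.lowerSemicontinuousAt _ _ hy2
      rcases mem_nhds_iff_exists_Ioo_subset.1 B with ⟨m, M, ⟨hm, hM⟩, H⟩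
      have : Ioo t (min M b) ∈ 𝓝[>] t := Ioo_mem_nhdsGT (lt_min hM ht.right.right)
      filter_upwards [this] with u hu
      have I : Icc t u ⊆ Icc a b := Icc_subset_Icc ht.2.1 (hu.2.le.trans (min_le_right _ _))
      calc
        (u - t) * y = ∫ _ in Icc t u, (y : ℝ) := by
          simp only [MeasureTheory.integral_const, MeasurableSet.univ, measureReal_restrict_apply,
            univ_inter, hu.left.le, Real.volume_real_Icc_of_le, smul_eq_mul]
        _ ≤ ∫ w in t..u, (G w).toReal := by
          rw [intervalIntegral.integral_of_le hu.1.le, ← integral_Icc_eq_integral_Ioc]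
          apply setIntegral_mono_ae_restrict
          · simp
          · exact IntegrableOn.mono_set Gint I
          · have C1 : ∀ᵐ x : ℝ ∂volume.restrict (Icc t u), G x < ⊤ :=
              ae_mono (Measure.restrict_mono I le_rfl) Gtop
            have C2 : ∀ᵐ x : ℝ ∂volume.restrict (Icc t u), x ∈ Icc t u :=
              ae_restrict_mem measurableSet_Icc
            filter_upwards [C1, C2] with x G'x hx
            have : x ∈ Ioo m M := by
              simp only [hm.trans_le hx.left,
                (hx.right.trans_lt hu.right).trans_le (min_le_left M b), mem_Ioo, and_self_iff]
            have h1 : (y : ℝ≥0∞) < G x := H this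
            exact (ENNReal.toReal_mono G'x.ne h1.le)
    have I2 : ∀ᶠ u in 𝓝[>] t, g u - g t ≤ (u - t) * y :=
      hdini t ht.2 y (by exact_mod_cast hy1)
    have I4 : ∀ᶠ u in 𝓝[>] t, u ∈ Ioc t (min v b) := Ioc_mem_nhdsGT <| lt_min t_lt_v ht.2.2
    rcases ((I1.and I2).and I4).exists with ⟨x, ⟨h1x, h2x⟩, h'x⟩
    refine ⟨x, ?_, Ioc_subset_Ioc le_rfl (min_le_left _ _) h'x⟩
    calc
      g x - g a = g t - g a + (g x - g t) := by abel
      _ ≤ (∫ w in a..t, (G w).toReal) + ∫ w in t..x, (G w).toReal :=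
        add_le_add ht.1 (h2x.trans h1x)
      _ = ∫ w in a..x, (G w).toReal := by
        apply intervalIntegral.integral_add_adjacent_intervals
        · rw [intervalIntegrable_iff_integrableOn_Ioc_of_le ht.2.1]
          exact IntegrableOn.mono_set Gint
            (Ioc_subset_Icc_self.trans (Icc_subset_Icc le_rfl ht.2.2.le))
        · rw [intervalIntegrable_iff_integrableOn_Ioc_of_le h'x.1.le]
          apply IntegrableOn.mono_set Gint
          exact Ioc_subset_Icc_self.trans (Icc_subset_Icc ht.2.1 (h'x.2.trans (min_le_right _ _)))
  calc
    ENNReal.ofReal (g b - g a) ≤ ENNReal.ofReal (∫ y in a..b, (G y).toReal) :=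
      ENNReal.ofReal_le_ofReal (main (right_mem_Icc.2 hab))
    _ = ∫⁻ s in Icc a b, G s := by
      rw [intervalIntegral.integral_of_le hab, ← integral_Icc_eq_integral_Ioc,
        integral_toReal hGmeas.aemeasurable Gtop, ENNReal.ofReal_toReal hGfin]

/-- If the upper right Dini derivative of a continuous function is dominated by `f`, then its
increments are dominated by the (lower) integral of `f`, even if `f` is not measurable. -/
theorem sub_le_lintegral_of_dini_le {g : ℝ → ℝ} {a b : ℝ} (hab : a ≤ b)
    (hcont : ContinuousOn g (Icc a b)) {f : ℝ → ℝ≥0∞} (hf : ∀ s ∈ Ico a b, f s ≠ ⊤)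
    (hdini : ∀ s ∈ Ico a b, ∀ y : ℝ, f s < ENNReal.ofReal y →
      ∀ᶠ u in 𝓝[>] s, g u - g s ≤ (u - s) * y) :
    ENNReal.ofReal (g b - g a) ≤ ∫⁻ s in Icc a b, f s := by
  -- The constant extension of `g` makes all difference quotients continuous on the whole line.
  let k : ℝ → ℝ := IccExtend hab ((Icc a b).domRestrict g)
  have hk : Continuous k := (continuousOn_iff_continuous_domRestrict.1 hcont).Icc_extend'
  have hkg : ∀ x ∈ Icc a b, k x = g x := fun x hx => by
    simp only [k, IccExtend_of_mem hab _ hx]; rfl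
  -- The nonnegative part of the upper right Dini derivative, with the increments restricted to
  -- rationals so that it is measurable. It lies below `f`, so its integral is at most the lower
  -- integral of `f`.
  let F : ℝ → ℝ≥0∞ := fun s => ⨅ n : ℕ, ⨆ q : ℚ,
    if 0 < (q : ℝ) ∧ (q : ℝ) < 1 / (n + 1 : ℝ) then ENNReal.ofReal ((k (s + q) - k s) / q) else 0
  have hF : Measurable F := by
    refine Measurable.iInf fun n => Measurable.iSup fun q => ?_
    split_ifs
    · have : Continuous fun s => (k (s + q) - k s) / q := by fun_prop
      exact this.measurable.ennreal_ofReal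
    · exact measurable_const
  have hFf : ∀ s ∈ Ico a b, F s ≤ f s := by
    intro s hs
    refine ENNReal.le_of_forall_pos_le_add fun ε εpos _ => ?_
    have hy : f s < ENNReal.ofReal ((f s).toReal + (ε : ℝ)) := by
      rw [ENNReal.ofReal_add ENNReal.toReal_nonneg ε.coe_nonneg, ENNReal.ofReal_toReal (hf s hs)]
      simpa using ENNReal.lt_add_right (hf s hs) (by simpa using εpos.ne')
    have h1 := hdini s hs _ hy
    have h2 : ∀ᶠ u in 𝓝[>] s, u ∈ Ioo s b := Ioo_mem_nhdsGT hs.2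
    obtain ⟨m, hm, H⟩ := mem_nhdsGT_iff_exists_Ioo_subset.1 (h1.and h2)
    obtain ⟨n, hn⟩ := exists_nat_one_div_lt (sub_pos.2 (mem_Ioi.1 hm))
    refine (iInf_le _ n).trans (iSup_le fun q => ?_)
    split_ifs with hq
    · have hmem : s + q ∈ Ioo s m := ⟨by linarith, by linarith⟩
      have h3 := H hmem
      obtain ⟨h3, h4⟩ := h3
      rw [hkg _ ⟨hs.1.trans h4.1.le, h4.2.le⟩, hkg _ ⟨hs.1, hs.2.le⟩]
      have h5 : (g (s + q) - g s) / q ≤ (f s).toReal + ε := by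
        rw [div_le_iff₀ hq.1]
        have : s + (q : ℝ) - s = q := by ring
        rw [this] at h3; linarith
      calc _ ≤ ENNReal.ofReal ((f s).toReal + ε) := ENNReal.ofReal_le_ofReal h5
        _ = f s + ε := by
          rw [ENNReal.ofReal_add ENNReal.toReal_nonneg ε.coe_nonneg, ENNReal.ofReal_toReal (hf s hs)]
          simp
    · exact zero_le
  let φ : ℝ → NNReal := fun s => (F s).toNNReal
  have hφ : Measurable φ := hF.ennreal_toNNReal
  have hdF : ∀ s ∈ Ico a b, ∀ y : ℝ, (φ s : ℝ) < y →
      ∀ᶠ u in 𝓝[>] s, g u - g s ≤ (u - s) * y := by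
    intro s hs y hy
    have hFtop : F s ≠ ⊤ := ((hFf s hs).trans_lt (lt_top_iff_ne_top.2 (hf s hs))).ne
    have hy0 : 0 < y := (φ s).2.trans_lt hy
    have h1 : F s < ENNReal.ofReal y := by
      rw [← ENNReal.coe_toNNReal hFtop, ← ENNReal.ofReal_coe_nnreal]
      exact (ENNReal.ofReal_lt_ofReal_iff hy0).2 hy
    obtain ⟨n, hn⟩ := iInf_lt_iff.1 h1
    have h2 : ∀ q : ℚ, 0 < (q : ℝ) → (q : ℝ) < 1 / (n + 1 : ℝ) → k (s + q) - k s ≤ q * y := by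
      intro q h0 h1
      have h3 := ((le_iSup (fun q : ℚ => if 0 < (q : ℝ) ∧ (q : ℝ) < 1 / (n + 1 : ℝ) then
        ENNReal.ofReal ((k (s + q) - k s) / q) else 0) q).trans_lt hn).le
      simp only [h0, h1, and_self, if_true] at h3
      rw [ENNReal.ofReal_le_ofReal_iff hy0.le, div_le_iff₀ h0] at h3
      linarith
    -- By continuity the increments violating the bound form an open set, which would contain a
    -- rational.
    have h3 : ∀ r : ℝ, 0 < r → r < 1 / (n + 1 : ℝ) → k (s + r) - k s ≤ r * y := by
      intro r h0 h1
      by_contra hcon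
      push Not at hcon
      have hc : Continuous fun r => k (s + r) - k s - r * y := by fun_prop
      have ho : IsOpen ({r : ℝ | 0 < k (s + r) - k s - r * y} ∩ Ioo 0 (1 / (n + 1 : ℝ))) :=
        (isOpen_lt continuous_const hc).inter isOpen_Ioo
      obtain ⟨q, hq⟩ := Rat.denseRange_cast.exists_mem_open ho ⟨r, by
        simp only [mem_ofPred_eq]; linarith, h0, h1⟩
      have := h2 q hq.2.1 hq.2.2
      have h4 : 0 < k (s + q) - k s - q * y := hq.1
      linarith
    have h4 : Ioo s (min b (s + 1 / (n + 1 : ℝ))) ∈ 𝓝[>] s :=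
      Ioo_mem_nhdsGT (lt_min hs.2 (by have : (0:ℝ) < 1 / (n + 1) := by positivity
                                      linarith))
    filter_upwards [h4] with u hu
    have h5 := h3 (u - s) (by linarith [hu.1]) (by linarith [hu.2.trans_le (min_le_right _ _)])
    rw [show s + (u - s) = u by ring, hkg _ ⟨hs.1, hs.2.le⟩,
      hkg _ ⟨hs.1.trans hu.1.le, (hu.2.trans_le (min_le_left _ _)).le⟩] at h5
    exact h5
  refine (sub_le_lintegral_of_dini_le_measurable hab hcont hφ hdF).trans ?_
  -- The endpoint `b`, where `F` is not compared with `f`, is a null set.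
  rw [setLIntegral_congr (Ico_ae_eq_Icc (a := a) (b := b)).symm,
    setLIntegral_congr (f := f) (Ico_ae_eq_Icc (a := a) (b := b)).symm]
  refine setLIntegral_mono' measurableSet_Ico fun s hs => ?_
  exact ENNReal.coe_toNNReal_le_self.trans (hFf s hs)

/-- A function whose increments are at most `a m + b m²`, where `m` are the increments of a
continuous nondecreasing function, has increments at most `a m`. -/
theorem abs_sub_le_of_quadratic_increments {F M : ℝ → ℝ} {t a b : ℝ} (ht : 0 ≤ t)
    (hM : ContinuousOn M (Icc 0 t)) (hmono : MonotoneOn M (Icc 0 t)) (hb : 0 ≤ b)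
    (h : ∀ s ∈ Icc 0 t, ∀ s' ∈ Icc 0 t, s ≤ s' →
      |F s' - F s| ≤ a * (M s' - M s) + b * (M s' - M s) ^ 2) :
    |F t - F 0| ≤ a * (M t - M 0) := by
  refine le_of_forall_pos_le_add fun ε hε => ?_
  have hM0 : 0 ≤ M t - M 0 := sub_nonneg.2 (hmono ⟨le_rfl, ht⟩ ⟨ht, le_rfl⟩ ht)
  -- Once the mesh makes all increments of `M` smaller than `η`, each square is at most `η` times
  -- the increment. The sum telescopes with total error `b η (M t - M 0) ≤ ε`; the `+ 1` only
  -- prevents a zero denominator.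
  set η := ε / (b * (M t - M 0) + 1)
  have hη : 0 < η := by positivity
  obtain ⟨δ, hδ, hu⟩ := Metric.uniformContinuousOn_iff.1
    (isCompact_Icc.uniformContinuousOn_of_continuous hM) η hη
  obtain ⟨n, hn⟩ := exists_nat_gt (t / δ)
  have hn0 : (0 : ℝ) < n := (div_nonneg ht hδ.le).trans_lt hn
  let τ : ℕ → ℝ := fun i => i * t / n
  have hτmem : ∀ i ≤ n, τ i ∈ Icc 0 t := fun i hi => by
    refine ⟨by positivity, ?_⟩
    rw [div_le_iff₀ hn0, mul_comm]
    exact mul_le_mul_of_nonneg_left (by exact_mod_cast hi) ht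
  have hτle : ∀ i, τ i ≤ τ (i + 1) := fun i => by
    simp only [τ]; gcongr; simp
  have hτ0 : τ 0 = 0 := by simp [τ]
  have hτn : τ n = t := by simp only [τ]; field_simp
  have hstep : ∀ i < n, |F (τ (i + 1)) - F (τ i)| ≤
      (a + b * η) * (M (τ (i + 1)) - M (τ i)) := fun i hi => by
    have h1 := hτmem i hi.le
    have h2 := hτmem (i + 1) hi
    have h3 := h _ h1 _ h2 (hτle i)
    have h4 := hmono h1 h2 (hτle i)
    have h5 : dist (τ (i + 1)) (τ i) < δ := by
      rw [Real.dist_eq, abs_of_nonneg (sub_nonneg.2 (hτle i))]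
      have : τ (i + 1) - τ i = t / n := by simp only [τ]; push_cast; ring
      rw [this, div_lt_iff₀ hn0]
      rw [div_lt_iff₀ hδ] at hn; linarith
    have h6 := hu _ h2 _ h1 h5
    rw [Real.dist_eq, abs_of_nonneg (sub_nonneg.2 h4)] at h6
    have h7 : (M (τ (i + 1)) - M (τ i)) ^ 2 ≤ η * (M (τ (i + 1)) - M (τ i)) := by
      rw [sq]; exact mul_le_mul_of_nonneg_right h6.le (sub_nonneg.2 h4)
    nlinarith [mul_le_mul_of_nonneg_left h7 hb]
  have hsum : ∀ i ≤ n, |F (τ i) - F 0| ≤ (a + b * η) * (M (τ i) - M 0) := by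
    intro i
    induction i with
    | zero => intro _; simp [hτ0]
    | succ i ih =>
      intro hi
      have h1 := ih (by omega)
      have h2 := hstep i (by omega)
      calc |F (τ (i + 1)) - F 0| ≤ |F (τ (i + 1)) - F (τ i)| + |F (τ i) - F 0| :=
            abs_sub_le _ _ _
        _ ≤ _ := by linarith
  have h1 := hsum n le_rfl
  rw [hτn] at h1
  have h2 : b * η * (M t - M 0) ≤ ε := by
    have : b * (M t - M 0) * η ≤ ε := by
      rw [show b * (M t - M 0) * η = ε * ((b * (M t - M 0)) / (b * (M t - M 0) + 1)) by
        simp only [η]; ring]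
      have hh : (b * (M t - M 0)) / (b * (M t - M 0) + 1) ≤ 1 := by
        rw [div_le_one (by positivity)]; linarith
      exact mul_le_of_le_one_right hε.le hh
    linarith
  linarith

end

section

/-! ### The Wasserstein distance -/

section Wasserstein

variable {X : Type*} [MetricSpace X] [MeasurableSpace X] {p : ℝ}

/-- The power `1 / p` is an order isomorphism of `[0,∞]`, so it passes through the infimum. Each
coupling can then be handled as an `L^p` norm. -/
theorem wasserstein_eq_iInf (hp : 1 ≤ p) (μ ν : ProbabilityMeasure X) :
    wasserstein p μ ν = ⨅ π : {π : Measure (X × X) //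
      π.map Prod.fst = (μ : Measure X) ∧ π.map Prod.snd = (ν : Measure X)},
      (∫⁻ z, edist z.1 z.2 ^ p ∂(π : Measure (X × X))) ^ (1 / p) :=
  (ENNReal.orderIsoRpow (1 / p) (by positivity)).map_iInf _

theorem wasserstein_le_of_coupling (hp : 1 ≤ p) {μ ν : ProbabilityMeasure X}
    {π : Measure (X × X)} (h₁ : π.map Prod.fst = (μ : Measure X))
    (h₂ : π.map Prod.snd = (ν : Measure X)) :
    wasserstein p μ ν ≤ (∫⁻ z, edist z.1 z.2 ^ p ∂π) ^ (1 / p) := by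
  rw [wasserstein_eq_iInf hp]
  exact iInf_le (fun π : {π : Measure (X × X) //
      π.map Prod.fst = (μ : Measure X) ∧ π.map Prod.snd = (ν : Measure X)} =>
      (∫⁻ z, edist z.1 z.2 ^ p ∂(π : Measure (X × X))) ^ (1 / p)) ⟨π, h₁, h₂⟩

variable [BorelSpace X] [SecondCountableTopology X]

/-- The joint law of two maps is a coupling of their laws. -/
theorem wasserstein_le_of_maps (hp : 1 ≤ p) {μ ν : ProbabilityMeasure X} {Y : Type*}
    [MeasurableSpace Y] {ρ : Measure Y} {f g : Y → X} (hf : Measurable f) (hg : Measurable g)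
    (h₁ : ρ.map f = (μ : Measure X)) (h₂ : ρ.map g = (ν : Measure X)) :
    wasserstein p μ ν ≤ (∫⁻ y, edist (f y) (g y) ^ p ∂ρ) ^ (1 / p) := by
  have h := wasserstein_le_of_coupling (π := ρ.map fun y => (f y, g y)) hp
    (by rw [Measure.map_map measurable_fst (hf.prodMk hg), ← h₁]; rfl)
    (by rw [Measure.map_map measurable_snd (hf.prodMk hg), ← h₂]; rfl)
  rwa [lintegral_map ((measurable_edist).pow_const _) (hf.prodMk hg)] at h

theorem wasserstein_self (hp : 1 ≤ p) (μ : ProbabilityMeasure X) : wasserstein p μ μ = 0 := by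
  have h := wasserstein_le_of_maps (ρ := (μ : Measure X)) (μ := μ) (ν := μ) hp
    measurable_id measurable_id Measure.map_id Measure.map_id
  have hp0 : 0 < p := by linarith
  simpa [ENNReal.zero_rpow_of_pos, hp0] using h

theorem wasserstein_comm_le (hp : 1 ≤ p) (μ ν : ProbabilityMeasure X) :
    wasserstein p μ ν ≤ wasserstein p ν μ := by
  rw [wasserstein_eq_iInf hp ν μ]
  refine le_iInf fun π => ?_
  have h := wasserstein_le_of_maps (ρ := π.1) (μ := μ) (ν := ν) hp
    measurable_snd measurable_fst π.2.2 π.2.1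
  simpa only [edist_comm] using h

theorem wasserstein_comm (hp : 1 ≤ p) (μ ν : ProbabilityMeasure X) :
    wasserstein p μ ν = wasserstein p ν μ :=
  le_antisymm (wasserstein_comm_le hp μ ν) (wasserstein_comm_le hp ν μ)

/-- The triangle inequality, by gluing of couplings. -/
theorem wasserstein_triangle [StandardBorelSpace X] [Nonempty X] (hp : 1 ≤ p)
    (μ₁ μ₂ μ₃ : ProbabilityMeasure X) :
    wasserstein p μ₁ μ₃ ≤ wasserstein p μ₁ μ₂ + wasserstein p μ₂ μ₃ := by
  rw [wasserstein_eq_iInf hp μ₁ μ₂, wasserstein_eq_iInf hp μ₂ μ₃]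
  refine ENNReal.le_iInf_add_iInf fun π σ => ?_
  obtain ⟨π, hπ₁, hπ₂⟩ := π
  obtain ⟨σ, hσ₁, hσ₂⟩ := σ
  have : IsProbabilityMeasure π := by
    have : IsProbabilityMeasure (π.map Prod.fst) := by rw [hπ₁]; infer_instance
    exact Measure.isProbabilityMeasure_of_map Prod.fst
  have : IsProbabilityMeasure σ := by
    have : IsProbabilityMeasure (σ.map Prod.fst) := by rw [hσ₁]; infer_instance
    exact Measure.isProbabilityMeasure_of_map Prod.fst
  -- Disintegrate `σ` over its first marginal `μ₂`. Under `γ` the pair `(x, y)` has law `π`, and `z`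
  -- is drawn from the conditional law given `y`, independently of `x`.
  let κ := σ.condKernel
  have hσ : (μ₂ : Measure X).compProd κ = σ := by
    rw [← hσ₁]; exact σ.disintegrate σ.condKernel
  let γ : Measure ((X × X) × X) := π.compProd (κ.prodMkLeft X)
  have h12 : γ.map Prod.fst = π := Measure.fst_compProd _ _
  have h23 : γ.map (fun w => (w.1.2, w.2)) = σ := by
    refine Measure.ext_of_lintegral _ fun f hf => ?_
    rw [lintegral_map hf (by fun_prop), Measure.lintegral_compProd (by fun_prop), ← hσ,
      Measure.lintegral_compProd hf, ← hπ₂,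
      lintegral_map (Measurable.lintegral_kernel_prod_right' hf) measurable_snd]
    rfl
  have hm1 : γ.map (fun w => w.1.1) = (μ₁ : Measure X) := by
    rw [← hπ₁, ← h12, Measure.map_map measurable_fst measurable_fst]; rfl
  have hm3 : γ.map (fun w => w.2) = (μ₃ : Measure X) := by
    rw [← hσ₂, ← h23, Measure.map_map measurable_snd (by fun_prop)]; rfl
  have hmeas : Measurable fun z : X × X => edist z.1 z.2 := measurable_edist
  calc wasserstein p μ₁ μ₃
      ≤ (∫⁻ w, edist w.1.1 w.2 ^ p ∂γ) ^ (1 / p) :=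
        wasserstein_le_of_maps hp (by fun_prop) (by fun_prop) hm1 hm3
    _ ≤ (∫⁻ w, ((fun w : (X × X) × X => edist w.1.1 w.1.2) +
          fun w : (X × X) × X => edist w.1.2 w.2) w ^ p ∂γ)
          ^ (1 / p) := by
        gcongr
        exact edist_triangle _ _ _
    _ ≤ (∫⁻ w, edist w.1.1 w.1.2 ^ p ∂γ) ^ (1 / p) + (∫⁻ w, edist w.1.2 w.2 ^ p ∂γ) ^ (1 / p) :=
        ENNReal.lintegral_Lp_add_le (hmeas.comp measurable_fst).aemeasurable
          (hmeas.comp (by fun_prop : Measurable fun w : (X × X) × X => (w.1.2, w.2))).aemeasurable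
          hp
    _ = _ := by
        congr 2
        · change _ = ∫⁻ z, edist z.1 z.2 ^ p ∂π
          rw [← h12, lintegral_map (hmeas.pow_const _) measurable_fst]
        · change _ = ∫⁻ z, edist z.1 z.2 ^ p ∂σ
          rw [← h23, lintegral_map (hmeas.pow_const _) (by fun_prop)]

/-- Integrals of Lipschitz functions are Lipschitz in the Wasserstein distance. -/
theorem abs_integral_sub_integral_le_wasserstein (hp : 1 ≤ p) {μ ν : ProbabilityMeasure X}
    {G : X → ℝ} {L w : ℝ} (hL : 0 ≤ L) (hG : ∀ x y, |G x - G y| ≤ L * dist x y) (hw : 0 ≤ w)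
    (hbd : ∃ C, ∀ x, |G x| ≤ C) (h : wasserstein p μ ν ≤ ENNReal.ofReal w) :
    |∫ x, G x ∂(μ : Measure X) - ∫ x, G x ∂(ν : Measure X)| ≤ L * w := by
  obtain ⟨C, hC⟩ := hbd
  have hcont : Continuous G :=
    (LipschitzWith.of_dist_le_mul (K := ⟨L, hL⟩) fun x y => by
      rw [Real.dist_eq]; exact hG x y).continuous
  have hp0 : 0 < p := by linarith
  refine le_of_forall_pos_le_add fun ε hε => ?_
  -- A nearly optimal coupling suffices: the slack `ε / (L + 1)` costs at most `ε` after
  -- multiplication by `L`.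
  have h1 : wasserstein p μ ν < ENNReal.ofReal (w + ε / (L + 1)) :=
    h.trans_lt ((ENNReal.ofReal_lt_ofReal_iff (by positivity)).2 (by
      have : 0 < ε / (L + 1) := by positivity
      linarith))
  rw [wasserstein_eq_iInf hp] at h1
  obtain ⟨⟨π, hπ₁, hπ₂⟩, hπ⟩ := iInf_lt_iff.1 h1
  have : IsProbabilityMeasure π := by
    have : IsProbabilityMeasure (π.map Prod.fst) := by rw [hπ₁]; infer_instance
    exact Measure.isProbabilityMeasure_of_map Prod.fst
  have hmeas : Measurable fun z : X × X => edist z.1 z.2 := measurable_edist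
  have h2 : ∫⁻ z, edist z.1 z.2 ∂π ≤ (∫⁻ z, edist z.1 z.2 ^ p ∂π) ^ (1 / p) := by
    have h3 := eLpNorm'_le_eLpNorm'_of_exponent_le (μ := π) (f := fun z : X × X => dist z.1 z.2)
      zero_lt_one hp (measurable_dist.aestronglyMeasurable)
    simp only [eLpNorm'] at h3
    have h4 : ∀ z : X × X, ‖dist z.1 z.2‖ₑ = edist z.1 z.2 := fun z => by
      rw [edist_dist, Real.enorm_eq_ofReal dist_nonneg]
    simpa [h4] using h3
  have h3 : ∫⁻ z, edist z.1 z.2 ∂π < ENNReal.ofReal (w + ε / (L + 1)) := h2.trans_lt hπ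
  have hint : Integrable (fun z : X × X => dist z.1 z.2) π := by
    refine ⟨measurable_dist.aestronglyMeasurable, ?_⟩
    rw [hasFiniteIntegral_iff_edist]
    simp only [edist_zero_right]
    have h4 : ∀ z : X × X, ‖dist z.1 z.2‖ₑ = edist z.1 z.2 := fun z => by
      rw [edist_dist, Real.enorm_eq_ofReal dist_nonneg]
    simp only [h4]
    exact h3.trans ENNReal.ofReal_lt_top
  have h4 : ∫ z, dist z.1 z.2 ∂π ≤ w + ε / (L + 1) := by
    rw [integral_eq_lintegral_of_nonneg_ae (ae_of_all _ fun _ => dist_nonneg)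
      measurable_dist.aestronglyMeasurable]
    simp only [← edist_dist]
    exact (ENNReal.toReal_le_of_le_ofReal (by positivity) h3.le)
  have hi1 : Integrable (fun z : X × X => G z.1) π :=
    Integrable.of_bound (hcont.comp continuous_fst).measurable.aestronglyMeasurable C
      (ae_of_all _ fun z => hC z.1)
  have hi2 : Integrable (fun z : X × X => G z.2) π :=
    Integrable.of_bound (hcont.comp continuous_snd).measurable.aestronglyMeasurable C
      (ae_of_all _ fun z => hC z.2)
  rw [← hπ₁, ← hπ₂, integral_map measurable_fst.aemeasurable hcont.aestronglyMeasurable,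
    integral_map measurable_snd.aemeasurable hcont.aestronglyMeasurable, ← integral_sub hi1 hi2]
  calc |∫ z, G z.1 - G z.2 ∂π| ≤ ∫ z, |G z.1 - G z.2| ∂π := abs_integral_le_integral_abs
    _ ≤ ∫ z, L * dist z.1 z.2 ∂π :=
        integral_mono (hi1.sub hi2).abs (hint.const_mul L) fun z => hG _ _
    _ = L * ∫ z, dist z.1 z.2 ∂π := integral_const_mul _ _
    _ ≤ L * (w + ε / (L + 1)) := by gcongr
    _ ≤ L * w + ε := by
        have : L * (ε / (L + 1)) ≤ ε := by
          rw [← mul_div_assoc, div_le_iff₀ (by positivity)]; nlinarith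
        linarith

end Wasserstein

end

section

/-! ### Mollification -/

section Mollification

variable {d : ℕ}

/-- A bump function with support in the ball of radius `ε`. -/
def bump (d : ℕ) (ε : ℝ) (hε : 0 < ε) : ContDiffBump (0 : E d) :=
  ⟨ε / 2, ε, half_pos hε, half_lt_self hε⟩

/-- Mollification at scale `ε`. -/
def mollify (ε : ℝ) (hε : 0 < ε) (f : E d → ℝ) : E d → ℝ :=
  convolution ((bump d ε hε).normed volume) f (ContinuousLinearMap.lsmul ℝ ℝ) volume

variable {ε : ℝ} {hε : 0 < ε} {f g : E d → ℝ}

theorem mollify_apply (x : E d) :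
    mollify ε hε f x = ∫ z, (bump d ε hε).normed volume z * f (x - z) := by
  simp [mollify, convolution, smul_eq_mul]

theorem integrable_bump_mul (hf : Continuous f) (x : E d) :
    Integrable fun z => (bump d ε hε).normed volume z * f (x - z) := by
  refine Continuous.integrable_of_hasCompactSupport ?_ ?_
  · exact (bump d ε hε).continuous_normed.mul (hf.comp (by fun_prop))
  · exact (bump d ε hε).hasCompactSupport_normed.mul_right

/-- The kernel is a probability density supported in the ball of radius `ε`, so a bound valid for
all shifts of size at most `ε` survives averaging. The sup bound, the Lipschitz bound, the closeness
to `f` and the commutator with a flow all come from this estimate. -/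
theorem abs_mollify_sub_mollify_le (hf : Continuous f) (hg : Continuous g) {x y : E d} {b : ℝ}
    (h : ∀ z, ‖z‖ ≤ ε → |f (x - z) - g (y - z)| ≤ b) :
    |mollify ε hε f x - mollify ε hε g y| ≤ b := by
  rw [mollify_apply, mollify_apply,
    ← integral_sub (integrable_bump_mul hf x) (integrable_bump_mul hg y)]
  have h1 : ∀ z, |(bump d ε hε).normed volume z * f (x - z) -
      (bump d ε hε).normed volume z * g (y - z)| ≤ (bump d ε hε).normed volume z * b := by
    intro z
    rw [← mul_sub, abs_mul, abs_of_nonneg ((bump d ε hε).nonneg_normed z)]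
    by_cases hz : ‖z‖ ≤ ε
    · exact mul_le_mul_of_nonneg_left (h z hz) ((bump d ε hε).nonneg_normed z)
    · have : (bump d ε hε).normed volume z = 0 := by
        have h2 : z ∉ Function.support ((bump d ε hε).normed (volume : Measure (E d))) := by
          rw [ContDiffBump.support_normed_eq]
          simp only [Metric.mem_ball, dist_zero_right, not_lt]
          exact (not_le.1 hz).le
        simpa using h2
      simp [this]
  calc _ ≤ ∫ z, |(bump d ε hε).normed volume z * f (x - z) -
      (bump d ε hε).normed volume z * g (y - z)| := abs_integral_le_integral_abs
    _ ≤ ∫ z, (bump d ε hε).normed volume z * b :=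
        integral_mono ((integrable_bump_mul hf x).sub (integrable_bump_mul hg y)).abs
          ((bump d ε hε).integrable_normed.mul_const b) h1
    _ = b := by rw [integral_mul_const, ContDiffBump.integral_normed, one_mul]

theorem mollify_const (c : ℝ) (x : E d) : mollify ε hε (fun _ => c) x = c := by
  rw [mollify_apply, integral_mul_const, ContDiffBump.integral_normed, one_mul]

theorem abs_mollify_le (hf : Continuous f) {C : ℝ} (h : ∀ x, |f x| ≤ C) (x : E d) :
    |mollify ε hε f x| ≤ C := by
  have h1 := abs_mollify_sub_mollify_le (hε := hε) (x := x) (y := x) hf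
    (continuous_const (y := (0 : ℝ))) (b := C) (fun z _ => by simpa using h _)
  rwa [mollify_const, sub_zero] at h1

theorem abs_mollify_sub_le {K : NNReal} (hf : LipschitzWith K f) (x : E d) :
    |mollify ε hε f x - f x| ≤ K * ε := by
  have h1 := abs_mollify_sub_mollify_le (hε := hε) (x := x) (y := x) hf.continuous
    (continuous_const (y := f x)) (b := K * ε) (fun z hz => by
      have := hf.dist_le_mul (x - z) x
      rw [Real.dist_eq] at this
      refine this.trans ?_
      simp only [dist_eq_norm, sub_sub_cancel_left, norm_neg]
      gcongr)
  rwa [mollify_const] at h1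

theorem lipschitzWith_mollify {K : NNReal} (hf : LipschitzWith K f) :
    LipschitzWith K (mollify ε hε f) :=
  LipschitzWith.of_dist_le_mul fun x y => by
    rw [Real.dist_eq]
    refine abs_mollify_sub_mollify_le hf.continuous hf.continuous fun z _ => ?_
    have := hf.dist_le_mul (x - z) (y - z)
    rwa [Real.dist_eq, dist_sub_right] at this

theorem contDiff_mollify (hf : Continuous f) : ContDiff ℝ ∞ (mollify ε hε f) :=
  (bump d ε hε).hasCompactSupport_normed.contDiff_convolution_left _
    (bump d ε hε).contDiff_normed hf.locallyIntegrable

theorem hasCompactSupport_mollify (hf : HasCompactSupport f) :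
    HasCompactSupport (mollify ε hε f) :=
  (bump d ε hε).hasCompactSupport_normed.convolution _ hf

theorem mollify_add_of_periodic {k : E d} (hf : ∀ x, f (x + k) = f x) (x : E d) :
    mollify ε hε f (x + k) = mollify ε hε f x := by
  simp only [mollify_apply, add_sub_right_comm, hf]

/-- The total derivative of the kernel of `mollify ε`. -/
def fderivBump (d : ℕ) (ε : ℝ) (hε : 0 < ε) : E d → E d →L[ℝ] ℝ :=
  fderiv ℝ ((bump d ε hε).normed volume)

theorem continuous_fderivBump : Continuous (fderivBump d ε hε) :=
  ((bump d ε hε).contDiff_normed (n := 1) (μ := volume)).continuous_fderiv one_ne_zero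

theorem hasCompactSupport_fderivBump : HasCompactSupport (fderivBump d ε hε) :=
  (bump d ε hε).hasCompactSupport_normed.fderiv ℝ

theorem fderiv_mollify (hf : Continuous f) (x : E d) :
    fderiv ℝ (mollify ε hε f) x = ∫ z, f (x - z) • fderivBump d ε hε z := by
  have h := ((bump d ε hε).hasCompactSupport_normed (μ := volume)).hasFDerivAt_convolution_left
    (μ := volume) (ContinuousLinearMap.lsmul ℝ ℝ) (bump d ε hε).contDiff_normed
    (hf.locallyIntegrable (μ := volume)) x
  rw [mollify, h.fderiv, convolution]
  refine integral_congr_ae (ae_of_all _ fun z => ?_)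
  ext v
  simp [mul_comm, fderivBump]

/-- The derivative falls on the kernel, so only the Lipschitz constant of `f` is needed. The
constant depends on `ε` without control, which is harmless because it multiplies only second-order
terms in the time step. -/
theorem norm_fderiv_mollify_sub_le {K : NNReal} (hf : LipschitzWith K f) (x y : E d) :
    ‖fderiv ℝ (mollify ε hε f) x - fderiv ℝ (mollify ε hε f) y‖ ≤
      (K * ∫ z, ‖fderivBump d ε hε z‖) * ‖x - y‖ := by
  have hint : ∀ x : E d, Integrable fun z => f (x - z) • fderivBump d ε hε z := fun x => by
    have h1 : Continuous fun z => f (x - z) := hf.continuous.comp (continuous_const.sub continuous_id)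
    have h2 : Continuous fun z => f (x - z) • fderivBump d ε hε z := h1.smul continuous_fderivBump
    have h3 : HasCompactSupport fun z => f (x - z) • fderivBump d ε hε z :=
      hasCompactSupport_fderivBump.mono fun z hz h0 => hz (by
        change f (x - z) • fderivBump d ε hε z = 0
        rw [show fderivBump d ε hε z = 0 from h0, smul_zero])
    exact h2.integrable_of_hasCompactSupport h3
  have hint' : Integrable fun z => ‖fderivBump d ε hε z‖ :=
    (continuous_fderivBump.integrable_of_hasCompactSupport hasCompactSupport_fderivBump).norm
  rw [fderiv_mollify hf.continuous, fderiv_mollify hf.continuous, ← integral_sub (hint x) (hint y)]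
  calc _ ≤ ∫ z, (K * ‖x - y‖) * ‖fderivBump d ε hε z‖ := by
        refine norm_integral_le_of_norm_le (hint'.const_mul _) (ae_of_all _ fun z => ?_)
        have h0 : f (x - z) • fderivBump d ε hε z - f (y - z) • fderivBump d ε hε z =
          (f (x - z) - f (y - z)) • fderivBump d ε hε z := (sub_smul _ _ _).symm
        rw [h0, norm_smul]
        gcongr
        have := hf.dist_le_mul (x - z) (y - z)
        rwa [dist_sub_right, dist_eq_norm, dist_eq_norm] at this
    _ = _ := by rw [integral_const_mul]; ring

end Mollification

end

section

/-! ### Flows of Lipschitz vector fields that are measurable in time -/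

section Flow

variable {d : ℕ}

/-- A time-dependent vector field, measurable in time, and bounded and Lipschitz in space with
constants `β r` that are small in `L¹`. -/
structure IsCaratheodoryField (V : ℝ → E d → E d) (β : ℝ → ℝ) : Prop where
  lipschitz : ∀ r x y, ‖V r x - V r y‖ ≤ β r * ‖x - y‖
  norm_le : ∀ r x, ‖V r x‖ ≤ β r
  measurable : ∀ x, Measurable fun r => V r x
  integrable : Integrable β
  integral_le : ∫ r, β r ≤ 1 / 2

namespace IsCaratheodoryField

variable {V W : ℝ → E d → E d} {β β' : ℝ → ℝ}

theorem nonneg (hV : IsCaratheodoryField V β) (r : ℝ) : 0 ≤ β r :=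
  (norm_nonneg _).trans (hV.norm_le r 0)

theorem continuous (hV : IsCaratheodoryField V β) (r : ℝ) : Continuous (V r) :=
  (LipschitzWith.of_dist_le_mul (K := ⟨β r, hV.nonneg r⟩) fun x y => by
    rw [dist_eq_norm, dist_eq_norm]; exact hV.lipschitz r x y).continuous

theorem measurable_uncurry (hV : IsCaratheodoryField V β) :
    Measurable fun z : ℝ × E d => V z.1 z.2 :=
  (measurable_uncurry_of_continuous_of_measurable (u := fun x r => V r x) hV.continuous
    hV.measurable).comp measurable_swap

theorem integrable_comp (hV : IsCaratheodoryField V β) {γ : ℝ → E d} (hγ : Measurable γ) :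
    Integrable fun r => V r (γ r) :=
  hV.integrable.mono' (hV.measurable_uncurry.comp (measurable_id.prodMk hγ)).aestronglyMeasurable
    (ae_of_all _ fun r => hV.norm_le r _)

theorem intervalIntegral_le (hV : IsCaratheodoryField V β) {s r : ℝ} (h : s ≤ r) :
    ∫ u in s..r, β u ≤ 1 / 2 := by
  rw [intervalIntegral.integral_of_le h]
  exact (setIntegral_le_integral hV.integrable (ae_of_all _ hV.nonneg)).trans hV.integral_le

theorem norm_integral_le (hV : IsCaratheodoryField V β) {f : ℝ → E d} {c : ℝ} (hc : 0 ≤ c)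
    (hf : ∀ r, ‖f r‖ ≤ β r * c) (s r : ℝ) : ‖∫ u in s..r, f u‖ ≤ 1 / 2 * c := by
  calc ‖∫ u in s..r, f u‖ ≤ ∫ u in uIoc s r, ‖f u‖ :=
        intervalIntegral.norm_integral_le_integral_norm_uIoc
    _ ≤ ∫ u in uIoc s r, β u * c := by
        refine integral_mono_of_nonneg (ae_of_all _ fun _ => norm_nonneg _)
          (hV.integrable.mul_const c).integrableOn (ae_of_all _ hf)
    _ ≤ ∫ u, β u * c := setIntegral_le_integral (hV.integrable.mul_const c)
        (ae_of_all _ fun u => mul_nonneg (hV.nonneg u) hc)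
    _ ≤ 1 / 2 * c := by
        rw [integral_mul_const]; exact mul_le_mul_of_nonneg_right hV.integral_le hc

theorem continuous_primitive (hV : IsCaratheodoryField V β) {γ : ℝ → E d} (hγ : Measurable γ)
    (s : ℝ) (x : E d) : Continuous fun r => x + ∫ u in s..r, V u (γ u) :=
  continuous_const.add (intervalIntegral.continuous_primitive
    (fun _ _ => (hV.integrable_comp hγ).intervalIntegrable) s)

/-- The Picard operator on bounded continuous curves. -/
def picard (hV : IsCaratheodoryField V β) (s : ℝ) (x : E d)
    (γ : BoundedContinuousFunction ℝ (E d)) : BoundedContinuousFunction ℝ (E d) :=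
  BoundedContinuousFunction.ofNormedAddCommGroup (fun r => x + ∫ u in s..r, V u (γ u))
    (hV.continuous_primitive γ.continuous.measurable s x) (‖x‖ + 1 / 2 * 1) fun r =>
    (norm_add_le _ _).trans (add_le_add le_rfl (hV.norm_integral_le zero_le_one
      (fun u => by rw [mul_one]; exact hV.norm_le u _) s r))

theorem picard_apply (hV : IsCaratheodoryField V β) (s : ℝ) (x : E d)
    (γ : BoundedContinuousFunction ℝ (E d)) (r : ℝ) :
    hV.picard s x γ r = x + ∫ u in s..r, V u (γ u) := rfl

theorem norm_integral_sub_le (hV : IsCaratheodoryField V β) {γ γ' : ℝ → E d} (hγ : Measurable γ)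
    (hγ' : Measurable γ') {c : ℝ} (hc : 0 ≤ c) (h : ∀ r, ‖γ r - γ' r‖ ≤ c) (s r : ℝ) :
    ‖(∫ u in s..r, V u (γ u)) - ∫ u in s..r, V u (γ' u)‖ ≤ 1 / 2 * c := by
  rw [← intervalIntegral.integral_sub (hV.integrable_comp hγ).intervalIntegrable
    (hV.integrable_comp hγ').intervalIntegrable]
  exact hV.norm_integral_le hc (fun u => (hV.lipschitz u _ _).trans
    (mul_le_mul_of_nonneg_left (h u) (hV.nonneg u))) s r

/-- Because the total integral of `β` is at most `1/2`, the Picard operator contracts on the whole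
time axis in the unweighted sup norm, forwards and backwards from `s` at once. -/
theorem contracting_picard (hV : IsCaratheodoryField V β) (s : ℝ) (x : E d) :
    ContractingWith (1 / 2) (hV.picard s x) := by
  refine ⟨by rw [← NNReal.coe_lt_coe]; norm_num, LipschitzWith.of_dist_le_mul fun γ γ' => ?_⟩
  rw [BoundedContinuousFunction.dist_le (by positivity)]
  intro r
  rw [picard_apply, picard_apply, dist_add_left, dist_eq_norm]
  have := hV.norm_integral_sub_le γ.continuous.measurable γ'.continuous.measurable
    (dist_nonneg (x := γ) (y := γ'))
    (fun r => by rw [← dist_eq_norm]; exact BoundedContinuousFunction.dist_coe_le_dist r) s r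
  simpa using this

/-- The flow: `hV.flow s r x` is the position at time `r` of the particle which is in `x` at
time `s`. -/
def flow (hV : IsCaratheodoryField V β) (s r : ℝ) (x : E d) : E d :=
  ContractingWith.fixedPoint _ (hV.contracting_picard s x) r

theorem continuous_flow_time (hV : IsCaratheodoryField V β) (s : ℝ) (x : E d) :
    Continuous fun r => hV.flow s r x :=
  (ContractingWith.fixedPoint _ (hV.contracting_picard s x)).continuous

theorem flow_eq (hV : IsCaratheodoryField V β) (s r : ℝ) (x : E d) :
    hV.flow s r x = x + ∫ u in s..r, V u (hV.flow s u x) := by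
  have h := ContractingWith.fixedPoint_isFixedPt (hV.contracting_picard s x)
  have h2 := congrArg (fun γ : BoundedContinuousFunction ℝ (E d) => γ r) h
  exact h2.symm

/-- A continuous solution of the integral equation is automatically bounded, hence is the fixed
point of the Picard operator. This uniqueness yields the composition law and the commutation with
periods. -/
theorem eq_flow (hV : IsCaratheodoryField V β) {s : ℝ} {x : E d} {γ : ℝ → E d}
    (hγ : Continuous γ) (h : ∀ r, γ r = x + ∫ u in s..r, V u (γ u)) (r : ℝ) :
    γ r = hV.flow s r x := by
  let γ' : BoundedContinuousFunction ℝ (E d) :=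
    BoundedContinuousFunction.ofNormedAddCommGroup γ hγ (‖x‖ + 1 / 2 * 1) fun r => by
      rw [h r]
      exact (norm_add_le _ _).trans (add_le_add le_rfl (hV.norm_integral_le zero_le_one
        (fun u => by rw [mul_one]; exact hV.norm_le u _) s r))
  have h1 : Function.IsFixedPt (hV.picard s x) γ' := by
    ext1 r
    exact (h r).symm
  have h2 := ContractingWith.fixedPoint_unique (hV.contracting_picard s x) h1
  exact congrArg (fun γ : BoundedContinuousFunction ℝ (E d) => γ r) h2

theorem flow_self (hV : IsCaratheodoryField V β) (s : ℝ) (x : E d) : hV.flow s s x = x := by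
  rw [flow_eq]; simp

theorem integrable_flow (hV : IsCaratheodoryField V β) (s : ℝ) (x : E d) :
    Integrable fun u => V u (hV.flow s u x) :=
  hV.integrable_comp (hV.continuous_flow_time s x).measurable

theorem flow_flow (hV : IsCaratheodoryField V β) (s r t : ℝ) (x : E d) :
    hV.flow r t (hV.flow s r x) = hV.flow s t x := by
  refine (hV.eq_flow (γ := fun t => hV.flow s t x) (hV.continuous_flow_time s x)
    (fun t => ?_) t).symm
  rw [hV.flow_eq s t, hV.flow_eq s r, add_assoc, intervalIntegral.integral_add_adjacent_intervals
    (hV.integrable_flow s x).intervalIntegrable (hV.integrable_flow s x).intervalIntegrable]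

theorem flow_add_of_periodic (hV : IsCaratheodoryField V β) {k : E d}
    (hk : ∀ r x, V r (x + k) = V r x) (s r : ℝ) (x : E d) :
    hV.flow s r (x + k) = hV.flow s r x + k := by
  refine (hV.eq_flow (γ := fun r => hV.flow s r x + k)
    ((hV.continuous_flow_time s x).add continuous_const) (fun r => ?_) r).symm
  simp only [hk]
  rw [add_right_comm, ← hV.flow_eq]

/-- The two fixed points satisfy `dist ≤ ‖x - y‖ + dist / 2`, and absorbing the last term gives the
factor `2`. -/
theorem norm_flow_sub_flow_le (hV : IsCaratheodoryField V β) (s r : ℝ) (x y : E d) :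
    ‖hV.flow s r x - hV.flow s r y‖ ≤ 2 * ‖x - y‖ := by
  set γ := ContractingWith.fixedPoint _ (hV.contracting_picard s x) with hγ
  set γ' := ContractingWith.fixedPoint _ (hV.contracting_picard s y) with hγ'
  have h1 : dist γ γ' ≤ ‖x - y‖ + 1 / 2 * dist γ γ' := by
    rw [BoundedContinuousFunction.dist_le (by positivity)]
    intro r
    have h2 : γ r = x + ∫ u in s..r, V u (γ u) := hV.flow_eq s r x
    have h3 : γ' r = y + ∫ u in s..r, V u (γ' u) := hV.flow_eq s r y
    rw [h2, h3, dist_eq_norm, add_sub_add_comm]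
    refine (norm_add_le _ _).trans (add_le_add le_rfl ?_)
    exact hV.norm_integral_sub_le γ.continuous.measurable γ'.continuous.measurable dist_nonneg
      (fun r => by rw [← dist_eq_norm]; exact BoundedContinuousFunction.dist_coe_le_dist r) s r
  have h2 : dist (γ r) (γ' r) ≤ dist γ γ' := BoundedContinuousFunction.dist_coe_le_dist r
  rw [dist_eq_norm] at h2
  change ‖γ r - γ' r‖ ≤ _
  linarith

theorem lipschitzWith_flow (hV : IsCaratheodoryField V β) (s r : ℝ) :
    LipschitzWith 2 (hV.flow s r) :=
  LipschitzWith.of_dist_le_mul fun x y => by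
    rw [dist_eq_norm, dist_eq_norm]; exact hV.norm_flow_sub_flow_le s r x y

theorem measurable_flow (hV : IsCaratheodoryField V β) (s : ℝ) :
    Measurable fun z : ℝ × E d => hV.flow s z.1 z.2 :=
  measurable_uncurry_of_continuous_of_measurable (u := fun r x => hV.flow s r x)
    (hV.continuous_flow_time s) fun r => (hV.lipschitzWith_flow s r).continuous.measurable

theorem norm_intervalIntegral_le (hV : IsCaratheodoryField V β) {f : ℝ → E d} {c s r : ℝ}
    (hsr : s ≤ r) (hf : ∀ u ∈ Icc s r, ‖f u‖ ≤ β u * c) :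
    ‖∫ u in s..r, f u‖ ≤ (∫ u in s..r, β u) * c := by
  rw [← intervalIntegral.integral_mul_const]
  refine intervalIntegral.norm_integral_le_of_norm_le hsr (ae_of_all _ fun u hu =>
    hf u (Ioc_subset_Icc_self hu)) (hV.integrable.mul_const c).intervalIntegrable

theorem norm_flow_sub_le (hV : IsCaratheodoryField V β) {s r : ℝ} (hsr : s ≤ r) (x : E d) :
    ‖hV.flow s r x - x‖ ≤ ∫ u in s..r, β u := by
  rw [flow_eq, add_sub_cancel_left]
  have := hV.norm_intervalIntegral_le (f := fun u => V u (hV.flow s u x)) (c := 1) hsr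
    fun u _ => by rw [mul_one]; exact hV.norm_le u _
  rwa [mul_one] at this

/-- A displacement bound that is uniform in the point and valid in both time directions; it keeps
compact supports compact under composition with the flow. -/
theorem norm_flow_sub_half (hV : IsCaratheodoryField V β) (s r : ℝ) (x : E d) :
    ‖hV.flow s r x - x‖ ≤ 1 / 2 := by
  rw [flow_eq, add_sub_cancel_left]
  have := hV.norm_integral_le (f := fun u => V u (hV.flow s u x)) zero_le_one
    (fun u => by rw [mul_one]; exact hV.norm_le u _) s r
  rwa [mul_one] at this

theorem intervalIntegral_mono (hV : IsCaratheodoryField V β) {s u r : ℝ} (hsu : s ≤ u)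
    (hur : u ≤ r) : ∫ v in s..u, β v ≤ ∫ v in s..r, β v :=
  intervalIntegral.integral_mono_interval le_rfl hsu hur (ae_of_all _ hV.nonneg)
    hV.integrable.intervalIntegrable

/-- The displacement of the flow is Lipschitz with a small constant. -/
theorem norm_displacement_sub_le (hV : IsCaratheodoryField V β) {s r : ℝ} (hsr : s ≤ r)
    (x y : E d) : ‖(hV.flow s r x - x) - (hV.flow s r y - y)‖ ≤
      (∫ u in s..r, β u) * (2 * ‖x - y‖) := by
  rw [hV.flow_eq s r x, hV.flow_eq s r y, add_sub_cancel_left, add_sub_cancel_left,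
    ← intervalIntegral.integral_sub (hV.integrable_flow s x).intervalIntegrable
    (hV.integrable_flow s y).intervalIntegrable]
  exact hV.norm_intervalIntegral_le hsr fun u _ => (hV.lipschitz u _ _).trans
    (mul_le_mul_of_nonneg_left (hV.norm_flow_sub_flow_le s u x y) (hV.nonneg u))

/-- The displacement of the flow is that of the Euler scheme up to second order. -/
theorem norm_displacement_sub_euler_le (hV : IsCaratheodoryField V β) {s r : ℝ} (hsr : s ≤ r)
    (x : E d) : ‖(hV.flow s r x - x) - ∫ u in s..r, V u x‖ ≤ (∫ u in s..r, β u) ^ 2 := by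
  rw [hV.flow_eq s r x, add_sub_cancel_left, ← intervalIntegral.integral_sub
    (hV.integrable_flow s x).intervalIntegrable
    (hV.integrable_comp measurable_const).intervalIntegrable, sq]
  exact hV.norm_intervalIntegral_le hsr fun u hu => (hV.lipschitz u _ _).trans
    (mul_le_mul_of_nonneg_left ((hV.norm_flow_sub_le hu.1 x).trans
      (hV.intervalIntegral_mono hu.1 hu.2)) (hV.nonneg u))

/-- Stability of the flow with respect to the vector field. -/
theorem norm_flow_sub_flow_le_integral (hV : IsCaratheodoryField V β)
    (hW : IsCaratheodoryField W β') {t : ℝ} (ht : 0 ≤ t) (x : E d) :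
    (1 - ∫ u in 0..t, β' u) * ‖hV.flow 0 t x - hW.flow 0 t x‖ ≤
      ∫ u in 0..t, ‖V u (hV.flow 0 u x) - W u (hV.flow 0 u x)‖ := by
  have hc : Continuous fun r => ‖hV.flow 0 r x - hW.flow 0 r x‖ :=
    ((hV.continuous_flow_time 0 x).sub (hW.continuous_flow_time 0 x)).norm
  -- At the time `τ` of maximal separation `M` the Lipschitz part of the difference is at most `(∫
  -- β') M`, which is absorbed on the left instead of applying Gronwall. The remaining term compares
  -- the two fields along the flow of `V` alone.
  obtain ⟨τ, hτ, hmax⟩ := isCompact_Icc.exists_isMaxOn ⟨(0 : ℝ), le_rfl, ht⟩ hc.continuousOn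
  set M := ‖hV.flow 0 τ x - hW.flow 0 τ x‖
  have hXm := (hV.continuous_flow_time 0 x).measurable
  have hYm := (hW.continuous_flow_time 0 x).measurable
  have hi1 : Integrable fun u => V u (hV.flow 0 u x) - W u (hV.flow 0 u x) :=
    (hV.integrable_comp hXm).sub (hW.integrable_comp hXm)
  have hi2 : Integrable fun u => W u (hV.flow 0 u x) - W u (hW.flow 0 u x) :=
    (hW.integrable_comp hXm).sub (hW.integrable_comp hYm)
  have h1 : M ≤ (∫ u in 0..t, ‖V u (hV.flow 0 u x) - W u (hV.flow 0 u x)‖) +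
      (∫ u in 0..t, β' u) * M := by
    have h2 : hV.flow 0 τ x - hW.flow 0 τ x =
        (∫ u in 0..τ, (V u (hV.flow 0 u x) - W u (hV.flow 0 u x))) +
        ∫ u in 0..τ, (W u (hV.flow 0 u x) - W u (hW.flow 0 u x)) := by
      rw [← intervalIntegral.integral_add hi1.intervalIntegrable hi2.intervalIntegrable]
      simp only [sub_add_sub_cancel]
      rw [intervalIntegral.integral_sub (hV.integrable_comp hXm).intervalIntegrable
        (hW.integrable_comp hYm).intervalIntegrable, hV.flow_eq 0 τ x, hW.flow_eq 0 τ x]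
      abel
    calc M ≤ ‖∫ u in 0..τ, (V u (hV.flow 0 u x) - W u (hV.flow 0 u x))‖ +
          ‖∫ u in 0..τ, (W u (hV.flow 0 u x) - W u (hW.flow 0 u x))‖ := by
          simp only [M]; rw [h2]; exact norm_add_le _ _
      _ ≤ _ := by
          refine add_le_add ?_ ?_
          · refine (intervalIntegral.norm_integral_le_integral_norm hτ.1).trans ?_
            exact intervalIntegral.integral_mono_interval le_rfl hτ.1 hτ.2
              (ae_of_all _ fun _ => norm_nonneg _) hi1.norm.intervalIntegrable
          · refine (hW.norm_intervalIntegral_le (c := M) hτ.1 fun u hu => ?_).trans ?_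
            · exact (hW.lipschitz u _ _).trans (mul_le_mul_of_nonneg_left
                (hmax ⟨hu.1, hu.2.trans hτ.2⟩) (hW.nonneg u))
            · exact mul_le_mul_of_nonneg_right (hW.intervalIntegral_mono hτ.1 hτ.2)
                (norm_nonneg _)
  have h3 : ‖hV.flow 0 t x - hW.flow 0 t x‖ ≤ M := hmax ⟨ht, le_rfl⟩
  have h4 := hW.intervalIntegral_le ht
  calc _ ≤ (1 - ∫ u in 0..t, β' u) * M := mul_le_mul_of_nonneg_left h3 (by linarith)
    _ ≤ _ := by linarith

end IsCaratheodoryField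

end Flow

end

section

/-! ### Unfolding of the spatial domains into Euclidean space -/

section Torus

variable {R : ℝ}

theorem coe_equivIoc_torus [Fact (0 < 2 * R)] (a : ℝ) :
    ∃ k : ℤ, (AddCircle.equivIoc (2 * R) (-R) (a : AddCircle (2 * R)) : ℝ) = a + 2 * R * k := by
  have h : ((AddCircle.equivIoc (2 * R) (-R) (a : AddCircle (2 * R)) : ℝ) : AddCircle (2 * R)) =
      (a : AddCircle (2 * R)) := AddCircle.coe_equivIoc
  rw [← sub_eq_zero, ← AddCircle.coe_sub, AddCircle.coe_eq_zero_iff] at h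
  obtain ⟨k, hk⟩ := h
  refine ⟨k, ?_⟩
  rw [zsmul_eq_mul] at hk
  linarith

theorem exists_dist_coe_eq (a b : ℝ) :
    ∃ k : ℤ, |a - b - 2 * R * k| = dist (a : AddCircle (2 * R)) (b : AddCircle (2 * R)) := by
  refine ⟨round ((2 * R)⁻¹ * (a - b)), ?_⟩
  rw [dist_eq_norm, ← AddCircle.coe_sub, AddCircle.norm_eq, mul_comm (2 * R) (round _ : ℝ)]

theorem dist_coe_le (a b : ℝ) :
    dist (a : AddCircle (2 * R)) (b : AddCircle (2 * R)) ≤ |a - b| := by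
  rw [dist_eq_norm, ← AddCircle.coe_sub]
  exact QuotientAddGroup.norm_mk_le_norm

end Torus

namespace SpatialDomain

variable {d : ℕ}

instance instSecondCountableTopologyPt : (Ω : SpatialDomain d) → SecondCountableTopology Ω.Pt
  | whole => inferInstanceAs (SecondCountableTopology (E d))
  | bounded U _ => inferInstanceAs (SecondCountableTopology U)
  | torus R hR =>
      have : Fact (0 < 2 * R) := ⟨by linarith⟩
      inferInstanceAs (SecondCountableTopology (PiLp 2 (fun _ : Fin d => AddCircle (2 * R))))

instance instStandardBorelSpacePt : (Ω : SpatialDomain d) → StandardBorelSpace Ω.Pt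
  | whole => inferInstanceAs (StandardBorelSpace (E d))
  | bounded U hU => hU.isOpen.measurableSet.standardBorel
  | torus R hR =>
      have : Fact (0 < 2 * R) := ⟨by linarith⟩
      inferInstanceAs (StandardBorelSpace (PiLp 2 (fun _ : Fin d => AddCircle (2 * R))))

instance instNonemptyPt : (Ω : SpatialDomain d) → Nonempty Ω.Pt
  | whole => ⟨(0 : E d)⟩
  | bounded _ hU => hU.isConnected.nonempty.to_subtype
  | torus R _ => ⟨(WithLp.toLp 2 fun _ => 0 : PiLp 2 (fun _ : Fin d => AddCircle (2 * R)))⟩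

open Classical in
/-- A left inverse of `coord`; on the torus, the quotient map. -/
def fold : (Ω : SpatialDomain d) → E d → Ω.Pt
  | whole => fun x => x
  | bounded U hU => fun x => if h : x ∈ U then (⟨x, h⟩ : U)
      else (Classical.choice hU.isConnected.nonempty.to_subtype : U)
  | torus R _ => fun x => (WithLp.toLp 2 (fun i => ((x i : ℝ) : AddCircle (2 * R))) :
        PiLp 2 (fun _ : Fin d => AddCircle (2 * R)))

/-- The periods: those of the torus, and only `0` in the other cases. -/
def lattice : SpatialDomain d → Set (E d)
  | whole => {0}
  | bounded _ _ => {0}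
  | torus R _ => range fun k : Fin d → ℤ => WithLp.toLp 2 (fun i => 2 * R * (k i : ℝ))

/-- The points of `ℝᵈ` that represent a point of `Ω`. -/
def carrier : SpatialDomain d → Set (E d)
  | whole => univ
  | bounded U _ => U
  | torus _ _ => univ

theorem fold_coord (Ω : SpatialDomain d) (x : Ω.Pt) : Ω.fold (Ω.coord x) = x := by
  cases Ω with
  | whole => rfl
  | bounded U hU => exact dif_pos (Subtype.coe_prop (x : U))
  | torus R hR =>
    have : Fact (0 < 2 * R) := ⟨by linarith⟩
    refine PiLp.ext fun i => ?_
    exact AddCircle.coe_equivIoc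

theorem coord_mem_carrier (Ω : SpatialDomain d) (x : Ω.Pt) : Ω.coord x ∈ Ω.carrier := by
  cases Ω with
  | whole => trivial
  | bounded U hU => exact Subtype.coe_prop (x : U)
  | torus R hR => trivial

theorem measurableSet_carrier (Ω : SpatialDomain d) : MeasurableSet Ω.carrier := by
  cases Ω with
  | whole => exact MeasurableSet.univ
  | bounded U hU => exact hU.isOpen.measurableSet
  | torus R hR => exact MeasurableSet.univ

theorem coord_fold (Ω : SpatialDomain d) {y : E d} (hy : y ∈ Ω.carrier) :
    ∃ k ∈ Ω.lattice, Ω.coord (Ω.fold y) = y + k := by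
  cases Ω with
  | whole => exact ⟨0, rfl, (add_zero y).symm⟩
  | bounded U hU =>
    refine ⟨0, rfl, ?_⟩
    have h : (bounded U hU).fold y = (⟨y, hy⟩ : U) := dif_pos hy
    rw [h, add_zero]; rfl
  | torus R hR =>
    have : Fact (0 < 2 * R) := ⟨by linarith⟩
    choose k hk using fun i => coe_equivIoc_torus (R := R) (y i)
    exact ⟨_, ⟨k, rfl⟩, PiLp.ext fun i => hk i⟩

theorem dist_fold_le (Ω : SpatialDomain d) {x y : E d} (hx : x ∈ Ω.carrier)
    (hy : y ∈ Ω.carrier) : dist (Ω.fold x) (Ω.fold y) ≤ dist x y := by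
  cases Ω with
  | whole => exact le_rfl
  | bounded U hU =>
    have h1 : (bounded U hU).fold x = (⟨x, hx⟩ : U) := dif_pos hx
    have h2 : (bounded U hU).fold y = (⟨y, hy⟩ : U) := dif_pos hy
    rw [h1, h2]; exact le_rfl
  | torus R hR =>
    change dist (WithLp.toLp 2 (fun i => ((x i : ℝ) : AddCircle (2 * R))) :
      PiLp 2 (fun _ : Fin d => AddCircle (2 * R)))
      (WithLp.toLp 2 (fun i => ((y i : ℝ) : AddCircle (2 * R)))) ≤ _
    rw [PiLp.dist_eq_of_L2, EuclideanSpace.dist_eq]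
    refine Real.sqrt_le_sqrt (Finset.sum_le_sum fun i _ => ?_)
    exact pow_le_pow_left₀ dist_nonneg (dist_coe_le _ _) 2

/-- On the torus the nearest period in each coordinate realizes the circle distance, and these
independent choices assemble into a single lattice vector. -/
theorem exists_lattice_dist (Ω : SpatialDomain d) (x y : Ω.Pt) :
    ∃ k ∈ Ω.lattice, ‖Ω.coord x - (Ω.coord y + k)‖ ≤ dist x y := by
  cases Ω with
  | whole => exact ⟨0, rfl, by rw [add_zero, ← dist_eq_norm]; exact le_rfl⟩
  | bounded U hU => exact ⟨0, rfl, by rw [add_zero, ← dist_eq_norm]; exact le_rfl⟩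
  | torus R hR =>
    have : Fact (0 < 2 * R) := ⟨by linarith⟩
    set a := (torus R hR).coord x
    set b := (torus R hR).coord y
    choose k hk using fun i => exists_dist_coe_eq (R := R) (a i) (b i)
    refine ⟨_, ⟨k, rfl⟩, ?_⟩
    rw [← (torus R hR).fold_coord x, ← (torus R hR).fold_coord y]
    change _ ≤ dist (WithLp.toLp 2 (fun i => ((a i : ℝ) : AddCircle (2 * R))) :
      PiLp 2 (fun _ : Fin d => AddCircle (2 * R)))
      (WithLp.toLp 2 (fun i => ((b i : ℝ) : AddCircle (2 * R))))
    rw [PiLp.dist_eq_of_L2, EuclideanSpace.norm_eq]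
    refine Real.sqrt_le_sqrt (Finset.sum_le_sum fun i _ => ?_)
    rw [← hk i, Real.norm_eq_abs]
    simp only [PiLp.sub_apply, PiLp.add_apply]
    rw [sub_add_eq_sub_sub]

theorem measurable_coord (Ω : SpatialDomain d) : Measurable Ω.coord := by
  cases Ω with
  | whole => exact measurable_id
  | bounded U hU => exact measurable_subtype_coe
  | torus R hR =>
    have : Fact (0 < 2 * R) := ⟨by linarith⟩
    refine (WithLp.measurable_toLp 2 _).comp (measurable_pi_lambda _ fun i => ?_)
    have h1 : Measurable fun a : AddCircle (2 * R) => (AddCircle.equivIoc (2 * R) (-R) a : ℝ) :=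
      measurable_subtype_coe.comp (AddCircle.measurableEquivIoc (2 * R) (-R)).measurable
    exact h1.comp ((measurable_pi_apply i).comp (WithLp.measurable_ofLp 2 _))

theorem measurable_fold (Ω : SpatialDomain d) : Measurable Ω.fold := by
  cases Ω with
  | whole => exact measurable_id
  | bounded U hU =>
    classical
    exact Measurable.dite (s := U) (f := fun x : U => x) measurable_id
      (measurable_const) hU.isOpen.measurableSet
  | torus R hR =>
    refine (WithLp.measurable_toLp 2 _).comp (measurable_pi_lambda _ fun i => ?_)
    exact (AddCircle.continuous_mk' _).measurable.comp
      ((measurable_pi_apply i).comp (WithLp.measurable_ofLp 2 _))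

theorem fold_add (Ω : SpatialDomain d) {k : E d} (hk : k ∈ Ω.lattice) (x : E d) :
    Ω.fold (x + k) = Ω.fold x := by
  cases Ω with
  | whole => rw [show k = 0 from hk, add_zero]
  | bounded U hU => rw [show k = 0 from hk, add_zero]
  | torus R hR =>
    obtain ⟨m, rfl⟩ := hk
    refine PiLp.ext fun i => ?_
    change ((x i + 2 * R * (m i : ℝ) : ℝ) : AddCircle (2 * R)) = _
    rw [AddCircle.coe_add, mul_comm (2 * R), ← zsmul_eq_mul, AddCircle.coe_zsmul,
      AddCircle.coe_period, smul_zero, add_zero]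
    rfl

instance instSFiniteVol : (Ω : SpatialDomain d) → SFinite Ω.vol
  | whole => inferInstanceAs (SFinite (volume : Measure (E d)))
  | bounded U hU =>
      have : SigmaFinite ((volume : Measure (E d)).comap (Subtype.val : U → E d)) := by
        refine SigmaFinite.of_map _ measurable_subtype_coe.aemeasurable ?_
        rw [(MeasurableEmbedding.subtype_coe hU.isOpen.measurableSet).map_comap]
        infer_instance
      inferInstanceAs (SFinite ((volume : Measure (E d)).comap (Subtype.val : U → E d)))
  | torus R _ => inferInstanceAs (SFinite (Measure.map (fun x : E d =>
      (WithLp.toLp 2 (fun i => ((x i : ℝ) : AddCircle (2 * R))) :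
        PiLp 2 (fun _ : Fin d => AddCircle (2 * R))))
      ((volume : Measure (E d)).restrict {x | ∀ i, x i ∈ Ioc (-R) R})))

/-- Needed so that a property holding for almost every point of `Ω` holds on a dense set. -/
instance instIsOpenPosMeasureVol : (Ω : SpatialDomain d) → Ω.vol.IsOpenPosMeasure
  | whole => inferInstanceAs (volume : Measure (E d)).IsOpenPosMeasure
  | bounded U hU => by
      refine ⟨fun O hO hne => ?_⟩
      change Set U at O
      change (volume.comap (Subtype.val : U → E d)) O ≠ 0
      rw [(MeasurableEmbedding.subtype_coe hU.isOpen.measurableSet).comap_apply]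
      exact ((hU.isOpen.isOpenMap_subtype_val _ hO).measure_pos _ (hne.image _)).ne'
  | torus R hR => by
      refine ⟨fun O hO hne => ?_⟩
      have hf := (torus R hR : SpatialDomain d).measurable_fold
      have hvol : (torus R hR : SpatialDomain d).vol O =
          (volume : Measure (E d)) ((torus R hR).fold ⁻¹' O ∩ {x | ∀ i, x i ∈ Ioc (-R) R}) := by
        have hm : MeasurableSet {x : E d | ∀ i, x i ∈ Ioc (-R) R} := by
          rw [ofPred_forall]
          exact MeasurableSet.iInter fun i =>
            ((measurable_pi_apply i).comp (WithLp.measurable_ofLp 2 _)) measurableSet_Ioc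
        rw [← Measure.restrict_apply (hf hO.measurableSet)]
        exact Measure.map_apply hf hO.measurableSet
      rw [hvol]
      have hcont : Continuous (torus R hR : SpatialDomain d).fold := by
        refine (PiLp.continuous_toLp 2 _).comp (continuous_pi fun i => ?_)
        exact (AddCircle.continuous_mk' _).comp (by fun_prop)
      have hOo : IsOpen ((torus R hR : SpatialDomain d).fold ⁻¹' O ∩
          {x : E d | ∀ i, x i ∈ Ioo (-R) R}) := by
        refine (hO.preimage hcont).inter ?_
        rw [ofPred_forall]
        exact isOpen_iInter_of_finite fun i => isOpen_Ioo.preimage (by fun_prop)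
      have hne' : ((torus R hR : SpatialDomain d).fold ⁻¹' O ∩
          {x : E d | ∀ i, x i ∈ Ioo (-R) R}).Nonempty := by
        obtain ⟨x, hx⟩ := hne
        have : Fact (0 < 2 * R) := ⟨by linarith⟩
        set c := (torus R hR).coord x
        have hc : ∀ i, c i ∈ Ioc (-R) R := fun i => by
          have h := (AddCircle.equivIoc (2 * R) (-R)
            (WithLp.ofLp (x : PiLp 2 fun _ : Fin d => AddCircle (2 * R)) i)).2
          exact ⟨h.1, h.2.trans_eq (by ring)⟩
        -- The representative `c` may lie on a face of the half-open cube. Scaling it by `s < 1`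
        -- moves it into the open cube, while its image stays in `O` for `s` near `1`.
        have hlim : Tendsto (fun s : ℝ => s • c) (𝓝[<] 1) (𝓝 c) := by
          have : Tendsto (fun s : ℝ => s • c) (𝓝 1) (𝓝 ((1 : ℝ) • c)) :=
            (continuous_id.smul continuous_const).tendsto 1
          rw [one_smul] at this
          exact this.mono_left nhdsWithin_le_nhds
        have h1 : ∀ᶠ s : ℝ in 𝓝[<] 1, (torus R hR : SpatialDomain d).fold (s • c) ∈ O := by
          refine hlim.eventually ((hO.preimage hcont).mem_nhds ?_)
          change (torus R hR).fold ((torus R hR).coord x) ∈ O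
          rwa [fold_coord]
        have h2 : ∀ᶠ s : ℝ in 𝓝[<] 1, s ∈ Ioo (0 : ℝ) 1 := Ioo_mem_nhdsLT one_pos
        obtain ⟨s, hs1, hs2⟩ := (h1.and h2).exists
        refine ⟨s • c, hs1, fun i => ?_⟩
        simp only [PiLp.smul_apply, smul_eq_mul]
        have := hc i
        constructor
        · nlinarith [this.1, this.2, hs2.1, hs2.2]
        · nlinarith [this.1, this.2, hs2.1, hs2.2]
      refine ((hOo.measure_pos volume hne').trans_le (measure_mono ?_)).ne'
      exact inter_subset_inter_right _ fun x hx i => Ioo_subset_Ioc_self (hx i)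

end SpatialDomain

end

section

/-! ### Lipschitz test functions -/

/-- Two finite measures on a proper metric space that have the same integrals of compactly
supported Lipschitz functions are equal. -/
theorem ext_of_integral_lipschitz {X : Type*} [MetricSpace X] [ProperSpace X] [MeasurableSpace X]
    [BorelSpace X] {m m' : Measure X} [IsProbabilityMeasure m] [IsProbabilityMeasure m']
    (h : ∀ f : X → ℝ, (∃ K, LipschitzWith K f) → HasCompactSupport f →
      ∫ x, f x ∂m = ∫ x, f x ∂m') : m = m' := by
  -- Thickened indicators of a compact set are Lipschitz, compactly supported because the space is
  -- proper, and decrease to the indicator. Exhaustion by closed balls then reaches closed sets, a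
  -- generating π-system.
  have hK : ∀ F : Set X, IsCompact F → m F = m' F := by
    intro F hF
    let δ : ℕ → ℝ := fun n => 1 / ((n : ℝ) + 1)
    have δpos : ∀ n, 0 < δ n := fun n => by positivity
    have δlim : Tendsto δ atTop (𝓝 0) := tendsto_one_div_add_atTop_nhds_zero_nat
    have h1 := tendsto_lintegral_thickenedIndicator_of_isClosed m hF.isClosed δpos δlim
    have h2 := tendsto_lintegral_thickenedIndicator_of_isClosed m' hF.isClosed δpos δlim
    have h3 : ∀ n, ∫⁻ x, (thickenedIndicator (δpos n) F x : ℝ≥0∞) ∂m =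
        ∫⁻ x, (thickenedIndicator (δpos n) F x : ℝ≥0∞) ∂m' := by
      intro n
      have hlip := lipschitzWith_thickenedIndicator (δpos n) F
      have hlip' : LipschitzWith _ fun x => (thickenedIndicator (δpos n) F x : ℝ) :=
        LipschitzWith.of_dist_le_mul fun x y => hlip.dist_le_mul x y
      have hsupp : HasCompactSupport fun x => (thickenedIndicator (δpos n) F x : ℝ) := by
        refine HasCompactSupport.intro (K := Metric.cthickening (δ n) F) hF.cthickening fun x hx => ?_
        have := thickenedIndicator_zero (δpos n) F
          (fun hh => hx (Metric.thickening_subset_cthickening _ _ hh))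
        simp [this]
      have hint : ∀ ν : Measure X, IsProbabilityMeasure ν →
          ∫⁻ x, (thickenedIndicator (δpos n) F x : ℝ≥0∞) ∂ν =
            ENNReal.ofReal (∫ x, (thickenedIndicator (δpos n) F x : ℝ) ∂ν) := by
        intro ν _
        rw [ofReal_integral_eq_lintegral_ofReal
          (hlip'.continuous.integrable_of_hasCompactSupport hsupp)
          (ae_of_all _ fun x => NNReal.coe_nonneg _)]
        simp
      rw [hint m inferInstance, hint m' inferInstance, h _ ⟨_, hlip'⟩ hsupp]
    exact tendsto_nhds_unique h1 (by simpa only [h3] using h2)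
  have hC : ∀ F : Set X, IsClosed F → m F = m' F := by
    intro F hF
    rcases isEmpty_or_nonempty X with hX | ⟨⟨x₀⟩⟩
    · simp [Set.eq_empty_of_isEmpty F]
    have hU : F = ⋃ n : ℕ, F ∩ Metric.closedBall x₀ n := by
      rw [← inter_iUnion, Metric.iUnion_closedBall_nat, inter_univ]
    have hmono : Monotone fun n : ℕ => F ∩ Metric.closedBall x₀ n := fun a b hab =>
      inter_subset_inter_right _ (Metric.closedBall_subset_closedBall (by exact_mod_cast hab))
    have h1 := tendsto_measure_iUnion_atTop (μ := m) hmono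
    have h2 := tendsto_measure_iUnion_atTop (μ := m') hmono
    rw [← hU] at h1 h2
    refine tendsto_nhds_unique h1 ?_
    have : ∀ n : ℕ, m (F ∩ Metric.closedBall x₀ n) = m' (F ∩ Metric.closedBall x₀ n) := fun n =>
      hK _ ((isCompact_closedBall _ _).inter_left hF)
    simpa only [Function.comp_def, this] using h2
  refine ext_of_generate_finite _ ?_ isPiSystem_isClosed (fun s hs => hC s hs) (by simp)
  rw [← borel_eq_generateFrom_isClosed]; exact BorelSpace.measurable_eq

namespace SpatialDomain

variable {d : ℕ}

/-- `Ω` is a torus. -/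
def IsTorus : SpatialDomain d → Prop
  | torus _ _ => True
  | _ => False

/-- Functions on `ℝᵈ` with the periods of `Ω`. -/
def IsPeriodic {Y : Type*} (Ω : SpatialDomain d) (f : E d → Y) : Prop :=
  ∀ k ∈ Ω.lattice, ∀ x, f (x + k) = f x

/-- Bounded Lipschitz functions that satisfy the spatial condition on test functions. -/
structure IsLipTest (Ω : SpatialDomain d) (K : NNReal) (f : E d → ℝ) : Prop where
  lipschitz : LipschitzWith K f
  bounded : ∃ C, ∀ x, |f x| ≤ C
  periodic : Ω.IsPeriodic f
  compact : ¬ Ω.IsTorus → HasCompactSupport f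

variable {Ω : SpatialDomain d}

/-- `coord` jumps across the faces of the cube, but a periodic function does not see the jump: the
second point may be replaced by its nearest lattice translate. -/
theorem norm_comp_coord_sub_le {Y : Type*} [SeminormedAddCommGroup Y] {F : E d → Y} {L : ℝ}
    (hL : 0 ≤ L) (hF : ∀ x y, ‖F x - F y‖ ≤ L * ‖x - y‖) (hper : Ω.IsPeriodic F) (x y : Ω.Pt) :
    ‖F (Ω.coord x) - F (Ω.coord y)‖ ≤ L * dist x y := by
  obtain ⟨k, hk, h⟩ := Ω.exists_lattice_dist x y
  rw [← hper k hk (Ω.coord y)]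
  exact (hF _ _).trans (mul_le_mul_of_nonneg_left h hL)

theorem IsPeriodic.fold {Y : Type*} {F : E d → Y} (hF : Ω.IsPeriodic F) {y : E d}
    (hy : y ∈ Ω.carrier) : F (Ω.coord (Ω.fold y)) = F y := by
  obtain ⟨k, hk, h⟩ := Ω.coord_fold hy
  rw [h, hF k hk]

namespace IsLipTest

variable {K : NNReal} {f : E d → ℝ}

theorem continuous_comp_coord (hf : Ω.IsLipTest K f) : Continuous fun x => f (Ω.coord x) :=
  (LipschitzWith.of_dist_le_mul (K := K) fun x y => by
    rw [dist_eq_norm]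
    exact norm_comp_coord_sub_le K.2 (fun x y => by
      rw [← dist_eq_norm, ← dist_eq_norm]; exact hf.lipschitz.dist_le_mul x y)
      hf.periodic x y).continuous

/-- If `Φ x` lies in the support of `f`, then `x` is within `b` of it, so compactness of the support
only needs the displacement bound. -/
theorem comp (hf : Ω.IsLipTest K f) {L : NNReal} {Φ : E d → E d} (hΦ : LipschitzWith L Φ)
    (hper : ∀ k ∈ Ω.lattice, ∀ x, Φ (x + k) = Φ x + k) {b : ℝ} (hb : ∀ x, ‖Φ x - x‖ ≤ b) :
    Ω.IsLipTest (K * L) fun x => f (Φ x) where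
  lipschitz := hf.lipschitz.comp hΦ
  bounded := let ⟨C, hC⟩ := hf.bounded; ⟨C, fun x => hC _⟩
  periodic k hk x := by beta_reduce; rw [hper k hk, hf.periodic k hk]
  compact ht := by
    obtain ⟨r, hr⟩ := (hf.compact ht).isCompact.isBounded.subset_closedBall 0
    refine HasCompactSupport.intro (isCompact_closedBall (0 : E d) (r + b)) fun x hx => ?_
    by_contra h0
    have h1 : ‖Φ x‖ ≤ r := by simpa using hr (subset_tsupport f h0)
    refine hx ?_
    rw [mem_closedBall_zero_iff]
    calc ‖x‖ = ‖Φ x - (Φ x - x)‖ := by rw [sub_sub_cancel]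
      _ ≤ ‖Φ x‖ + ‖Φ x - x‖ := norm_sub_le _ _
      _ ≤ r + b := add_le_add h1 (hb x)

theorem mollify (hf : Ω.IsLipTest K f) {ε : ℝ} (hε : 0 < ε) :
    Ω.IsLipTest K (mollify ε hε f) where
  lipschitz := lipschitzWith_mollify hf.lipschitz
  bounded := let ⟨C, hC⟩ := hf.bounded; ⟨C, abs_mollify_le hf.lipschitz.continuous hC⟩
  periodic k hk x := mollify_add_of_periodic (hf.periodic k hk) x
  compact ht := hasCompactSupport_mollify (hf.compact ht)

theorem isTestFunction (hf : Ω.IsLipTest K f) (hs : ContDiff ℝ ∞ f) {θ : ℝ → ℝ}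
    (hθ : ContDiff ℝ ∞ θ) (hθs : HasCompactSupport θ) {T b : ℝ} (hb : b < T)
    (hθb : ∀ t, b ≤ t → θ t = 0) : Ω.IsTestFunction T fun z => θ z.1 * f z.2 where
  smooth := (hθ.comp contDiff_fst).mul (hs.comp contDiff_snd)
  eq_zero_near_end := ⟨b, hb, fun t ht x => by simp [hθb t ht]⟩
  spatial := by
    have hc : ¬ Ω.IsTorus → HasCompactSupport fun z : ℝ × E d => θ z.1 * f z.2 := fun ht =>
      HasCompactSupport.intro (hθs.isCompact.prod (hf.compact ht).isCompact) fun z hz => by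
        rw [mem_prod, not_and_or] at hz
        rcases hz with hz | hz
        · simp [image_eq_zero_of_notMem_tsupport hz]
        · simp [image_eq_zero_of_notMem_tsupport hz]
    cases Ω with
    | whole => exact hc fun h => h
    | bounded U hU => exact hc fun h => h
    | torus R hR =>
      intro t x k
      have := hf.periodic _ ⟨k, rfl⟩ x
      simp only [this]

end IsLipTest

/-- Lipschitz test functions determine the image of a measure in `Ω`. -/
theorem map_fold_eq_of_integral_eq {m m' : Measure (E d)} [IsProbabilityMeasure m]
    [IsProbabilityMeasure m'] (hm : m Ω.carrierᶜ = 0)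
    (h : ∀ K f, Ω.IsLipTest K f → ∫ x, f x ∂m = ∫ x, f x ∂m') :
    m.map Ω.fold = m'.map Ω.fold ∧ m' Ω.carrierᶜ = 0 := by
  -- Without periods, all compactly supported Lipschitz functions on `ℝᵈ` are admissible, so the
  -- measures agree on `ℝᵈ` and the second one inherits concentration on the carrier. On the torus
  -- only the images under `fold` can be compared.
  have haux : ¬ Ω.IsTorus → Ω.lattice = {0} → m = m' := fun ht hl =>
    ext_of_integral_lipschitz fun f hf hc => by
      obtain ⟨K, hK⟩ := hf
      refine h K f ⟨hK, ?_, fun k hk x => ?_, fun _ => hc⟩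
      · obtain ⟨C, hC⟩ := hc.exists_bound_of_continuous hK.continuous
        exact ⟨C, hC⟩
      · rw [hl] at hk; rw [show k = 0 from hk, add_zero]
  cases Ω with
  | whole => rw [← haux (fun h => h) rfl]; exact ⟨rfl, hm⟩
  | bounded U hU => rw [← haux (fun h => h) rfl]; exact ⟨rfl, hm⟩
  | torus R hR =>
    refine ⟨?_, by simp [carrier]⟩
    have : Fact (0 < 2 * R) := ⟨by linarith⟩
    have hfm := (torus R hR : SpatialDomain d).measurable_fold
    have : CompactSpace (PiLp 2 (fun _ : Fin d => AddCircle (2 * R))) := ⟨by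
      rw [← (WithLp.toLp_surjective 2).range_eq]
      exact isCompact_range (PiLp.continuous_toLp 2 _)⟩
    have : ProperSpace (torus R hR : SpatialDomain d).Pt :=
      inferInstanceAs (ProperSpace (PiLp 2 (fun _ : Fin d => AddCircle (2 * R))))
    have := Measure.isProbabilityMeasure_map (μ := m) hfm.aemeasurable
    have := Measure.isProbabilityMeasure_map (μ := m') hfm.aemeasurable
    refine ext_of_integral_lipschitz fun f hf hc => ?_
    obtain ⟨K, hK⟩ := hf
    rw [integral_map hfm.aemeasurable hK.continuous.aestronglyMeasurable,
      integral_map hfm.aemeasurable hK.continuous.aestronglyMeasurable]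
    refine h K _ ⟨LipschitzWith.of_dist_le_mul fun x y => ?_, ?_, fun k hk x => ?_,
      fun ht => (ht trivial).elim⟩
    · exact (hK.dist_le_mul _ _).trans
        (mul_le_mul_of_nonneg_left (dist_fold_le _ (mem_univ x) (mem_univ y)) K.2)
    · obtain ⟨C, hC⟩ := hc.exists_bound_of_continuous hK.continuous
      exact ⟨C, fun x => hC _⟩
    · rw [fold_add _ hk]

/-! ### Extension of velocity fields -/

/-- Extension of a bounded Lipschitz function, by the formula of McShane, with a countable
infimum. -/
theorem exists_lipschitz_extension_of_subset {U : Set (E d)} (hU : U.Nonempty)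
    {u : ℝ → U → E d} {β : ℝ → ℝ} (hβ : Measurable β)
    (hlip : ∀ r x y, ‖u r x - u r y‖ ≤ β r * dist x y) (hbdd : ∀ r x, ‖u r x‖ ≤ β r)
    (hmeas : ∀ x, Measurable fun r => u r x) :
    ∃ V : ℝ → E d → E d, (∀ r x y, ‖V r x - V r y‖ ≤ (d + 1) * β r * ‖x - y‖) ∧
      (∀ r x, ‖V r x‖ ≤ (d + 1) * β r) ∧ (∀ x, Measurable fun r => V r x) ∧
      ∀ r (x : U), V r x = u r x := by
  have : Nonempty U := hU.to_subtype
  have hβ0 : ∀ r, 0 ≤ β r := fun r => (norm_nonneg _).trans (hbdd r (Classical.arbitrary U))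
  let D : ℕ → U := TopologicalSpace.denseSeq U
  have hD : DenseRange D := TopologicalSpace.denseRange_denseSeq U
  have hcoord : ∀ (v : E d) i, |v i| ≤ ‖v‖ := fun v i => PiLp.norm_apply_le v i
  -- Summing coordinates costs a factor `d`. The larger `d + 1` is positive even for `d = 0` and
  -- dominates `1`, so the same constant serves when no extension is needed.
  have hnorm : ∀ (v : E d) (c : ℝ), 0 ≤ c → (∀ i, |v i| ≤ c) → ‖v‖ ≤ (d + 1) * c := by
    intro v c hc h
    have h1 : ‖v‖ ≤ ∑ i, |v i| := by
      rw [EuclideanSpace.norm_eq]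
      refine Real.sqrt_le_iff.2 ⟨Finset.sum_nonneg fun _ _ => abs_nonneg _, ?_⟩
      simp only [Real.norm_eq_abs]
      exact Finset.sum_sq_le_sq_sum_of_nonneg fun _ _ => abs_nonneg _
    have h2 : ∑ i, |v i| ≤ d * c := by
      refine (Finset.sum_le_sum fun i _ => h i).trans ?_
      simp
    linarith
  -- The infimum over a dense sequence, rather than over all of `U`, keeps the extension measurable
  -- in time.
  let g : ℝ → E d → Fin d → ℕ → ℝ := fun r x i n => u r (D n) i + β r * ‖x - D n‖
  have hgb : ∀ r x i n, -β r ≤ g r x i n := fun r x i n => by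
    have h1 := (abs_le.1 ((hcoord _ i).trans (hbdd r (D n)))).1
    have h2 := mul_nonneg (hβ0 r) (norm_nonneg (x - D n))
    simp only [g]; linarith
  have hgB : ∀ r x i, BddBelow (range (g r x i)) := fun r x i =>
    ⟨-β r, by rintro _ ⟨n, rfl⟩; exact hgb r x i n⟩
  let e : ℝ → E d → Fin d → ℝ := fun r x i => ⨅ n, g r x i n
  have he : ∀ r x y i, e r x i ≤ e r y i + β r * ‖x - y‖ := fun r x y i => by
    rw [← sub_le_iff_le_add]
    refine le_ciInf fun n => ?_
    have h1 : e r x i ≤ g r x i n := ciInf_le (hgB r x i) n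
    have h2 : ‖x - D n‖ ≤ ‖x - y‖ + ‖y - D n‖ := norm_sub_le_norm_sub_add_norm_sub _ _ _
    have h3 := mul_le_mul_of_nonneg_left h2 (hβ0 r)
    simp only [g] at h1 ⊢
    linarith
  have heu : ∀ r (x : U) i, e r x i = u r x i := fun r x i => by
    refine le_antisymm ?_ (le_ciInf fun n => ?_)
    · refine le_of_forall_pos_le_add fun ε hε => ?_
      obtain ⟨n, hn⟩ := hD.exists_dist_lt x (ε := ε / (2 * β r + 1))
        (by have := hβ0 r; positivity)
      have h1 : e r x i ≤ g r x i n := ciInf_le (hgB r x i) n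
      have h2 : |u r (D n) i - u r x i| ≤ β r * dist x (D n) := by
        have := (hcoord (u r (D n) - u r x) i).trans (hlip r _ _)
        rwa [dist_comm] at this
      have h3 : ‖(x : E d) - D n‖ = dist x (D n) := by rw [← dist_eq_norm]; rfl
      simp only [g, h3] at h1
      have h4 := (abs_le.1 h2).2
      have h5 : dist x (D n) * (2 * β r + 1) ≤ ε :=
        (le_div_iff₀ (by have := hβ0 r; positivity)).1 hn.le
      have h6 := dist_nonneg (x := x) (y := D n)
      linarith
    · have h2 : |u r x i - u r (D n) i| ≤ β r * dist x (D n) :=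
        (hcoord (u r x - u r (D n)) i).trans (hlip r _ _)
      have h3 : ‖(x : E d) - D n‖ = dist x (D n) := by rw [← dist_eq_norm]; rfl
      simp only [g, h3]
      linarith [(abs_le.1 h2).2]
  -- The McShane extension can be unbounded; truncation at `± β r` restores the bound without
  -- increasing the Lipschitz constant or changing the values on `U`.
  let w : ℝ → E d → Fin d → ℝ := fun r x i => max (-β r) (min (β r) (e r x i))
  have hw : ∀ r x i, |w r x i| ≤ β r := fun r x i =>
    abs_le.2 ⟨le_max_left _ _, max_le (by linarith [hβ0 r]) (min_le_left _ _)⟩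
  refine ⟨fun r x => WithLp.toLp 2 (w r x), fun r x y => ?_, fun r x => hnorm _ _ (hβ0 r) (hw r x),
    fun x => ?_, fun r x => PiLp.ext fun i => ?_⟩
  · rw [mul_assoc]
    refine hnorm _ _ (mul_nonneg (hβ0 r) (norm_nonneg _)) fun i => ?_
    change |w r x i - w r y i| ≤ _
    have h1 : |e r x i - e r y i| ≤ β r * ‖x - y‖ := by
      rw [abs_le]
      have h1 := he r x y i
      have h2 := he r y x i
      rw [norm_sub_rev] at h2
      constructor <;> linarith
    calc |w r x i - w r y i| ≤ |min (β r) (e r x i) - min (β r) (e r y i)| := by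
          have := abs_max_sub_max_le_max (-β r) (min (β r) (e r x i)) (-β r) (min (β r) (e r y i))
          simpa using this
      _ ≤ |e r x i - e r y i| := by
          have := abs_min_sub_min_le_max (β r) (e r x i) (β r) (e r y i)
          simpa using this
      _ ≤ _ := h1
  · refine (WithLp.measurable_toLp 2 _).comp (measurable_pi_lambda _ fun i => ?_)
    refine hβ.neg.max (hβ.min (Measurable.iInf fun n => ?_))
    refine Measurable.add ?_ (hβ.mul_const _)
    exact (measurable_pi_apply i).comp ((WithLp.measurable_ofLp 2 _).comp (hmeas (D n)))
  · change w r x i = _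
    have h1 := abs_le.1 ((hcoord _ i).trans (hbdd r x))
    simp only [w, heu]
    rw [min_eq_right h1.2, max_eq_right h1.1]

/-- Bounded Lipschitz vector fields on `Ω` extend to periodic fields on `ℝᵈ`. -/
theorem exists_lipschitz_extension {u : ℝ → Ω.Pt → E d} {β : ℝ → ℝ} (hβ : Measurable β)
    (hlip : ∀ r x y, ‖u r x - u r y‖ ≤ β r * dist x y) (hbdd : ∀ r x, ‖u r x‖ ≤ β r)
    (hmeas : ∀ x, Measurable fun r => u r x) :
    ∃ V : ℝ → E d → E d, (∀ r x y, ‖V r x - V r y‖ ≤ (d + 1) * β r * ‖x - y‖) ∧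
      (∀ r x, ‖V r x‖ ≤ (d + 1) * β r) ∧ (∀ x, Measurable fun r => V r x) ∧
      (∀ r, Ω.IsPeriodic (V r)) ∧ ∀ r x, V r (Ω.coord x) = u r x := by
  have hβ0 : ∀ r, 0 ≤ β r := fun r => (norm_nonneg _).trans (hbdd r (Classical.arbitrary Ω.Pt))
  have haux : Ω.carrier = univ → ∃ V : ℝ → E d → E d,
      (∀ r x y, ‖V r x - V r y‖ ≤ (d + 1) * β r * ‖x - y‖) ∧
      (∀ r x, ‖V r x‖ ≤ (d + 1) * β r) ∧ (∀ x, Measurable fun r => V r x) ∧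
      (∀ r, Ω.IsPeriodic (V r)) ∧ ∀ r x, V r (Ω.coord x) = u r x := by
    intro hc
    have hle : ∀ r, β r ≤ (d + 1) * β r := fun r => by
      have := mul_nonneg (Nat.cast_nonneg (α := ℝ) d) (hβ0 r)
      linarith
    refine ⟨fun r x => u r (Ω.fold x), fun r x y => ?_, fun r x => (hbdd r _).trans (hle r),
      fun x => hmeas _, fun r k hk x => ?_, fun r x => ?_⟩
    · refine (hlip r _ _).trans (mul_le_mul (hle r) ?_ dist_nonneg
        (mul_nonneg (by positivity) (hβ0 r)))
      rw [← dist_eq_norm]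
      exact dist_fold_le Ω (by rw [hc]; trivial) (by rw [hc]; trivial)
    · beta_reduce; rw [fold_add _ hk]
    · beta_reduce; rw [fold_coord]
  cases Ω with
  | whole => exact haux rfl
  | torus R hR => exact haux rfl
  | bounded U hU =>
    obtain ⟨V, h1, h2, h3, h4⟩ := exists_lipschitz_extension_of_subset hU.isConnected.nonempty
      hβ hlip hbdd hmeas
    refine ⟨V, h1, h2, h3, fun r k hk x => ?_, h4⟩
    rw [show k = 0 from hk, add_zero]

end SpatialDomain

end

section

/-! ### Velocity fields in `L^q(0,h; BL(Ω))` -/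

section BoundedLipschitz

variable {X Y : Type*} [MetricSpace X] [NormedAddCommGroup Y] {f : X → Y}

theorem norm_le_toReal_blNorm (hf : blNorm f ≠ ⊤) (x : X) : ‖f x‖ ≤ (blNorm f).toReal := by
  rw [← toReal_enorm]
  exact ENNReal.toReal_mono hf ((le_iSup (fun x => ‖f x‖ₑ) x).trans le_self_add)

theorem norm_sub_le_toReal_blNorm (hf : blNorm f ≠ ⊤) (x y : X) :
    ‖f x - f y‖ ≤ (blNorm f).toReal * dist x y := by
  rcases eq_or_ne x y with rfl | hxy
  · simp
  have h1 : edist (f x) (f y) / edist x y ≤ blNorm f := by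
    refine le_trans ?_ le_add_self
    exact le_iSup_of_le x (le_iSup_of_le y (le_iSup_of_le hxy le_rfl))
  rw [ENNReal.div_le_iff (edist_pos.2 hxy).ne' (edist_ne_top _ _)] at h1
  have h2 := ENNReal.toReal_mono (ENNReal.mul_ne_top hf (edist_ne_top _ _)) h1
  rwa [ENNReal.toReal_mul, ← dist_edist, ← dist_edist, dist_eq_norm] at h2

end BoundedLipschitz

variable {d : ℕ} {Ω : SpatialDomain d}

/-- A field in `L^q(0,h; BL(Ω))` agrees for small times with the restriction of a Carathéodory
field. -/
theorem InLqBL.exists_caratheodoryField {v : ℝ → Ω.Pt → E d} {q h : ℝ} (hq : 1 ≤ q) (hh : 0 < h)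
    (hv : InLqBL Ω q h v) : ∃ H₀, 0 < H₀ ∧ H₀ ≤ h ∧ ∀ H, 0 < H → H ≤ H₀ →
      ∃ V β, IsCaratheodoryField V β ∧ (∀ r, Ω.IsPeriodic (V r)) ∧
        ∀ᵐ r ∂volume.restrict (Ioo 0 H), ∀ x, V r (Ω.coord x) = v r x := by
  obtain ⟨hvm, hbm, hbi⟩ := hv
  set μh : Measure ℝ := volume.restrict (Ioo 0 h) with hμ
  set b := hbm.mk (fun t => blNorm (v t)) with hb
  have hbmeas : Measurable b := hbm.measurable_mk
  have hbint : ∫⁻ t, b t ∂μh ≠ ⊤ := by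
    have h1 : ∫⁻ t, b t ∂μh = ∫⁻ t, blNorm (v t) ∂μh := lintegral_congr_ae hbm.ae_eq_mk.symm
    -- On a bounded time interval, `q ≥ 1` makes the norms integrable through `a ≤ 1 + a ^ q`.
    have h2 : ∀ a : ℝ≥0∞, a ≤ 1 + a ^ q := fun a => by
      rcases le_total a 1 with ha | ha
      · exact ha.trans le_self_add
      · refine le_trans ?_ le_add_self
        calc a = a ^ (1 : ℝ) := (ENNReal.rpow_one a).symm
          _ ≤ a ^ q := ENNReal.rpow_le_rpow_of_exponent_le ha hq
    rw [h1]
    refine ((lintegral_mono fun t => h2 (blNorm (v t))).trans_lt ?_).ne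
    rw [lintegral_add_left measurable_const]
    refine ENNReal.add_lt_top.2 ⟨?_, hbi⟩
    simp [hμ]
  -- By absolute continuity of the integral, a short interval carries mass below `1 / (2 (d + 1))`;
  -- the extension multiplies constants by `d + 1`, which leaves the required `1/2`.
  obtain ⟨δ, hδ, hδb⟩ := exists_pos_setLIntegral_lt_of_measure_lt hbint
    (ε := ENNReal.ofReal (1 / (2 * (d + 1)))) (by simp; positivity)
  obtain ⟨δ', hδ', hδ'δ⟩ : ∃ δ' : ℝ, 0 < δ' ∧ ENNReal.ofReal δ' < δ := by
    obtain ⟨r, hr0, hr⟩ := ENNReal.lt_iff_exists_nnreal_btwn.1 hδ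
    exact ⟨r, by exact_mod_cast hr0, by simpa using hr⟩
  refine ⟨min δ' h, lt_min hδ' hh, min_le_right _ _, fun H hH hHH => ?_⟩
  -- a countable dense set of points with measurable trajectories of the velocity
  obtain ⟨w, hwm, hw⟩ := hvm
  have hgood : ∀ᵐ x ∂Ω.vol, AEMeasurable (fun t => v t x) μh := by
    have h1 : ∀ᵐ z ∂(Ω.vol.prod μh), v z.2 z.1 = w (z.2, z.1) :=
      Measure.measurePreserving_swap.quasiMeasurePreserving.ae hw
    have h2 := Measure.ae_ae_of_ae_prod h1
    filter_upwards [h2] with x hx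
    exact ⟨fun t => w (t, x), hwm.comp (by fun_prop), hx⟩
  obtain ⟨C, hCsub, hCc, hCd⟩ := (Measure.dense_of_ae hgood).exists_countable_dense_subset
  have hCne : C.Nonempty := hCd.nonempty
  obtain ⟨D, hD⟩ := hCc.exists_eq_range hCne
  have hDmeas : ∀ n, AEMeasurable (fun t => v t (D n)) μh := fun n =>
    hCsub (by rw [hD]; exact mem_range_self n)
  have hDd : DenseRange D := by rw [DenseRange, ← hD]; exact hCd
  -- the exceptional times
  have hall : ∀ᵐ t ∂μh, blNorm (v t) = b t ∧ b t < ⊤ ∧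
      ∀ n, v t (D n) = (hDmeas n).mk _ t := by
    filter_upwards [hbm.ae_eq_mk, ae_lt_top hbmeas hbint,
      ae_all_iff.2 fun n => (hDmeas n).ae_eq_mk] with t h1 h2 h3 using ⟨h1, h2, h3⟩
  obtain ⟨N, hNsub, hNm, hN0⟩ := exists_measurable_superset_of_null hall
  have hNgood : ∀ t, t ∉ N → blNorm (v t) = b t ∧ b t < ⊤ ∧
      ∀ n, v t (D n) = (hDmeas n).mk _ t := fun t ht => by
    by_contra hcon
    exact ht (hNsub hcon)
  set S : Set ℝ := Ioo 0 H \ N with hS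
  have hSm : MeasurableSet S := measurableSet_Ioo.diff hNm
  classical
  -- Setting the field to zero at exceptional times and outside `(0, H)` makes the bounds hold at
  -- every time, as the Picard construction demands.
  let u : ℝ → Ω.Pt → E d := fun r x => if r ∈ S then v r x else 0
  let β : ℝ → ℝ := fun r => if r ∈ S then (b r).toReal else 0
  have hβm : Measurable β := Measurable.ite hSm hbmeas.ennreal_toReal measurable_const
  have hβ0 : ∀ r, 0 ≤ β r := fun r => by
    simp only [β]; split_ifs
    · exact ENNReal.toReal_nonneg
    · exact le_rfl
  have hlip : ∀ r x y, ‖u r x - u r y‖ ≤ β r * dist x y := fun r x y => by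
    by_cases hr : r ∈ S
    · obtain ⟨h1, h2, -⟩ := hNgood r hr.2
      simp only [u, β, hr, if_true]
      rw [← h1] at h2 ⊢
      exact norm_sub_le_toReal_blNorm h2.ne x y
    · simp [u, β, hr]
  have hbdd : ∀ r x, ‖u r x‖ ≤ β r := fun r x => by
    by_cases hr : r ∈ S
    · obtain ⟨h1, h2, -⟩ := hNgood r hr.2
      simp only [u, β, hr, if_true]
      rw [← h1] at h2 ⊢
      exact norm_le_toReal_blNorm h2.ne x
    · simp [u, β, hr]
  -- Joint a.e. measurability only controls the time slices at almost every point. They are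
  -- measurable at the dense points `D n`, and continuity in space passes this to every `x` as a
  -- pointwise limit.
  have hum : ∀ x, Measurable fun r => u r x := by
    have h1 : ∀ n, Measurable fun r => u r (D n) := fun n => by
      have : (fun r => u r (D n)) = fun r => if r ∈ S then (hDmeas n).mk _ r else 0 := by
        ext1 r
        by_cases hr : r ∈ S
        · simp only [u, hr, if_true]; exact (hNgood r hr.2).2.2 n
        · simp [u, hr]
      rw [this]
      exact Measurable.ite hSm (hDmeas n).measurable_mk measurable_const
    intro x
    obtain ⟨y, hy, hyx⟩ := mem_closure_iff_seq_limit.1 (hDd x)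
    choose n hn using hy
    refine measurable_of_tendsto_metrizable (f := fun k r => u r (D (n k))) (fun k => h1 _) ?_
    rw [tendsto_pi_nhds]
    intro r
    have hc : Continuous (u r) := (LipschitzWith.of_dist_le_mul (K := ⟨β r, hβ0 r⟩) fun x y => by
      rw [dist_eq_norm]; exact hlip r x y).continuous
    simp only [hn]
    exact (hc.tendsto x).comp hyx
  obtain ⟨V, hVl, hVb, hVm, hVp, hVu⟩ :=
    SpatialDomain.exists_lipschitz_extension hβm hlip hbdd hum
  have hβint : ∫⁻ r, ENNReal.ofReal (β r) ≤ ENNReal.ofReal (1 / (2 * (d + 1))) := by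
    have h1 : ∀ r, ENNReal.ofReal (β r) ≤ (Ioo 0 H).indicator b r := fun r => by
      by_cases hr : r ∈ S
      · simp only [β, hr, if_true, indicator_of_mem hr.1]
        exact ENNReal.ofReal_toReal_le
      · simp [β, hr]
    have hsub : Ioo 0 H ⊆ Ioo 0 h := Ioo_subset_Ioo_right (hHH.trans (min_le_right _ _))
    calc ∫⁻ r, ENNReal.ofReal (β r) ≤ ∫⁻ r, (Ioo 0 H).indicator b r := lintegral_mono h1
      _ = ∫⁻ r in Ioo 0 H, b r := lintegral_indicator measurableSet_Ioo _
      _ = ∫⁻ r in Ioo 0 H, b r ∂μh := by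
          rw [hμ, Measure.restrict_restrict_of_subset hsub]
      _ ≤ _ := by
          refine (hδb _ ?_).le
          refine lt_of_le_of_lt ?_ hδ'δ
          calc μh (Ioo 0 H) ≤ volume (Ioo 0 H) := Measure.restrict_apply_le _ _
            _ = ENNReal.ofReal H := by simp
            _ ≤ _ := ENNReal.ofReal_le_ofReal (hHH.trans (min_le_left _ _))
  have hβi : Integrable β := by
    refine ⟨hβm.aestronglyMeasurable, ?_⟩
    rw [hasFiniteIntegral_iff_ofReal (ae_of_all _ hβ0)]
    exact hβint.trans_lt ENNReal.ofReal_lt_top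
  refine ⟨V, fun r => (d + 1) * β r, ⟨hVl, hVb, hVm, hβi.const_mul _, ?_⟩, hVp, ?_⟩
  · rw [integral_const_mul, integral_eq_lintegral_of_nonneg_ae (ae_of_all _ hβ0)
      hβm.aestronglyMeasurable]
    have h1 := ENNReal.toReal_le_of_le_ofReal (by positivity) hβint
    calc ((d : ℝ) + 1) * _ ≤ (d + 1) * (1 / (2 * (d + 1))) :=
          mul_le_mul_of_nonneg_left h1 (by positivity)
      _ = 1 / 2 := by field_simp
  · have hsub : Ioo 0 H ⊆ Ioo 0 h := Ioo_subset_Ioo_right (hHH.trans (min_le_right _ _))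
    have h1 : ∀ᵐ r ∂volume.restrict (Ioo 0 H), r ∉ N :=
      ae_mono (Measure.restrict_mono hsub le_rfl) (measure_eq_zero_iff_ae_notMem.1 hN0)
    filter_upwards [h1, ae_restrict_mem measurableSet_Ioo] with r hr hrH x
    rw [hVu]
    simp only [u]
    rw [if_pos ⟨hrH, hr⟩]

end

section

/-! ### From the weak formulation to increments of integrals -/

/-- The lemma of du Bois-Reymond, with initial datum. -/
theorem sub_eq_integral_of_weak {a b : ℝ → ℝ} {H : ℝ} (hH : 0 < H)
    (ha : ContinuousOn a (Icc 0 H)) (hb : IntervalIntegrable b volume 0 H)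
    (h : ∀ θ : ℝ → ℝ, ContDiff ℝ ∞ θ → HasCompactSupport θ → (∃ c < H, ∀ t, c ≤ t → θ t = 0) →
      (∫ t in 0..H, (deriv θ t * a t + θ t * b t)) + θ 0 * a 0 = 0) :
    ∀ t ∈ Icc 0 H, a t - a 0 = ∫ s in 0..t, b s := by
  set B : ℝ → ℝ := fun t => ∫ s in 0..t, b s with hB
  have hBac : AbsolutelyContinuousOnInterval B 0 H :=
    hb.absolutelyContinuousOnInterval_intervalIntegral left_mem_uIcc
  have hBc : ContinuousOn B (Icc 0 H) := by
    have := hBac.continuousOn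
    rwa [uIcc_of_le hH.le] at this
  have hBd : ∀ᵐ t, t ∈ uIcc 0 H → HasDerivAt B (b t) t := by
    filter_upwards [hb.ae_hasDerivAt_integral] with t ht htm using ht htm 0 left_mem_uIcc
  -- Integrating by parts against the primitive `B` turns the weak identity into orthogonality of `a
  -- - B - a 0` to all `deriv θ`; since `∫ deriv θ = - θ 0`, the initial term accounts for the
  -- constant `a 0`.
  have hkey : ∀ θ : ℝ → ℝ, ContDiff ℝ ∞ θ → HasCompactSupport θ →
      (∃ c < H, ∀ t, c ≤ t → θ t = 0) → ∫ t in 0..H, deriv θ t * (a t - B t - a 0) = 0 := by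
    intro θ hθ hθs hθ0
    have hw := h θ hθ hθs hθ0
    obtain ⟨c, hc, hθ0⟩ := hθ0
    have hθ1 : ContDiff ℝ 1 θ := hθ.of_le (by exact_mod_cast le_top)
    have hθH : θ H = 0 := hθ0 H hc.le
    have hθd : Continuous (deriv θ) := hθ1.continuous_deriv le_rfl
    have hparts := AbsolutelyContinuousOnInterval.integral_mul_deriv_eq_deriv_mul
      (f := θ) (g := B) (a := 0) (b := H) (hθ1.contDiffOn.absolutelyContinuousOnInterval) hBac
    have hB0 : B 0 = 0 := by simp [hB]
    rw [hθH, hB0, zero_mul, mul_zero, sub_zero, zero_sub] at hparts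
    have h1 : ∫ t in 0..H, θ t * deriv B t = ∫ t in 0..H, θ t * b t := by
      refine intervalIntegral.integral_congr_ae ?_
      filter_upwards [hBd] with t ht htm
      rw [(ht (uIoc_subset_uIcc htm)).deriv]
    have h2 : ∫ t in 0..H, deriv θ t = - θ 0 := by
      rw [intervalIntegral.integral_deriv_eq_sub
        (fun t _ => (hθ1.differentiable one_ne_zero).differentiableAt)
        (hθd.intervalIntegrable _ _), hθH, zero_sub]
    have ia : IntervalIntegrable (fun t => deriv θ t * a t) volume 0 H :=
      ContinuousOn.intervalIntegrable (by rw [uIcc_of_le hH.le]; exact hθd.continuousOn.mul ha)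
    have ib : IntervalIntegrable (fun t => θ t * b t) volume 0 H :=
      hb.continuousOn_mul hθ1.continuous.continuousOn
    have iB : IntervalIntegrable (fun t => deriv θ t * B t) volume 0 H :=
      ContinuousOn.intervalIntegrable (by rw [uIcc_of_le hH.le]; exact hθd.continuousOn.mul hBc)
    have ic : IntervalIntegrable (fun t => deriv θ t * a 0) volume 0 H :=
      (hθd.mul continuous_const).intervalIntegrable _ _
    rw [intervalIntegral.integral_add ia ib, ← h1, hparts] at hw
    have h3 : ∫ t in 0..H, deriv θ t * (a t - B t - a 0) = (∫ t in 0..H, deriv θ t * a t) -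
        (∫ t in 0..H, deriv θ t * B t) - ∫ t in 0..H, deriv θ t * a 0 := by
      rw [← intervalIntegral.integral_sub ia iB, ← intervalIntegral.integral_sub (ia.sub iB) ic]
      refine intervalIntegral.integral_congr fun t _ => ?_
      ring
    rw [h3, intervalIntegral.integral_mul_const, h2]
    linarith
  have hcont : ContinuousOn (fun t => a t - B t - a 0) (Icc 0 H) :=
    (ha.sub hBc).sub continuousOn_const
  have hae : ∀ᵐ t, t ∈ Ioo 0 H → a t - B t - a 0 = 0 := by
    refine isOpen_Ioo.ae_eq_zero_of_integral_contDiff_smul_eq_zero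
      ((hcont.mono Ioo_subset_Icc_self).locallyIntegrableOn measurableSet_Ioo)
      fun η hη hηs hηt => ?_
    have hηc : Continuous η := hη.continuous
    -- an antiderivative of `η`, cut off
    let κ : ℝ → ℝ := fun t => ∫ s in H..t, η s
    have hκd : ∀ t, HasDerivAt κ (η t) t := fun t =>
      intervalIntegral.integral_hasDerivAt_right (hηc.intervalIntegrable _ _)
        (hηc.stronglyMeasurableAtFilter _ _) hηc.continuousAt
    have hκ : ContDiff ℝ ∞ κ := by
      rw [contDiff_infty_iff_deriv]
      refine ⟨fun t => (hκd t).differentiableAt, ?_⟩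
      rw [show deriv κ = η from funext fun t => (hκd t).deriv]
      exact hη
    -- The base point `H` makes `κ` vanish to the right of the support of `η`, but to its left `κ`
    -- may be a nonzero constant. The cut-off gives compact support and equals `1` around `[0, H]`;
    -- the value at `0` is unrestricted.
    let χ : ContDiffBump (0 : ℝ) := ⟨H + 1, H + 2, by linarith, by linarith⟩
    obtain ⟨c, hcH, hc⟩ : ∃ c < H, ∀ t ∈ tsupport η, t ≤ c := by
      rcases (tsupport η).eq_empty_or_nonempty with he | hne
      · exact ⟨0, hH, by simp [he]⟩
      · obtain ⟨c, hc, hmax⟩ := hηs.isCompact.exists_isMaxOn hne continuous_id.continuousOn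
        exact ⟨c, (hηt hc).2, fun t ht => hmax ht⟩
    have hκ0 : ∀ t, c < t → κ t = 0 := fun t ht => by
      simp only [κ]
      rw [intervalIntegral.integral_symm, neg_eq_zero]
      refine (intervalIntegral.integral_congr (g := fun _ => (0 : ℝ)) fun s hs => ?_).trans (by simp)
      refine image_eq_zero_of_notMem_tsupport fun hs' => ?_
      have h1 := hc s hs'
      have h2 : min t H ≤ s := hs.1
      have := lt_min ht hcH
      linarith
    obtain ⟨c', hc1, hc2⟩ := exists_between hcH
    have hk := hkey (fun t => χ t * κ t) (χ.contDiff.mul hκ) χ.hasCompactSupport.mul_right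
      ⟨c', hc2, fun t ht => by rw [hκ0 t (hc1.trans_le ht), mul_zero]⟩
    have hd : ∀ t ∈ Icc 0 H, deriv (fun t => χ t * κ t) t = η t := fun t ht => by
      have h1 : (fun t => χ t * κ t) =ᶠ[𝓝 t] κ := by
        have : Metric.ball (0 : ℝ) (H + 1) ∈ 𝓝 t := Metric.isOpen_ball.mem_nhds (by
          rw [Metric.mem_ball, Real.dist_eq, sub_zero, abs_of_nonneg ht.1]; linarith [ht.2])
        filter_upwards [this] with s hs
        rw [χ.one_of_mem_closedBall (Metric.ball_subset_closedBall hs), one_mul]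
      rw [h1.deriv_eq, (hκd t).deriv]
    have h0 : ∀ t, t ∉ Ioc 0 H → η t • (a t - B t - a 0) = 0 := fun t ht => by
      rw [image_eq_zero_of_notMem_tsupport fun h => ht (Ioo_subset_Ioc_self (hηt h)), zero_smul]
    rw [← setIntegral_eq_integral_of_forall_compl_eq_zero h0,
      ← intervalIntegral.integral_of_le hH.le]
    refine Eq.trans ?_ hk
    refine intervalIntegral.integral_congr fun t ht => ?_
    rw [uIcc_of_le hH.le] at ht
    simp only [hd t ht, smul_eq_mul]
  have hEq : EqOn (fun t => a t - B t - a 0) (fun _ => 0) (Icc 0 H) := by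
    refine Measure.eqOn_Icc_of_ae_eq volume hH.ne ?_ hcont continuousOn_const
    rw [← restrict_Ioo_eq_restrict_Icc]
    exact (ae_restrict_iff' measurableSet_Ioo).2 hae
  intro t ht
  have h1 : a t - B t - a 0 = 0 := hEq ht
  linarith

/-- A narrowly continuous curve of probability measures is measurable. -/
theorem measurable_of_continuous_probabilityMeasure {X : Type*} [MetricSpace X]
    [MeasurableSpace X] [BorelSpace X] {m : ℝ → ProbabilityMeasure X} (hm : Continuous m) :
    Measurable fun r => (m r : Measure X) := by
  refine Measurable.measure_of_isPiSystem_of_isProbabilityMeasure (S := {s | IsOpen s})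
    BorelSpace.measurable_eq isPiSystem_isOpen fun G hG => ?_
  refine LowerSemicontinuous.measurable fun r => ?_
  refine lowerSemicontinuousAt_iff_le_liminf.2 ?_
  exact ProbabilityMeasure.le_liminf_measure_open_of_tendsto (hm.tendsto r) hG

variable {d : ℕ} {Ω : SpatialDomain d}

/-- A narrowly continuous curve of measures, transported by a periodic Carathéodory field for
times in `[0,H]`. -/
structure IsTransported (Ω : SpatialDomain d) (H : ℝ) (V : ℝ → E d → E d) (β : ℝ → ℝ)
    (m : ℝ → ProbabilityMeasure Ω.Pt) : Prop where
  field : IsCaratheodoryField V β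
  periodic : ∀ r, Ω.IsPeriodic (V r)
  continuous : Continuous m
  increment : ∀ K f, Ω.IsLipTest K f → ContDiff ℝ ∞ f → ∀ s t, 0 ≤ s → s ≤ t → t ≤ H →
    ∫ x, f (Ω.coord x) ∂(m t : Measure Ω.Pt) - ∫ x, f (Ω.coord x) ∂(m s : Measure Ω.Pt) =
      ∫ r in s..t, ∫ x, fderiv ℝ f (Ω.coord x) (V r (Ω.coord x)) ∂(m r : Measure Ω.Pt)

theorem inner_gradient_eq_fderiv (f : E d → ℝ) (x v : E d) : ⟪gradient f x, v⟫ = fderiv ℝ f x v := by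
  rw [gradient, InnerProductSpace.toDual_symm_apply]

/-- Narrow continuity makes the curve a Markov kernel, and integrals of jointly measurable functions
against a kernel are measurable in the parameter. -/
theorem stronglyMeasurable_integral_fderiv {V : ℝ → E d → E d} {β : ℝ → ℝ}
    (hV : IsCaratheodoryField V β) {m : ℝ → ProbabilityMeasure Ω.Pt} (hm : Continuous m)
    {f : E d → ℝ} (hf : ContDiff ℝ ∞ f) : StronglyMeasurable fun r =>
      ∫ x, fderiv ℝ f (Ω.coord x) (V r (Ω.coord x)) ∂(m r : Measure Ω.Pt) := by
  let κ : ProbabilityTheory.Kernel ℝ Ω.Pt :=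
    ⟨fun r => (m r : Measure Ω.Pt), measurable_of_continuous_probabilityMeasure hm⟩
  have : ProbabilityTheory.IsMarkovKernel κ := ⟨fun r => by
    change IsProbabilityMeasure (m r : Measure Ω.Pt); infer_instance⟩
  have hfd : Continuous (fderiv ℝ f) := hf.continuous_fderiv (by simp)
  have h1 : Measurable fun z : ℝ × Ω.Pt => fderiv ℝ f (Ω.coord z.2) (V z.1 (Ω.coord z.2)) := by
    have h2 : Measurable fun z : ℝ × Ω.Pt => V z.1 (Ω.coord z.2) :=
      hV.measurable_uncurry.comp
        (measurable_fst.prodMk (Ω.measurable_coord.comp measurable_snd))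
    have h3 : Measurable fun z : ℝ × Ω.Pt => fderiv ℝ f (Ω.coord z.2) :=
      hfd.measurable.comp (Ω.measurable_coord.comp measurable_snd)
    have h4 : Measurable fun z : (E d →L[ℝ] ℝ) × E d => z.1 z.2 :=
      (isBoundedBilinearMap_apply.continuous).measurable
    exact h4.comp (h3.prodMk h2)
  exact h1.stronglyMeasurable.integral_kernel_prod_right' (κ := κ)

theorem abs_fderiv_apply_le {V : ℝ → E d → E d} {β : ℝ → ℝ} (hV : IsCaratheodoryField V β)
    {K : NNReal} {f : E d → ℝ} (hf : LipschitzWith K f) (r : ℝ) (x : E d) :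
    |fderiv ℝ f x (V r x)| ≤ K * β r := by
  rw [← Real.norm_eq_abs]
  refine (ContinuousLinearMap.le_opNorm _ _).trans ?_
  exact mul_le_mul (norm_fderiv_le_of_lipschitz ℝ hf) (hV.norm_le r x) (norm_nonneg _) K.2

theorem integrable_integral_fderiv {V : ℝ → E d → E d} {β : ℝ → ℝ}
    (hV : IsCaratheodoryField V β) {m : ℝ → ProbabilityMeasure Ω.Pt} (hm : Continuous m)
    {K : NNReal} {f : E d → ℝ} (hL : LipschitzWith K f) (hf : ContDiff ℝ ∞ f) :
    Integrable fun r => ∫ x, fderiv ℝ f (Ω.coord x) (V r (Ω.coord x)) ∂(m r : Measure Ω.Pt) := by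
  refine (hV.integrable.const_mul (K : ℝ)).mono'
    (stronglyMeasurable_integral_fderiv hV hm hf).aestronglyMeasurable (ae_of_all _ fun r => ?_)
  refine (norm_integral_le_of_norm_le_const (C := K * β r) (ae_of_all _ fun x => ?_)).trans
    (by simp)
  exact abs_fderiv_apply_le hV hL r _

/-- The clamped curve, constant outside `[0,T]`. -/
def clampCurve {X : Type*} {T : ℝ} (hT : 0 ≤ T) (μ : ℝ → X) : ℝ → X :=
  fun t => μ (projIcc 0 T hT t)

theorem clampCurve_of_mem {X : Type*} {T : ℝ} (hT : 0 ≤ T) (μ : ℝ → X) {t : ℝ}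
    (ht : t ∈ Icc 0 T) : clampCurve hT μ t = μ t := by
  simp [clampCurve, projIcc_of_mem hT ht]

theorem continuous_clampCurve {X : Type*} [TopologicalSpace X] {T : ℝ} (hT : 0 ≤ T) {μ : ℝ → X}
    (hμ : ContinuousOn μ (Icc 0 T)) : Continuous (clampCurve hT μ) :=
  (continuousOn_iff_continuous_domRestrict.1 hμ).comp continuous_projIcc

/-- Weak solutions with a velocity that agrees with a Carathéodory field are transported. -/
theorem IsWeakSolution.isTransported {T H : ℝ} (hT : 0 ≤ T) (hH : 0 < H) (hHT : H ≤ T)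
    {v : Velocity Ω} {A : Set (ProbabilityMeasure Ω.Pt)} {ρ₀ : ProbabilityMeasure Ω.Pt}
    {μ : ℝ → ProbabilityMeasure Ω.Pt} (hμ : IsWeakSolution Ω T v A ρ₀ μ)
    {V : ℝ → E d → E d} {β : ℝ → ℝ} (hV : IsCaratheodoryField V β)
    (hper : ∀ r, Ω.IsPeriodic (V r))
    (hVv : ∀ᵐ r ∂volume.restrict (Ioo 0 H), ∀ x, V r (Ω.coord x) = v (μ r) x) :
    IsTransported Ω H V β (clampCurve hT μ) := by
  set m := clampCurve hT μ
  have hm : Continuous m := continuous_clampCurve hT hμ.narrowly_continuous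
  have hmμ : ∀ t ∈ Icc 0 T, m t = μ t := fun t ht => clampCurve_of_mem hT μ ht
  refine ⟨hV, hper, hm, fun K f hf hfs s t hs hst ht => ?_⟩
  obtain ⟨C, hC⟩ := hf.bounded
  have hfc : Continuous fun x => f (Ω.coord x) := hf.continuous_comp_coord
  set a : ℝ → ℝ := fun t => ∫ x, f (Ω.coord x) ∂(m t : Measure Ω.Pt) with ha
  set b : ℝ → ℝ := fun r =>
    ∫ x, fderiv ℝ f (Ω.coord x) (V r (Ω.coord x)) ∂(m r : Measure Ω.Pt) with hb
  have hac : Continuous a := by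
    rw [continuous_iff_continuousAt]
    intro t
    have := (ProbabilityMeasure.tendsto_iff_forall_integral_tendsto.1 (hm.tendsto t))
      (BoundedContinuousFunction.ofNormedAddCommGroup _ hfc C fun x => hC _)
    exact this
  have hbi : Integrable b := integrable_integral_fderiv hV hm hf.lipschitz hfs
  have key : ∀ t ∈ Icc 0 H, a t - a 0 = ∫ s in 0..t, b s := by
    refine sub_eq_integral_of_weak hH hac.continuousOn hbi.intervalIntegrable
      fun θ hθ hθs ⟨c, hcH, hc⟩ => ?_
    -- Separated test functions `θ(t) f(x)` reduce the equation to a scalar weak identity for `t ↦ ∫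
    -- f dμ_t`.
    have hw := hμ.weak _ (hf.isTestFunction hfs hθ hθs (hcH.trans_le hHT) hc)
    have hθd : Differentiable ℝ θ := hθ.differentiable (by simp)
    have hfd : Differentiable ℝ f := hfs.differentiable (by simp)
    have hint : ∀ (r : ℝ) (x : Ω.Pt), deriv (fun s => θ s * f (Ω.coord x)) r +
        ⟪gradient (fun y => θ r * f y) (Ω.coord x), v (μ r) x⟫ =
        deriv θ r * f (Ω.coord x) + θ r * fderiv ℝ f (Ω.coord x) (v (μ r) x) := fun r x => by
      rw [deriv_mul_const (hθd r), inner_gradient_eq_fderiv,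
        fderiv_const_mul (hfd _)]
      rfl
    simp only [hint] at hw
    have h0 : (0 : ℝ) ∈ Icc 0 T := ⟨le_rfl, hT⟩
    have hinit : ∫ x, θ 0 * f (Ω.coord x) ∂(μ 0 : Measure Ω.Pt) = θ 0 * a 0 := by
      rw [integral_const_mul, ha, ← hmμ 0 h0]
    rw [hinit] at hw
    refine Eq.trans ?_ hw
    congr 1
    rw [intervalIntegral.integral_of_le hH.le, integral_Ioc_eq_integral_Ioo]
    have hsub : Ioo 0 H ⊆ Ioo 0 T := Ioo_subset_Ioo_right hHT
    -- Beyond `H` the integrand vanishes because `θ` is zero from some `c < H` on, so the velocity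
    -- matters only where it agrees with `V`.
    rw [setIntegral_eq_of_subset_of_forall_sdiff_eq_zero measurableSet_Ioo hsub]
    · refine setIntegral_congr_ae measurableSet_Ioo ?_
      filter_upwards [(ae_restrict_iff' measurableSet_Ioo).1 hVv] with r hr hrm
      rw [← hmμ r ⟨hrm.1.le, (hsub hrm).2.le⟩] at hr ⊢
      simp only [← hr hrm]
      rw [integral_add, integral_const_mul, integral_const_mul]
      · exact (Integrable.of_bound hfc.aestronglyMeasurable C (ae_of_all _ fun x => hC _)).const_mul _
      · refine Integrable.const_mul (Integrable.of_bound ?_ (K * β r) (ae_of_all _ fun x => ?_)) _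
        · have h1 : Continuous fun y => fderiv ℝ f y (V r y) :=
            (hfs.continuous_fderiv (by simp)).clm_apply (hV.continuous r)
          exact (h1.measurable.comp Ω.measurable_coord).aestronglyMeasurable
        · exact abs_fderiv_apply_le hV hf.lipschitz r _
    · intro r hr
      have hrH : H ≤ r := not_lt.1 fun h => hr.2 ⟨hr.1.1, h⟩
      have h1 : θ r = 0 := hc r (hcH.le.trans hrH)
      have h2 : deriv θ r = 0 := by
        have : θ =ᶠ[𝓝 r] fun _ => 0 := by
          filter_upwards [lt_mem_nhds (hcH.trans_le hrH)] with s hs using hc s hs.le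
        rw [this.deriv_eq, deriv_const]
      simp [h1, h2]
  have h1 := key t ⟨hs.trans hst, ht⟩
  have h2 := key s ⟨hs, hst.trans ht⟩
  rw [← intervalIntegral.integral_interval_sub_left (hbi.intervalIntegrable)
    (hbi.intervalIntegrable (a := 0)), ← h1, ← h2]
  ring

end

section

/-! ### Representation of solutions by flows -/

variable {d : ℕ} {Ω : SpatialDomain d}

theorem abs_sub_sub_fderiv_le {g : E d → ℝ} (hg : ContDiff ℝ ∞ g) {L : ℝ} (hL : 0 ≤ L)
    (h : ∀ x y, ‖fderiv ℝ g x - fderiv ℝ g y‖ ≤ L * ‖x - y‖) (y z : E d) :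
    |g z - g y - fderiv ℝ g y (z - y)| ≤ L * ‖z - y‖ ^ 2 := by
  have h1 := Convex.norm_image_sub_le_of_norm_fderiv_le' (𝕜 := ℝ) (f := g) (φ := fderiv ℝ g y)
    (C := L * ‖z - y‖) (s := Metric.closedBall y ‖z - y‖) (x := y) (y := z)
    (fun x _ => (hg.differentiable (by simp)).differentiableAt)
    (fun x hx => (h x y).trans (mul_le_mul_of_nonneg_left (by simpa [dist_eq_norm] using hx) hL))
    (convex_closedBall _ _) (Metric.mem_closedBall_self (norm_nonneg _))
    (by simp [dist_eq_norm])
  rw [Real.norm_eq_abs] at h1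
  linarith [h1, sq (‖z - y‖), mul_assoc L ‖z - y‖ ‖z - y‖]

namespace IsTransported

variable {H : ℝ} {V : ℝ → E d → E d} {β : ℝ → ℝ} {m : ℝ → ProbabilityMeasure Ω.Pt}

theorem flow_add (hm : IsTransported Ω H V β m) {k : E d} (hk : k ∈ Ω.lattice) (s r : ℝ)
    (x : E d) : hm.field.flow s r (x + k) = hm.field.flow s r x + k :=
  hm.field.flow_add_of_periodic (fun r x => hm.periodic r k hk x) s r x

theorem isLipTest_flow (hm : IsTransported Ω H V β m) {K : NNReal} {f : E d → ℝ}
    (hf : Ω.IsLipTest K f) (s r : ℝ) : Ω.IsLipTest (K * 2) fun x => f (hm.field.flow s r x) :=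
  hf.comp (hm.field.lipschitzWith_flow s r) (fun _ hk x => hm.flow_add hk s r x)
    (hm.field.norm_flow_sub_half s r)

/-- The change of the integral of a mollified test function, which is carried along the flow, in
a short time. -/
theorem abs_integral_mollify_sub_le (hm : IsTransported Ω H V β m) {p : ℝ} (hp : 1 ≤ p)
    {h : ℝ → ℝ} (hh : ∀ u, 0 ≤ h u) (hhi : IntervalIntegrable h volume 0 H)
    (hW : ∀ s t, 0 ≤ s → s ≤ t → t ≤ H →
      wasserstein p (m t) (m s) ≤ ENNReal.ofReal (∫ u in s..t, h u))
    {K : NNReal} {ψ : E d → ℝ} (hψ : Ω.IsLipTest K ψ) {ε : ℝ} (hε : 0 < ε) {s s' : ℝ}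
    (hs : 0 ≤ s) (hss : s ≤ s') (hs' : s' ≤ H) :
    |∫ x, mollify ε hε ψ (Ω.coord x) ∂(m s' : Measure Ω.Pt) -
      ∫ x, mollify ε hε (fun y => ψ (hm.field.flow s s' y)) (Ω.coord x) ∂(m s : Measure Ω.Pt)| ≤
      (2 * K * ε) * ((∫ u in s..s', β u) + ∫ u in s..s', h u) +
      (2 * (K * (∫ z, ‖fderivBump d ε hε z‖) + K)) *
        ((∫ u in s..s', β u) + ∫ u in s..s', h u) ^ 2 := by
  have hV := hm.field
  set g := mollify ε hε ψ with hgdef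
  have hg : Ω.IsLipTest K g := hψ.mollify hε
  have hgs : ContDiff ℝ ∞ g := contDiff_mollify hψ.lipschitz.continuous
  have hgd : Continuous (fderiv ℝ g) := hgs.continuous_fderiv (by simp)
  set C : ℝ := ∫ z, ‖fderivBump d ε hε z‖ with hC
  have hC0 : 0 ≤ C := integral_nonneg fun _ => norm_nonneg _
  set L : ℝ := K * C with hL
  have hL0 : 0 ≤ L := mul_nonneg K.coe_nonneg hC0
  have hgL : ∀ x y, ‖fderiv ℝ g x - fderiv ℝ g y‖ ≤ L * ‖x - y‖ :=
    norm_fderiv_mollify_sub_le hψ.lipschitz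
  have hgK : ∀ x, ‖fderiv ℝ g x‖ ≤ K := fun x => norm_fderiv_le_of_lipschitz ℝ hg.lipschitz
  set bβ := ∫ u in s..s', β u with hbβ
  set bh := ∫ u in s..s', h u with hbh
  have hbβ0 : 0 ≤ bβ := intervalIntegral.integral_nonneg hss fun u _ => hV.nonneg u
  have hbh0 : 0 ≤ bh := intervalIntegral.integral_nonneg hss fun u _ => hh u
  set δ := bβ + bh with hδ
  have hδ0 : 0 ≤ δ := add_nonneg hbβ0 hbh0
  let G : ℝ → E d → ℝ := fun r y => fderiv ℝ g y (V r y)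
  have hGb : ∀ r y, |G r y| ≤ K * β r := fun r y => abs_fderiv_apply_le hV hg.lipschitz r y
  have hGl : ∀ r x y, ‖G r x - G r y‖ ≤ ((L + K) * β r) * ‖x - y‖ := fun r x y => by
    have e : G r x - G r y = (fderiv ℝ g x - fderiv ℝ g y) (V r x) +
        fderiv ℝ g y (V r x - V r y) := by
      simp only [G, sub_apply, map_sub]; ring
    rw [e]
    calc _ ≤ ‖(fderiv ℝ g x - fderiv ℝ g y) (V r x)‖ + ‖fderiv ℝ g y (V r x - V r y)‖ :=
          norm_add_le _ _
      _ ≤ (L * ‖x - y‖) * β r + K * (β r * ‖x - y‖) := by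
          refine add_le_add ?_ ?_
          · exact (ContinuousLinearMap.le_opNorm _ _).trans (mul_le_mul (hgL x y)
              (hV.norm_le r x) (norm_nonneg _) (by positivity))
          · exact (ContinuousLinearMap.le_opNorm _ _).trans (mul_le_mul (hgK y)
              (hV.lipschitz r x y) (norm_nonneg _) K.coe_nonneg)
      _ = _ := by ring
  have hGp : ∀ r, Ω.IsPeriodic (G r) := fun r k hk x => by
    have h1 : fderiv ℝ g (x + k) = fderiv ℝ g x := by
      rw [← fderiv_comp_add_right]
      congr 1
      exact funext fun y => hg.periodic k hk y
    simp only [G, h1, hm.periodic r k hk x]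
  have hGm : Measurable fun z : ℝ × Ω.Pt => G z.1 (Ω.coord z.2) := by
    have h2 : Measurable fun z : ℝ × Ω.Pt => V z.1 (Ω.coord z.2) :=
      hV.measurable_uncurry.comp
        (measurable_fst.prodMk (Ω.measurable_coord.comp measurable_snd))
    have h3 : Measurable fun z : ℝ × Ω.Pt => fderiv ℝ g (Ω.coord z.2) :=
      hgd.measurable.comp (Ω.measurable_coord.comp measurable_snd)
    have h4 : Measurable fun z : (E d →L[ℝ] ℝ) × E d => z.1 z.2 :=
      (isBoundedBilinearMap_apply.continuous).measurable
    exact h4.comp (h3.prodMk h2)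
  have hβi : ∀ a b, IntervalIntegrable β volume a b := fun a b => hV.integrable.intervalIntegrable
  have hhi' : IntervalIntegrable h volume s s' :=
    hhi.mono_set (by
      rw [uIcc_of_le hss, uIcc_of_le (hs.trans (hss.trans hs'))]
      exact Icc_subset_Icc hs hs')
  -- the increment is computed with the frozen measure
  have hinc := hm.increment K g hg hgs s s' hs hss hs'
  have hGsint : Integrable (fun z : ℝ × Ω.Pt => G z.1 (Ω.coord z.2))
      (volume.prod (m s : Measure Ω.Pt)) := by
    refine ((hV.integrable.const_mul (K : ℝ)).comp_fst (m s : Measure Ω.Pt)).mono'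
      hGm.aestronglyMeasurable (ae_of_all _ fun z => hGb _ _)
  have hb1 : IntervalIntegrable (fun r => ∫ x, G r (Ω.coord x) ∂(m r : Measure Ω.Pt))
      volume s s' :=
    (integrable_integral_fderiv hV hm.continuous hg.lipschitz hgs).intervalIntegrable
  have hb2 : IntervalIntegrable (fun r => ∫ x, G r (Ω.coord x) ∂(m s : Measure Ω.Pt))
      volume s s' := hGsint.integral_prod_left.intervalIntegrable
  -- Replacing `m r` by `m s` costs the Lipschitz constant `(L + K) β r` of `G r` times the distance
  -- moved, at most `bh`. Integrated, this is of order `bβ * bh`, hence quadratic.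
  have hT1 : |(∫ r in s..s', ∫ x, G r (Ω.coord x) ∂(m r : Measure Ω.Pt)) -
      ∫ r in s..s', ∫ x, G r (Ω.coord x) ∂(m s : Measure Ω.Pt)| ≤ (L + K) * δ ^ 2 := by
    rw [← intervalIntegral.integral_sub hb1 hb2]
    have h1 : ∀ r ∈ Ioc s s', ‖(∫ x, G r (Ω.coord x) ∂(m r : Measure Ω.Pt)) -
        ∫ x, G r (Ω.coord x) ∂(m s : Measure Ω.Pt)‖ ≤ ((L + K) * bh) * β r := by
      intro r hr
      have h2 := hW s r hs hr.1.le (hr.2.trans hs')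
      have h3 : ∫ u in s..r, h u ≤ bh :=
        intervalIntegral.integral_mono_interval le_rfl hr.1.le hr.2 (ae_of_all _ hh) hhi'
      have h4 := abs_integral_sub_integral_le_wasserstein hp (G := fun x => G r (Ω.coord x))
        (L := (L + K) * β r) (w := bh) (mul_nonneg (add_nonneg hL0 K.coe_nonneg) (hV.nonneg r))
        (fun x y => SpatialDomain.norm_comp_coord_sub_le
          (mul_nonneg (add_nonneg hL0 K.coe_nonneg) (hV.nonneg r)) (hGl r) (hGp r) x y) hbh0
        ⟨K * β r, fun x => hGb _ _⟩ (h2.trans (ENNReal.ofReal_le_ofReal h3))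
      rw [Real.norm_eq_abs]
      linarith
    have h5 := intervalIntegral.norm_integral_le_of_norm_le hss (ae_of_all _ h1)
      ((hβi s s').const_mul _)
    rw [Real.norm_eq_abs, intervalIntegral.integral_const_mul] at h5
    refine h5.trans ?_
    have h6 : bh * bβ ≤ δ ^ 2 := by rw [hδ]; nlinarith
    have h7 : 0 ≤ L + K := add_nonneg hL0 K.coe_nonneg
    calc (L + K) * bh * ∫ u in s..s', β u = (L + K) * (bh * bβ) := by rw [← hbβ]; ring
      _ ≤ _ := mul_le_mul_of_nonneg_left h6 h7
  have hswap : ∫ r in s..s', ∫ x, G r (Ω.coord x) ∂(m s : Measure Ω.Pt) =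
      ∫ x, fderiv ℝ g (Ω.coord x) (∫ r in s..s', V r (Ω.coord x)) ∂(m s : Measure Ω.Pt) := by
    rw [intervalIntegral_integral_swap]
    · refine integral_congr_ae (ae_of_all _ fun x => ?_)
      exact ContinuousLinearMap.intervalIntegral_comp_comm _
        (hV.integrable_comp measurable_const).intervalIntegrable
    · exact hGsint.mono_measure (Measure.prod_mono Measure.restrict_le_self le_rfl)
  -- the pointwise comparison
  let Φ := hV.flow s s'
  have hpt : ∀ y, |mollify ε hε (fun y => ψ (Φ y)) y - g y -
      fderiv ℝ g y (∫ r in s..s', V r y)| ≤ (2 * K * ε) * δ + (L + K) * δ ^ 2 := by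
    intro y
    -- Mollification does not commute with the flow, but the displacement is Lipschitz with constant
    -- `2 bβ` and is compared at points at distance at most `ε`. This commutator is the only
    -- first-order error, and it carries the factor `ε`.
    have h1 : |g (Φ y) - mollify ε hε (fun y => ψ (Φ y)) y| ≤ (2 * K * ε) * bβ := by
      refine abs_mollify_sub_mollify_le hψ.lipschitz.continuous
        (hψ.lipschitz.continuous.comp (hV.lipschitzWith_flow s s').continuous) fun z hz => ?_
      have h2 := hψ.lipschitz.dist_le_mul (Φ y - z) (Φ (y - z))
      rw [Real.dist_eq, dist_eq_norm] at h2
      have h3 := hV.norm_displacement_sub_le hss y (y - z)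
      have h4 : hV.flow s s' y - y - (hV.flow s s' (y - z) - (y - z)) =
          Φ y - z - Φ (y - z) := by simp only [Φ]; abel
      rw [h4, sub_sub_cancel] at h3
      have h5 : bβ * (2 * ‖z‖) ≤ bβ * (2 * ε) := by gcongr
      have h6 := mul_le_mul_of_nonneg_left (h3.trans h5) K.coe_nonneg
      exact h2.trans (h6.trans_eq (by ring))
    have h2 := abs_sub_sub_fderiv_le hgs hL0 hgL y (Φ y)
    have h3 : ‖Φ y - y‖ ^ 2 ≤ bβ ^ 2 :=
      pow_le_pow_left₀ (norm_nonneg _) (hV.norm_flow_sub_le hss y) 2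
    have h4 : |fderiv ℝ g y (Φ y - y) - fderiv ℝ g y (∫ r in s..s', V r y)| ≤ K * bβ ^ 2 := by
      rw [← map_sub, ← Real.norm_eq_abs]
      exact (ContinuousLinearMap.le_opNorm _ _).trans (mul_le_mul (hgK y)
        (hV.norm_displacement_sub_euler_le hss y) (norm_nonneg _) K.coe_nonneg)
    have h5 : bβ ^ 2 ≤ δ ^ 2 := pow_le_pow_left₀ hbβ0 (by linarith) 2
    have h6 : (2 * K * ε) * bβ ≤ (2 * K * ε) * δ :=
      mul_le_mul_of_nonneg_left (by linarith) (by positivity)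
    have h7 := mul_le_mul_of_nonneg_left (h3.trans h5) hL0
    have h8 := mul_le_mul_of_nonneg_left h5 K.coe_nonneg
    rw [abs_le] at h1 h2 h4 ⊢
    have h9 : (L + (K : ℝ)) * δ ^ 2 = L * δ ^ 2 + K * δ ^ 2 := by ring
    constructor <;> linarith [h1.1, h1.2, h2.1, h2.2, h4.1, h4.2]
  have hi1 : Integrable (fun x => mollify ε hε (fun y => ψ (Φ y)) (Ω.coord x))
      (m s : Measure Ω.Pt) := by
    have h1 := (hm.isLipTest_flow hψ s s').mollify hε
    obtain ⟨B, hB⟩ := h1.bounded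
    exact Integrable.of_bound h1.continuous_comp_coord.aestronglyMeasurable B
      (ae_of_all _ fun x => hB _)
  have hi2 : Integrable (fun x => g (Ω.coord x)) (m s : Measure Ω.Pt) := by
    obtain ⟨B, hB⟩ := hg.bounded
    exact Integrable.of_bound hg.continuous_comp_coord.aestronglyMeasurable B
      (ae_of_all _ fun x => hB _)
  have hi3 : Integrable (fun x => fderiv ℝ g (Ω.coord x) (∫ r in s..s', V r (Ω.coord x)))
      (m s : Measure Ω.Pt) := by
    have h1 : Integrable (fun x => ∫ r in s..s', G r (Ω.coord x)) (m s : Measure Ω.Pt) := by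
      simp only [intervalIntegral.integral_of_le hss]
      exact Integrable.integral_prod_right (f := fun z : ℝ × Ω.Pt => G z.1 (Ω.coord z.2))
        (hGsint.mono_measure (Measure.prod_mono Measure.restrict_le_self le_rfl))
    refine h1.congr (ae_of_all _ fun x => ?_)
    exact ContinuousLinearMap.intervalIntegral_comp_comm _
      (hV.integrable_comp measurable_const).intervalIntegrable
  have hT2 : |(∫ x, mollify ε hε (fun y => ψ (Φ y)) (Ω.coord x) ∂(m s : Measure Ω.Pt)) -
      (∫ x, g (Ω.coord x) ∂(m s : Measure Ω.Pt)) -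
      ∫ x, fderiv ℝ g (Ω.coord x) (∫ r in s..s', V r (Ω.coord x)) ∂(m s : Measure Ω.Pt)| ≤
      (2 * K * ε) * δ + (L + K) * δ ^ 2 := by
    rw [← integral_sub hi1 hi2, ← integral_sub (f := fun x =>
      mollify ε hε (fun y => ψ (Φ y)) (Ω.coord x) - g (Ω.coord x)) (hi1.sub hi2) hi3,
      ← Real.norm_eq_abs]
    refine (norm_integral_le_of_norm_le_const (ae_of_all _ fun x => hpt (Ω.coord x))).trans ?_
    simp
  rw [← hswap] at hT2
  change ∫ x, g (Ω.coord x) ∂(m s' : Measure Ω.Pt) - ∫ x, g (Ω.coord x) ∂(m s : Measure Ω.Pt) =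
    ∫ r in s..s', ∫ x, G r (Ω.coord x) ∂(m r : Measure Ω.Pt) at hinc
  rw [← hinc] at hT1
  rw [abs_le] at hT1 hT2 ⊢
  change _ ∧ ∫ x, g (Ω.coord x) ∂(m s' : Measure Ω.Pt) -
    (∫ x, mollify ε hε (fun y => ψ (Φ y)) (Ω.coord x) ∂(m s : Measure Ω.Pt)) ≤ _
  change _ ≤ ∫ x, g (Ω.coord x) ∂(m s' : Measure Ω.Pt) -
    (∫ x, mollify ε hε (fun y => ψ (Φ y)) (Ω.coord x) ∂(m s : Measure Ω.Pt)) ∧ _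
  constructor <;> linarith [hT1.1, hT1.2, hT2.1, hT2.2]

/-- A transported curve, absolutely continuous in the Wasserstein distance, is the image of its
initial datum under the flow, tested with Lipschitz functions. -/
theorem integral_eq_integral_flow (hm : IsTransported Ω H V β m) {p : ℝ} (hp : 1 ≤ p)
    {h : ℝ → ℝ} (hh : ∀ u, 0 ≤ h u) (hhi : IntervalIntegrable h volume 0 H)
    (hW : ∀ s t, 0 ≤ s → s ≤ t → t ≤ H →
      wasserstein p (m t) (m s) ≤ ENNReal.ofReal (∫ u in s..t, h u))
    {K : NNReal} {f : E d → ℝ} (hf : Ω.IsLipTest K f) {t : ℝ} (ht0 : 0 ≤ t) (htH : t ≤ H) :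
    ∫ x, f (Ω.coord x) ∂(m t : Measure Ω.Pt) =
      ∫ x, f (hm.field.flow 0 t (Ω.coord x)) ∂(m 0 : Measure Ω.Pt) := by
  have hV := hm.field
  -- One function controls both the motion of particles (`β`) and the motion of the measure (`h`).
  let M : ℝ → ℝ := fun s => (∫ u in 0..s, β u) + ∫ u in 0..s, h u
  have hβi : ∀ a b, IntervalIntegrable β volume a b := fun a b => hV.integrable.intervalIntegrable
  have hhi' : ∀ {a b}, 0 ≤ a → a ≤ b → b ≤ H → IntervalIntegrable h volume a b :=
    fun {a b} ha hab hb => hhi.mono_set (by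
      rw [uIcc_of_le hab, uIcc_of_le (ha.trans (hab.trans hb))]
      exact Icc_subset_Icc ha hb)
  have hMsub : ∀ s ∈ Icc 0 t, ∀ s' ∈ Icc 0 t, s ≤ s' →
      M s' - M s = (∫ u in s..s', β u) + ∫ u in s..s', h u := by
    intro s hs s' hs' hss
    rw [← intervalIntegral.integral_interval_sub_left (hβi 0 s') (hβi 0 s),
      ← intervalIntegral.integral_interval_sub_left (hhi' le_rfl hs'.1 (hs'.2.trans htH))
        (hhi' le_rfl hs.1 (hs.2.trans htH))]
    simp only [M]; ring
  have hMmono : MonotoneOn M (Icc 0 t) := fun s hs s' hs' hss => by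
    have h1 := hMsub s hs s' hs' hss
    have h2 : 0 ≤ ∫ u in s..s', β u :=
      intervalIntegral.integral_nonneg hss fun u _ => hV.nonneg u
    have h3 : 0 ≤ ∫ u in s..s', h u := intervalIntegral.integral_nonneg hss fun u _ => hh u
    linarith
  have hMcont : ContinuousOn M (Icc 0 t) := by
    refine ContinuousOn.add
      (intervalIntegral.continuous_primitive hβi 0).continuousOn ?_
    have h1 := intervalIntegral.continuousOn_primitive_interval (μ := volume) (f := h)
      (a := 0) (b := t) (by
        have := (hhi' le_rfl ht0 htH)
        rw [intervalIntegrable_iff_integrableOn_Icc_of_le ht0] at this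
        rwa [uIcc_of_le ht0])
    rwa [uIcc_of_le ht0] at h1
  have hMt : 0 ≤ M t - M 0 := sub_nonneg.2 (hMmono ⟨le_rfl, ht0⟩ ⟨ht0, le_rfl⟩ ht0)
  -- The flow doubles the Lipschitz constant, so the first-order error is `2 (2 K) ε (M t - M 0)`,
  -- and removing the mollification at times `0` and `t` costs `2 K ε` each.
  have hmain : ∀ ε, 0 < ε → |(∫ x, f (Ω.coord x) ∂(m t : Measure Ω.Pt)) -
      ∫ x, f (hm.field.flow 0 t (Ω.coord x)) ∂(m 0 : Measure Ω.Pt)| ≤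
      (4 * K * (M t - M 0) + 4 * K) * ε := by
    intro ε hε
    -- The test function carried back along characteristics: it is `f` at time `t` and `f` composed
    -- with the flow at time `0`.
    let ψ : ℝ → E d → ℝ := fun s y => f (hV.flow s t y)
    have hψ : ∀ s, Ω.IsLipTest (K * 2) (ψ s) := fun s => hm.isLipTest_flow hf s t
    let A : ℝ → ℝ := fun s => ∫ x, mollify ε hε (ψ s) (Ω.coord x) ∂(m s : Measure Ω.Pt)
    have hA := abs_sub_le_of_quadratic_increments (F := A) (M := M) (t := t)
      (a := 2 * ((K * 2 : NNReal) : ℝ) * ε)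
      (b := 2 * (((K * 2 : NNReal) : ℝ) * (∫ z, ‖fderivBump d ε hε z‖) + ((K * 2 : NNReal) : ℝ)))
      ht0 hMcont hMmono
      (by have : 0 ≤ ∫ z, ‖fderivBump d ε hε z‖ := integral_nonneg fun _ => norm_nonneg _
          positivity)
      (fun s hs s' hs' hss => by
        have h1 := hm.abs_integral_mollify_sub_le hp hh hhi hW (hψ s') hε hs.1 hss
          (hs'.2.trans htH)
        rw [hMsub s hs s' hs' hss]
        have h2 : (fun y => ψ s' (hV.flow s s' y)) = ψ s := funext fun y => by
          simp only [ψ, hV.flow_flow]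
        rw [h2] at h1
        exact h1)
    have hclose : ∀ s, |A s - ∫ x, ψ s (Ω.coord x) ∂(m s : Measure Ω.Pt)| ≤ 2 * K * ε := by
      intro s
      have hi : ∀ {g : E d → ℝ}, Ω.IsLipTest (K * 2) g →
          Integrable (fun x => g (Ω.coord x)) (m s : Measure Ω.Pt) := fun hg => by
        obtain ⟨B, hB⟩ := hg.bounded
        exact Integrable.of_bound hg.continuous_comp_coord.aestronglyMeasurable B
          (ae_of_all _ fun x => hB _)
      simp only [A]
      rw [← integral_sub (hi ((hψ s).mollify hε)) (hi (hψ s)), ← Real.norm_eq_abs]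
      refine (norm_integral_le_of_norm_le_const (C := 2 * K * ε) (ae_of_all _ fun x => ?_)).trans
        (by simp)
      have := abs_mollify_sub_le (hε := hε) (hψ s).lipschitz (Ω.coord x)
      rw [Real.norm_eq_abs]
      refine this.trans_eq ?_
      push_cast; ring
    have h1 := hclose t
    have h2 := hclose 0
    have h3 : ∀ x, ψ t (Ω.coord x) = f (Ω.coord x) := fun x => by simp only [ψ, hV.flow_self]
    simp only [h3] at h1
    push_cast at hA
    rw [abs_le] at hA h1 h2 ⊢
    change _ ≤ _ - ∫ x, ψ 0 (Ω.coord x) ∂(m 0 : Measure Ω.Pt) ∧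
      _ - ∫ x, ψ 0 (Ω.coord x) ∂(m 0 : Measure Ω.Pt) ≤ _
    constructor <;> linarith [hA.1, hA.2, h1.1, h1.2, h2.1, h2.2]
  have h0 : |(∫ x, f (Ω.coord x) ∂(m t : Measure Ω.Pt)) -
      ∫ x, f (hm.field.flow 0 t (Ω.coord x)) ∂(m 0 : Measure Ω.Pt)| ≤ 0 := by
    refine le_of_forall_pos_le_add fun η hη => ?_
    have hc : 0 < 4 * K * (M t - M 0) + 4 * K + 1 := by positivity
    refine (hmain (η / (4 * K * (M t - M 0) + 4 * K + 1)) (by positivity)).trans ?_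
    rw [zero_add, ← mul_div_assoc, div_le_iff₀ hc]
    nlinarith
  exact sub_eq_zero.1 (abs_nonpos_iff.1 h0)

/-- A transported curve is the image of its initial datum under the flow. -/
theorem map_flow_eq (hm : IsTransported Ω H V β m) {p : ℝ} (hp : 1 ≤ p)
    {h : ℝ → ℝ} (hh : ∀ u, 0 ≤ h u) (hhi : IntervalIntegrable h volume 0 H)
    (hW : ∀ s t, 0 ≤ s → s ≤ t → t ≤ H →
      wasserstein p (m t) (m s) ≤ ENNReal.ofReal (∫ u in s..t, h u))
    {t : ℝ} (ht0 : 0 ≤ t) (htH : t ≤ H) :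
    (m 0 : Measure Ω.Pt).map (fun x => Ω.fold (hm.field.flow 0 t (Ω.coord x))) =
      (m t : Measure Ω.Pt) ∧
    ∀ᵐ x ∂(m 0 : Measure Ω.Pt), hm.field.flow 0 t (Ω.coord x) ∈ Ω.carrier := by
  have hΦ : Measurable (hm.field.flow 0 t) :=
    (hm.field.lipschitzWith_flow 0 t).continuous.measurable
  have hΦc : Measurable fun x => hm.field.flow 0 t (Ω.coord x) := hΦ.comp Ω.measurable_coord
  have := Measure.isProbabilityMeasure_map (μ := (m t : Measure Ω.Pt))
    Ω.measurable_coord.aemeasurable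
  have := Measure.isProbabilityMeasure_map (μ := (m 0 : Measure Ω.Pt)) hΦc.aemeasurable
  have hmt : (m t : Measure Ω.Pt).map Ω.coord Ω.carrierᶜ = 0 := by
    rw [Measure.map_apply Ω.measurable_coord Ω.measurableSet_carrier.compl]
    convert measure_empty (μ := (m t : Measure Ω.Pt))
    ext x
    simp [Ω.coord_mem_carrier x]
  obtain ⟨h1, h2⟩ := SpatialDomain.map_fold_eq_of_integral_eq
    (m' := (m 0 : Measure Ω.Pt).map fun x => hm.field.flow 0 t (Ω.coord x)) hmt fun K f hf => by
    rw [integral_map Ω.measurable_coord.aemeasurable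
        hf.lipschitz.continuous.aestronglyMeasurable,
      integral_map hΦc.aemeasurable hf.lipschitz.continuous.aestronglyMeasurable]
    exact hm.integral_eq_integral_flow hp hh hhi hW hf ht0 htH
  rw [Measure.map_map Ω.measurable_fold Ω.measurable_coord,
    Measure.map_map Ω.measurable_fold hΦc] at h1
  refine ⟨?_, ?_⟩
  · refine Eq.trans h1.symm ?_
    rw [show Ω.fold ∘ Ω.coord = id from funext Ω.fold_coord, Measure.map_id]
  · rw [Measure.map_apply hΦc Ω.measurableSet_carrier.compl] at h2
    exact h2

end IsTransported

end

section

/-! ### The first variation of the distance between two solutions -/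

variable {d : ℕ} {Ω : SpatialDomain d}

/-- Hölder's inequality, including `p = 1`; for Lebesgue measure on `(0, t]` the prefactor is `t ^
(p - 1)`. -/
theorem lintegral_rpow_le_of_measure {X : Type*} [MeasurableSpace X] {m : Measure X} {p : ℝ}
    (hp : 1 ≤ p) {f : X → ℝ≥0∞} (hf : AEMeasurable f m) :
    (∫⁻ x, f x ∂m) ^ p ≤ m univ ^ (p - 1) * ∫⁻ x, f x ^ p ∂m := by
  have hp0 : 0 < p := by linarith
  have h1 := eLpNorm'_le_eLpNorm'_mul_rpow_measure_univ (μ := m) (f := f) zero_lt_one hp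
    hf.aestronglyMeasurable
  simp only [eLpNorm', enorm_eq_self, ENNReal.rpow_one, div_one] at h1
  calc (∫⁻ x, f x ∂m) ^ p ≤ ((∫⁻ x, f x ^ p ∂m) ^ (1 / p) * m univ ^ (1 - 1 / p)) ^ p :=
        ENNReal.rpow_le_rpow h1 hp0.le
    _ = _ := by
        rw [ENNReal.mul_rpow_of_nonneg _ _ hp0.le, ← ENNReal.rpow_mul, ← ENNReal.rpow_mul,
          one_div_mul_cancel hp0.ne', ENNReal.rpow_one, mul_comm]
        congr 2
        field_simp

/-- Bound for the Wasserstein distance of the images of a measure under two maps whose distance is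
controlled by a time integral. -/
theorem mul_wasserstein_le_of_edist_le {X Y : Type*} [MeasurableSpace X] [MetricSpace Y]
    [MeasurableSpace Y] [BorelSpace Y] [SecondCountableTopology Y] {p : ℝ} (hp : 1 ≤ p)
    {ρ : Measure X} [SFinite ρ] {f g : X → Y} (hf : Measurable f) (hg : Measurable g)
    {μ ν : ProbabilityMeasure Y} (hμ : ρ.map f = (μ : Measure Y)) (hν : ρ.map g = (ν : Measure Y))
    {a y : ℝ≥0∞} (ha : a ≠ ⊤) {t : ℝ} (ht : 0 < t) {G : ℝ → X → ℝ≥0∞}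
    (hG : Measurable fun z : ℝ × X => G z.1 z.2)
    (hfg : ∀ᵐ x ∂ρ, a * edist (f x) (g x) ≤ ∫⁻ u in Ioc 0 t, G u x)
    (hy : ∀ᵐ u ∂volume.restrict (Ioo 0 t), ∫⁻ x, G u x ^ p ∂ρ ≤ y) :
    a * wasserstein p μ ν ≤ ENNReal.ofReal t * y ^ (1 / p) := by
  have hp0 : 0 < p := by linarith
  have hpt : ∀ᵐ x ∂ρ, (a * edist (f x) (g x)) ^ p ≤
      ENNReal.ofReal t ^ (p - 1) * ∫⁻ u in Ioc 0 t, G u x ^ p := by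
    filter_upwards [hfg] with x hx
    refine (ENNReal.rpow_le_rpow hx hp0.le).trans ?_
    refine (lintegral_rpow_le_of_measure hp (hG.comp
      (measurable_id.prodMk measurable_const)).aemeasurable).trans_eq ?_
    simp
  calc a * wasserstein p μ ν
      ≤ a * (∫⁻ x, edist (f x) (g x) ^ p ∂ρ) ^ (1 / p) := by
        gcongr
        exact wasserstein_le_of_maps hp hf hg hμ hν
    _ = (∫⁻ x, (a * edist (f x) (g x)) ^ p ∂ρ) ^ (1 / p) := by
        simp only [ENNReal.mul_rpow_of_nonneg _ _ hp0.le]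
        rw [lintegral_const_mul' _ _ (ENNReal.rpow_ne_top_of_nonneg hp0.le ha),
          ENNReal.mul_rpow_of_nonneg _ _ (by positivity), ← ENNReal.rpow_mul,
          mul_one_div_cancel hp0.ne', ENNReal.rpow_one]
    _ ≤ (∫⁻ x, ENNReal.ofReal t ^ (p - 1) * (∫⁻ u in Ioc 0 t, G u x ^ p) ∂ρ) ^ (1 / p) :=
        ENNReal.rpow_le_rpow (lintegral_mono_ae hpt) (by positivity)
    _ = (ENNReal.ofReal t ^ (p - 1) * ∫⁻ u in Ioc 0 t, ∫⁻ x, G u x ^ p ∂ρ) ^ (1 / p) := by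
        rw [lintegral_const_mul' _ _ (ENNReal.rpow_ne_top_of_nonneg (by linarith)
          ENNReal.ofReal_ne_top)]
        congr 2
        exact lintegral_lintegral_swap (f := fun x u => G u x ^ p) ((hG.pow_const p).comp measurable_swap).aemeasurable
    -- After Tonelli the inner integral is at most `y` for almost every time. The remaining time
    -- integral supplies the missing factor `t`, so the `p`-th root is exactly linear in `t`.
    _ ≤ (ENNReal.ofReal t ^ (p - 1) * (ENNReal.ofReal t * y)) ^ (1 / p) := by
        refine ENNReal.rpow_le_rpow ?_ (by positivity)
        gcongr
        calc ∫⁻ u in Ioc 0 t, ∫⁻ x, G u x ^ p ∂ρ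
            = ∫⁻ u in Ioo 0 t, ∫⁻ x, G u x ^ p ∂ρ := setLIntegral_congr Ioo_ae_eq_Ioc.symm
          _ ≤ ∫⁻ _ in Ioo 0 t, y := lintegral_mono_ae hy
          _ = _ := by simp [mul_comm]
    _ = ENNReal.ofReal t * y ^ (1 / p) := by
        have h1 : ENNReal.ofReal t ^ (p - 1) * ENNReal.ofReal t = ENNReal.ofReal t ^ p := by
          conv_lhs => rw [← ENNReal.rpow_one (ENNReal.ofReal t)]
          rw [← ENNReal.rpow_mul, ← ENNReal.rpow_add _ _ (by simpa using ht)
            ENNReal.ofReal_ne_top]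
          congr 1; ring
        rw [← mul_assoc, h1, ENNReal.mul_rpow_of_nonneg _ _ (by positivity), ← ENNReal.rpow_mul,
          mul_one_div_cancel hp0.ne', ENNReal.rpow_one]

/-- Bound for the Wasserstein distance by the difference of the fields along the flow. -/
theorem IsTransported.wasserstein_le {H : ℝ} {V W : ℝ → E d → E d} {β β' : ℝ → ℝ}
    {m n : ℝ → ProbabilityMeasure Ω.Pt} (hm : IsTransported Ω H V β m)
    (hn : IsTransported Ω H W β' n) (h0 : m 0 = n 0) {p : ℝ} (hp : 1 ≤ p)
    {h h' : ℝ → ℝ} (hh : ∀ u, 0 ≤ h u) (hhi : IntervalIntegrable h volume 0 H)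
    (hWm : ∀ s t, 0 ≤ s → s ≤ t → t ≤ H →
      wasserstein p (m t) (m s) ≤ ENNReal.ofReal (∫ u in s..t, h u))
    (hh' : ∀ u, 0 ≤ h' u) (hhi' : IntervalIntegrable h' volume 0 H)
    (hWn : ∀ s t, 0 ≤ s → s ≤ t → t ≤ H →
      wasserstein p (n t) (n s) ≤ ENNReal.ofReal (∫ u in s..t, h' u))
    {t : ℝ} (ht0 : 0 < t) (htH : t ≤ H) {y : ℝ≥0∞}
    (hy : ∀ᵐ u ∂volume.restrict (Ioo 0 t),
      ∫⁻ x, ‖V u (Ω.coord x) - W u (Ω.coord x)‖ₑ ^ p ∂(m u : Measure Ω.Pt) ≤ y) :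
    ENNReal.ofReal (1 - ∫ u in 0..t, β' u) * wasserstein p (m t) (n t) ≤
      ENNReal.ofReal t * y ^ (1 / p) := by
  have hV := hm.field
  have hW := hn.field
  have hstab := fun x => hV.norm_flow_sub_flow_le_integral hW ht0.le x
  have hmapm := fun u hu0 huH => hm.map_flow_eq hp hh hhi hWm (t := u) hu0 huH
  have hmapn := hn.map_flow_eq hp hh' hhi' hWn ht0.le htH
  have hXj := hV.measurable_flow 0
  have hXm : ∀ u, Measurable (hV.flow 0 u) := fun u =>
    (hV.lipschitzWith_flow 0 u).continuous.measurable
  have hYm : Measurable (hW.flow 0 t) := (hW.lipschitzWith_flow 0 t).continuous.measurable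
  have hXt := fun x => (hV.continuous_flow_time 0 x).measurable
  have hint : ∀ x, Integrable fun u => V u (hV.flow 0 u x) - W u (hV.flow 0 u x) := fun x =>
    (hV.integrable_comp (hXt x)).sub (hW.integrable_comp (hXt x))
  have hβ := hW.intervalIntegral_le ht0.le
  have hFm : Measurable fun z : ℝ × E d => V z.1 z.2 - W z.1 z.2 :=
    hV.measurable_uncurry.sub hW.measurable_uncurry
  have hFp : ∀ u, Ω.IsPeriodic fun x => V u x - W u x := fun u k hk x => by
    simp only [hm.periodic u k hk x, hn.periodic u k hk x]
  rw [← h0] at hmapn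
  change ∀ x, _ * ‖hV.flow 0 t x - hW.flow 0 t x‖ ≤ _ at hstab
  generalize hV.flow 0 = X at *
  generalize hW.flow 0 t = Y at *
  have hc := Ω.measurable_coord
  have hG : Measurable fun z : ℝ × Ω.Pt =>
      ‖V z.1 (X z.1 (Ω.coord z.2)) - W z.1 (X z.1 (Ω.coord z.2))‖ₑ := by
    have h1 : Measurable fun z : ℝ × Ω.Pt => (z.1, Ω.coord z.2) :=
      measurable_fst.prodMk (hc.comp measurable_snd)
    have h2 : Measurable fun z : ℝ × Ω.Pt => (z.1, X z.1 (Ω.coord z.2)) :=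
      measurable_fst.prodMk (hXj.comp h1)
    exact (hFm.comp h2).enorm
  -- The coupling moves each particle of the common initial datum along both flows. The contraction
  -- by `fold` is available because both endpoints represent points of `Ω` almost surely.
  refine mul_wasserstein_le_of_edist_le hp (Ω.measurable_fold.comp ((hXm t).comp hc))
    (Ω.measurable_fold.comp (hYm.comp hc)) (hmapm t ht0.le htH).1 hmapn.1 ENNReal.ofReal_ne_top ht0
    (G := fun u x => ‖V u (X u (Ω.coord x)) - W u (X u (Ω.coord x))‖ₑ) hG ?_ ?_
  · filter_upwards [(hmapm t ht0.le htH).2, hmapn.2] with x hx hy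
    calc _ ≤ ENNReal.ofReal (1 - ∫ u in 0..t, β' u) *
          ENNReal.ofReal ‖X t (Ω.coord x) - Y (Ω.coord x)‖ := by
          gcongr
          rw [edist_dist, ← dist_eq_norm]
          exact ENNReal.ofReal_le_ofReal (Ω.dist_fold_le hx hy)
      _ = ENNReal.ofReal ((1 - ∫ u in 0..t, β' u) * ‖X t (Ω.coord x) - Y (Ω.coord x)‖) := by
          rw [ENNReal.ofReal_mul]
          linarith
      _ ≤ ENNReal.ofReal (∫ u in 0..t, ‖V u (X u (Ω.coord x)) - W u (X u (Ω.coord x))‖) :=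
          ENNReal.ofReal_le_ofReal (hstab _)
      _ = _ := by
          rw [intervalIntegral.integral_of_le ht0.le,
            ofReal_integral_norm_eq_lintegral_enorm (hint _).integrableOn]
  -- The image of `m 0` under the first flow is `m u`, so the difference of the fields along
  -- trajectories integrates to its integral against `m u`; periodicity allows the passage through
  -- `fold`.
  · filter_upwards [hy, ae_restrict_mem measurableSet_Ioo] with u hu hut
    obtain ⟨h1, h2⟩ := hmapm u hut.1.le (hut.2.le.trans htH)
    have h3 : Measurable fun x : Ω.Pt => ‖V u (Ω.coord x) - W u (Ω.coord x)‖ₑ ^ p :=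
      ((hFm.comp (measurable_const.prodMk hc)).enorm).pow_const _
    refine Eq.trans_le ?_ hu
    rw [← h1, lintegral_map (g := fun x => Ω.fold (X u (Ω.coord x))) h3
      (Ω.measurable_fold.comp ((hXm u).comp hc))]
    refine lintegral_congr_ae ?_
    filter_upwards [h2] with x hx
    have h4 := (hFp u).fold hx
    beta_reduce at h4
    simp only [h4]

/-- Mean `p`-th powers of the difference of the velocities, for small times. -/
theorem IsRegularPair.exists_lintegral_le {p T : ℝ} (hp : 1 ≤ p) {vμ vν : Velocity Ω}
    {μ ν : ℝ → ProbabilityMeasure Ω.Pt} (hreg : IsRegularPair Ω p T vμ vν μ ν) (hT : 0 < T)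
    (hcont : ContinuousOn μ (Icc 0 T)) (hac : ∀ t ∈ Icc 0 T, (μ t : Measure Ω.Pt) ≪ Ω.vol)
    (h0 : ν 0 = μ 0)
    (hc : Continuous fun x => ‖vμ (μ 0) x - vν (μ 0) x‖ ^ p)
    (hb : ∃ C : ℝ, ∀ x, ‖vμ (μ 0) x - vν (μ 0) x‖ ^ p ≤ C) {y : ℝ≥0∞}
    (hy : ∫⁻ x, ‖vν (μ 0) x - vμ (μ 0) x‖ₑ ^ p ∂(μ 0 : Measure Ω.Pt) < y) :
    ∃ t₀, 0 < t₀ ∧ t₀ ≤ T ∧ ∀ᵐ u ∂volume.restrict (Ioo 0 t₀),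
      ∫⁻ x, ‖vμ (μ u) x - vν (ν u) x‖ₑ ^ p ∂(μ u : Measure Ω.Pt) ≤ y := by
  have hp0 : 0 < p := by linarith
  set g : Ω.Pt → ℝ := fun x => ‖vν (μ 0) x - vμ (μ 0) x‖ ^ p with hg
  have hgc : Continuous g := by simpa only [hg, norm_sub_rev] using hc
  have hg0 : ∀ x, 0 ≤ g x := fun x => by positivity
  obtain ⟨C, hC⟩ := hb
  have hgC : ∀ x, g x ≤ C := fun x => by simpa only [hg, norm_sub_rev] using hC x
  have henorm : ∀ v : E d, ‖v‖ₑ ^ p = ENNReal.ofReal (‖v‖ ^ p) := fun v => by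
    rw [← ofReal_norm, ENNReal.ofReal_rpow_of_nonneg (norm_nonneg _) hp0.le]
  have hgi : ∀ u, Integrable g (μ u : Measure Ω.Pt) := fun u =>
    Integrable.of_bound hgc.aestronglyMeasurable C (ae_of_all _ fun x => by
      rw [Real.norm_eq_abs, abs_of_nonneg (hg0 x)]; exact hgC x)
  have hI : ∫⁻ x, ‖vν (μ 0) x - vμ (μ 0) x‖ₑ ^ p ∂(μ 0 : Measure Ω.Pt) =
      ENNReal.ofReal (∫ x, g x ∂(μ 0 : Measure Ω.Pt)) := by
    rw [ofReal_integral_eq_lintegral_ofReal (hgi 0) (ae_of_all _ hg0)]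
    simp only [henorm, hg]
  rw [hI] at hy
  -- Three errors of size `ε` are allowed: the contribution of a far region, bounded by `M ^ p`
  -- times its mass; the variation of the integrand in time on the bounded complement; and the
  -- narrow convergence of `∫ g dμ_u`, with `g` bounded and continuous.
  obtain ⟨ε, hε, hεy⟩ : ∃ ε : ℝ, 0 < ε ∧
      ENNReal.ofReal (∫ x, g x ∂(μ 0 : Measure Ω.Pt) + 3 * ε) ≤ y := by
    have hlim : Tendsto (fun ε : ℝ => ENNReal.ofReal (∫ x, g x ∂(μ 0 : Measure Ω.Pt) + 3 * ε))
        (𝓝[>] 0) (𝓝 (ENNReal.ofReal (∫ x, g x ∂(μ 0 : Measure Ω.Pt)))) := by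
      have : Continuous fun ε : ℝ => ENNReal.ofReal (∫ x, g x ∂(μ 0 : Measure Ω.Pt) + 3 * ε) :=
        ENNReal.continuous_ofReal.comp (by fun_prop)
      have := this.tendsto 0
      rw [mul_zero, add_zero] at this
      exact this.mono_left nhdsWithin_le_nhds
    obtain ⟨ε, h1, h2⟩ := ((hlim.eventually_lt_const hy).and self_mem_nhdsWithin).exists
    exact ⟨ε, h2, h1.le⟩
  obtain ⟨hbd, hbd0, hbdT, hbdd⟩ := hreg.diff_bounded
  set M := eLpNormEssSup (fun z : ℝ × Ω.Pt => vν (ν z.1) z.2 - vμ (μ z.1) z.2)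
      ((volume.restrict (Ioo 0 hbd)).prod Ω.vol) with hM
  have hMp : M ^ p ≠ ⊤ := ENNReal.rpow_ne_top_of_nonneg hp0.le hbdd.ne
  -- the mass far away
  let x₀ : Ω.Pt := Classical.arbitrary _
  let F : ℕ → Set Ω.Pt := fun R => {x | (R : ℝ) ≤ dist x x₀}
  have hFc : ∀ R, IsClosed (F R) := fun R => isClosed_le continuous_const (by fun_prop)
  obtain ⟨R, hR⟩ : ∃ R, M ^ p * (μ 0 : Measure Ω.Pt) (F R) < ENNReal.ofReal ε := by
    have hanti : Antitone F := fun a b hab x hx =>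
      (Nat.cast_le (α := ℝ).2 hab).trans hx
    have h1 := tendsto_measure_iInter_atTop (μ := (μ 0 : Measure Ω.Pt))
      (fun R => (hFc R).measurableSet.nullMeasurableSet) hanti ⟨0, measure_ne_top _ _⟩
    have h2 : ⋂ R, F R = ∅ := by
      ext x
      simp only [mem_iInter, mem_empty_iff_false, iff_false, not_forall]
      obtain ⟨R, hR⟩ := exists_nat_gt (dist x x₀)
      exact ⟨R, not_le.2 hR⟩
    rw [h2, measure_empty] at h1
    have h3 := ENNReal.Tendsto.const_mul h1 (Or.inr hMp)
    rw [mul_zero] at h3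
    exact (h3.eventually_lt_const (ENNReal.ofReal_pos.2 hε)).exists
  have hμ0 : Tendsto μ (𝓝[>] 0) (𝓝 (μ 0)) := by
    have h1 : Tendsto μ (𝓝[Icc 0 T] 0) (𝓝 (μ 0)) := hcont 0 ⟨le_rfl, hT.le⟩
    exact h1.mono_left (nhdsWithin_le_of_mem (mem_of_superset (Ioc_mem_nhdsGT hT)
      Ioc_subset_Icc_self))
  have hev1 : ∀ᶠ u in 𝓝[>] (0 : ℝ), M ^ p * (μ u : Measure Ω.Pt) (F R) < ENNReal.ofReal ε := by
    -- The portmanteau inequality for the closed far region makes the smallness of its mass uniform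
    -- for small times.
    have h1 := ProbabilityMeasure.limsup_measure_closed_le_of_tendsto hμ0 (hFc R)
    rcases eq_or_ne (M ^ p) 0 with hM0 | hM0
    · rw [hM0]; simpa using hε
    have h2 : (μ 0 : Measure Ω.Pt) (F R) < ENNReal.ofReal ε / M ^ p := by
      rw [ENNReal.lt_div_iff_mul_lt (Or.inl hM0) (Or.inl hMp), mul_comm]
      exact hR
    filter_upwards [eventually_lt_of_limsup_lt (h1.trans_lt h2)] with u hu
    rw [ENNReal.lt_div_iff_mul_lt (Or.inl hM0) (Or.inl hMp), mul_comm] at hu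
    exact hu
  have hev2 : ∀ᶠ u in 𝓝[>] (0 : ℝ), ∫ x, g x ∂(μ u : Measure Ω.Pt) <
      ∫ x, g x ∂(μ 0 : Measure Ω.Pt) + ε := by
    have h1 := (ProbabilityMeasure.tendsto_iff_forall_integral_tendsto.1 hμ0)
      (BoundedContinuousFunction.ofNormedAddCommGroup g hgc C fun x => by
        rw [Real.norm_eq_abs, abs_of_nonneg (hg0 x)]; exact hgC x)
    exact h1.eventually_lt_const (by
      change ∫ x, g x ∂(μ 0 : Measure Ω.Pt) < _
      linarith)
  have hBb : Bornology.IsBounded (F R)ᶜ := by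
    refine Metric.isBounded_ball.subset (t := Metric.ball x₀ R) fun x hx => ?_
    simpa [F] using hx
  have hev3 := (hreg.diff_tendsto _ hBb).eventually_lt_const (ENNReal.ofReal_pos.2 hε)
  obtain ⟨t₁, ht₁, hI1⟩ := mem_nhdsGT_iff_exists_Ioo_subset.1 (hev1.and hev2)
  obtain ⟨t₂, hess, ht₂⟩ := (hev3.and self_mem_nhdsWithin).exists
  refine ⟨min (min t₁ t₂) (min hbd T), lt_min (lt_min ht₁ ht₂) (lt_min hbd0 hT),
    (min_le_right _ _).trans (min_le_right _ _), ?_⟩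
  set t₀ := min (min t₁ t₂) (min hbd T)
  have hae1 : ∀ᵐ u ∂volume.restrict (Ioo 0 t₀), ∀ᵐ x ∂Ω.vol,
      ‖vν (ν u) x - vμ (μ u) x‖ₑ ≤ M := by
    have h1 : ∀ᵐ z ∂((volume.restrict (Ioo 0 hbd)).prod Ω.vol),
        ‖vν (ν z.1) z.2 - vμ (μ z.1) z.2‖ₑ ≤ M := enorm_ae_le_eLpNormEssSup _ _
    have h2 := Measure.ae_ae_of_ae_prod h1
    exact ae_mono (Measure.restrict_mono (Ioo_subset_Ioo_right
      ((min_le_right _ _).trans (min_le_left _ _))) le_rfl) h2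
  have hae2 : ∀ᵐ u ∂volume.restrict (Ioo 0 t₀),
      ∀ᵐ x ∂Ω.vol.restrict (F R)ᶜ, ‖vν (ν u) x - vμ (μ u) x‖ ^ p ≤ g x + ε := by
    have h1 := ae_lt_of_essSup_lt hess
    have h2 := ae_mono (Measure.restrict_mono (show Ioo 0 t₀ ⊆ Icc 0 t₂ from fun u hu =>
      ⟨hu.1.le, hu.2.le.trans ((min_le_left _ _).trans (min_le_right _ _))⟩) le_rfl) h1
    filter_upwards [h2] with u hu
    filter_upwards [enorm_ae_le_eLpNormEssSup (fun x => ‖vν (ν u) x - vμ (μ u) x‖ ^ p -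
      ‖vν (ν 0) x - vμ (μ 0) x‖ ^ p) (Ω.vol.restrict (F R)ᶜ)] with x hx
    have h3 := hx.trans hu.le
    rw [Real.enorm_eq_ofReal_abs, ENNReal.ofReal_le_ofReal_iff hε.le, h0] at h3
    have h4 := (abs_le.1 h3).2
    change _ - g x ≤ ε at h4
    linarith
  filter_upwards [hae1, hae2, ae_restrict_mem measurableSet_Ioo] with u hu1 hu2 hut
  have hut1 : u ∈ Ioo 0 t₁ := ⟨hut.1, hut.2.trans_le ((min_le_left _ _).trans (min_le_left _ _))⟩
  obtain ⟨he1, he2⟩ := hI1 hut1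
  -- The velocity bounds hold almost everywhere for Lebesgue measure; absolute continuity of `μ u`
  -- transfers them.
  have habs : (μ u : Measure Ω.Pt) ≪ Ω.vol :=
    hac u ⟨hut.1.le, hut.2.le.trans ((min_le_right _ _).trans (min_le_right _ _))⟩
  have hm1 : ∀ᵐ x ∂(μ u : Measure Ω.Pt), ‖vν (ν u) x - vμ (μ u) x‖ₑ ≤ M := habs.ae_le hu1
  have hm2 : ∀ᵐ x ∂(μ u : Measure Ω.Pt).restrict (F R)ᶜ,
      ‖vν (ν u) x - vμ (μ u) x‖ ^ p ≤ g x + ε := (habs.restrict _).ae_le hu2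
  calc ∫⁻ x, ‖vμ (μ u) x - vν (ν u) x‖ₑ ^ p ∂(μ u : Measure Ω.Pt)
      = ∫⁻ x, ‖vν (ν u) x - vμ (μ u) x‖ₑ ^ p ∂(μ u : Measure Ω.Pt) := by
        simp only [enorm_sub_rev]
    _ = ∫⁻ x in F R, ‖vν (ν u) x - vμ (μ u) x‖ₑ ^ p ∂(μ u : Measure Ω.Pt) +
        ∫⁻ x in (F R)ᶜ, ‖vν (ν u) x - vμ (μ u) x‖ₑ ^ p ∂(μ u : Measure Ω.Pt) :=
        (lintegral_add_compl _ (hFc R).measurableSet).symm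
    _ ≤ ENNReal.ofReal ε + ENNReal.ofReal (∫ x, g x ∂(μ 0 : Measure Ω.Pt) + 2 * ε) := by
        refine add_le_add ?_ ?_
        · refine le_trans ?_ he1.le
          rw [← setLIntegral_const]
          refine lintegral_mono_ae (ae_restrict_of_ae ?_)
          filter_upwards [hm1] with x hx using ENNReal.rpow_le_rpow hx hp0.le
        · calc ∫⁻ x in (F R)ᶜ, ‖vν (ν u) x - vμ (μ u) x‖ₑ ^ p ∂(μ u : Measure Ω.Pt)
              ≤ ∫⁻ x in (F R)ᶜ, ENNReal.ofReal (g x + ε) ∂(μ u : Measure Ω.Pt) := by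
                refine lintegral_mono_ae ?_
                filter_upwards [hm2] with x hx
                rw [henorm]
                exact ENNReal.ofReal_le_ofReal hx
            _ ≤ ∫⁻ x, ENNReal.ofReal (g x + ε) ∂(μ u : Measure Ω.Pt) :=
                setLIntegral_le_lintegral _ _
            _ = ENNReal.ofReal (∫ x, (g x + ε) ∂(μ u : Measure Ω.Pt)) := by
                rw [ofReal_integral_eq_lintegral_ofReal (f := fun x => g x + ε)
                  ((hgi u).add (integrable_const _))
                  (ae_of_all _ fun x => add_nonneg (hg0 x) hε.le)]
            _ ≤ _ := by
                refine ENNReal.ofReal_le_ofReal ?_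
                rw [integral_add (hgi u) (integrable_const _)]
                simp only [integral_const, probReal_univ, one_smul]
                linarith
    _ = ENNReal.ofReal (∫ x, g x ∂(μ 0 : Measure Ω.Pt) + 3 * ε) := by
        rw [← ENNReal.ofReal_add hε.le
          (add_nonneg (integral_nonneg hg0) (by positivity))]
        congr 1; ring
    _ ≤ y := hεy

theorem IsAbsContCurve.exists_clamp {X : Type*} [MetricSpace X] [MeasurableSpace X]
    [BorelSpace X] [SecondCountableTopology X] {p T H : ℝ} (hp : 1 ≤ p) (hT : 0 ≤ T) (hH : 0 ≤ H)
    (hHT : H ≤ T) {γ : ℝ → ProbabilityMeasure X} (hγ : IsAbsContCurve p T γ) :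
    ∃ h : ℝ → ℝ, (∀ u, 0 ≤ h u) ∧ IntervalIntegrable h volume 0 H ∧
      ∀ s t, 0 ≤ s → s ≤ t → t ≤ H → wasserstein p (clampCurve hT γ t) (clampCurve hT γ s) ≤
        ENNReal.ofReal (∫ u in s..t, h u) := by
  obtain ⟨h, h1, h2, h3⟩ := hγ
  refine ⟨h, h1, h2.mono_set ?_, fun s t hs hst ht => ?_⟩
  · rw [uIcc_of_le hH, uIcc_of_le hT]; exact Icc_subset_Icc_right hHT
  · rw [clampCurve_of_mem hT γ ⟨hs.trans hst, ht.trans hHT⟩,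
      clampCurve_of_mem hT γ ⟨hs, hst.trans (ht.trans hHT)⟩]
    rcases hst.eq_or_lt with rfl | hlt
    · rw [wasserstein_self hp]; exact zero_le
    · exact h3 s t hs hlt (ht.trans hHT)

/-- The distance between two solutions with the same initial datum grows at most at the rate of
the `L^p` distance of the initial velocities. -/
theorem eventually_wasserstein_le {p T : ℝ} (hp : 1 ≤ p) (hT : 0 < T) {vμ vν : Velocity Ω}
    {A₁ A₂ : Set (ProbabilityMeasure Ω.Pt)} (hA₁ : A₁ ⊆ Ω.PpL1 p)
    {ρ : ProbabilityMeasure Ω.Pt} {μ ν : ℝ → ProbabilityMeasure Ω.Pt}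
    (hμ : IsWeakSolution Ω T vμ A₁ ρ μ) (hν : IsWeakSolution Ω T vν A₂ ρ ν)
    (hreg : IsRegularPair Ω p T vμ vν μ ν)
    (hc : Continuous fun x => ‖vμ ρ x - vν ρ x‖ ^ p)
    (hb : ∃ C : ℝ, ∀ x, ‖vμ ρ x - vν ρ x‖ ^ p ≤ C)
    (hμac : IsAbsContCurve p T μ) (hνac : IsAbsContCurve p T ν) {y : ℝ}
    (hy : (∫⁻ x, ‖vν ρ x - vμ ρ x‖ₑ ^ p ∂(ρ : Measure Ω.Pt)) ^ (1 / p) < ENNReal.ofReal y) :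
    ∀ᶠ t in 𝓝[>] (0 : ℝ), wasserstein p (μ t) (ν t) ≤ ENNReal.ofReal (t * y) := by
  have hp0 : 0 < p := by linarith
  obtain ⟨y', hy'1, hy'2⟩ := exists_between hy
  have hy0 : 0 < y := ENNReal.ofReal_pos.1 (zero_le.trans_lt hy)
  have hI : ∫⁻ x, ‖vν ρ x - vμ ρ x‖ₑ ^ p ∂(ρ : Measure Ω.Pt) < y' ^ p := by
    have := ENNReal.rpow_lt_rpow hy'1 hp0
    rwa [← ENNReal.rpow_mul, one_div_mul_cancel hp0.ne', ENNReal.rpow_one] at this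
  rw [← hμ.initial] at hI hc hb
  obtain ⟨t₀, ht₀, ht₀T, hJ⟩ := hreg.exists_lintegral_le hp hT hμ.narrowly_continuous
    (fun t ht => (hA₁ (hμ.mem t ht)).1) (hν.initial.trans hμ.initial.symm) hc hb hI
  obtain ⟨h, δ, hh0, hhT, hδ, hbl1, hbl2⟩ := hreg.velocity_bl
  obtain ⟨H₁, hH₁, hH₁h, hF1⟩ := hbl1.exists_caratheodoryField (by linarith) hh0
  obtain ⟨H₂, hH₂, hH₂h, hF2⟩ := hbl2.exists_caratheodoryField (by linarith) hh0
  set H := min (min H₁ H₂) t₀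
  have hH : 0 < H := lt_min (lt_min hH₁ hH₂) ht₀
  have hHT : H ≤ T := (min_le_right _ _).trans ht₀T
  obtain ⟨V, β, hV, hVp, hVv⟩ := hF1 H hH ((min_le_left _ _).trans (min_le_left _ _))
  obtain ⟨W, β', hW, hWp, hWv⟩ := hF2 H hH ((min_le_left _ _).trans (min_le_right _ _))
  have hm := hμ.isTransported hT.le hH hHT hV hVp hVv
  have hn := hν.isTransported hT.le hH hHT hW hWp hWv
  obtain ⟨k, hk0, hki, hkW⟩ := hμac.exists_clamp hp hT.le hH.le hHT
  obtain ⟨k', hk'0, hk'i, hk'W⟩ := hνac.exists_clamp hp hT.le hH.le hHT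
  have h0T : (0 : ℝ) ∈ Icc 0 T := ⟨le_rfl, hT.le⟩
  -- The stability factor `c = 1 - ∫ β'` tends to `1`, so `c * y` exceeds the smaller `y'` for small
  -- times; then `c` cancels from both sides.
  have hlim : Tendsto (fun t => ENNReal.ofReal ((1 - ∫ u in 0..t, β' u) * y)) (𝓝[>] 0)
      (𝓝 (ENNReal.ofReal y)) := by
    have h1 : Continuous fun t => ENNReal.ofReal ((1 - ∫ u in 0..t, β' u) * y) :=
      ENNReal.continuous_ofReal.comp ((continuous_const.sub
        (intervalIntegral.continuous_primitive
          (fun a b => hW.integrable.intervalIntegrable) 0)).mul continuous_const)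
    have h2 := h1.tendsto 0
    simp only [intervalIntegral.integral_same, sub_zero, one_mul] at h2
    exact h2.mono_left nhdsWithin_le_nhds
  have hIoo : ∀ᶠ t in 𝓝[>] (0 : ℝ), t ∈ Ioo 0 H := Ioo_mem_nhdsGT hH
  filter_upwards [hlim.eventually_const_lt hy'2, hIoo] with t ht1 ht2
  have hmain := hm.wasserstein_le hn (by
      rw [clampCurve_of_mem hT.le μ h0T, clampCurve_of_mem hT.le ν h0T, hμ.initial, hν.initial])
    hp hk0 hki hkW hk'0 hk'i hk'W ht2.1 ht2.2.le (y := y' ^ p) (by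
      have hsub1 : Ioo 0 t ⊆ Ioo 0 H := Ioo_subset_Ioo_right ht2.2.le
      have hsub2 : Ioo 0 t ⊆ Ioo 0 t₀ := Ioo_subset_Ioo_right (ht2.2.le.trans (min_le_right _ _))
      filter_upwards [ae_mono (Measure.restrict_mono hsub1 le_rfl) hVv,
        ae_mono (Measure.restrict_mono hsub1 le_rfl) hWv,
        ae_mono (Measure.restrict_mono hsub2 le_rfl) hJ,
        ae_restrict_mem measurableSet_Ioo] with u h1 h2 h3 h4
      rw [clampCurve_of_mem hT.le μ ⟨h4.1.le, (h4.2.trans ht2.2).le.trans hHT⟩]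
      simpa only [h1, h2] using h3)
  have htT : t ∈ Icc 0 T := ⟨ht2.1.le, ht2.2.le.trans hHT⟩
  rw [clampCurve_of_mem hT.le μ htT, clampCurve_of_mem hT.le ν htT, ← ENNReal.rpow_mul,
    mul_one_div_cancel hp0.ne', ENNReal.rpow_one] at hmain
  have hl := hW.intervalIntegral_le ht2.1.le
  set c := 1 - ∫ u in 0..t, β' u
  have hc0 : 0 < c := by simp only [c]; linarith
  have h5 : ENNReal.ofReal c * wasserstein p (μ t) (ν t) ≤
      ENNReal.ofReal c * ENNReal.ofReal (t * y) := by
    refine hmain.trans ?_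
    rw [← ENNReal.ofReal_mul hc0.le, show c * (t * y) = t * (c * y) by ring,
      ENNReal.ofReal_mul ht2.1.le]
    gcongr
  exact (ENNReal.mul_le_mul_iff_right (ENNReal.ofReal_pos.2 hc0).ne' ENNReal.ofReal_ne_top).1 h5

end

section

/-! ### Comparison of a curve with a Lipschitz semigroup -/

variable {X : Type*} [MetricSpace X] [MeasurableSpace X] [BorelSpace X]
  [SecondCountableTopology X]

theorem IsAbsContCurve.exists_continuousOn_bound {p T : ℝ} (hp : 1 ≤ p) (hT : 0 ≤ T)
    {γ : ℝ → ProbabilityMeasure X} (hγ : IsAbsContCurve p T γ) :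
    ∃ F : ℝ → ℝ, ContinuousOn F (Icc 0 T) ∧ ∀ s ∈ Icc 0 T, ∀ t ∈ Icc 0 T,
      wasserstein p (γ s) (γ t) ≤ ENNReal.ofReal |F s - F t| := by
  obtain ⟨h, h0, hi, hW⟩ := hγ
  have hsub : ∀ a ∈ Icc 0 T, ∀ b ∈ Icc 0 T, IntervalIntegrable h volume a b := fun a ha b hb =>
    hi.mono_set (by rw [uIcc_of_le hT]; exact (uIcc_subset_Icc ha hb))
  have hz : (0 : ℝ) ∈ Icc 0 T := ⟨le_rfl, hT⟩
  have key : ∀ s ∈ Icc 0 T, ∀ t ∈ Icc 0 T, s < t → wasserstein p (γ t) (γ s) ≤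
      ENNReal.ofReal |(∫ u in 0..t, h u) - ∫ u in 0..s, h u| := fun s hs t ht hst => by
    rw [intervalIntegral.integral_interval_sub_left (hsub 0 hz t ht) (hsub 0 hz s hs)]
    exact (hW s t hs.1 hst ht.2).trans (ENNReal.ofReal_le_ofReal (le_abs_self _))
  refine ⟨fun t => ∫ u in 0..t, h u, ?_, fun s hs t ht => ?_⟩
  · have h1 := intervalIntegral.continuousOn_primitive_interval (f := h) (μ := volume) (a := 0)
      (b := T) (by
        rw [uIcc_of_le hT, integrableOn_Icc_iff_integrableOn_Ioc]
        exact (intervalIntegrable_iff_integrableOn_Ioc_of_le hT).1 hi)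
    rwa [uIcc_of_le hT] at h1
  · rcases lt_trichotomy s t with hst | rfl | hst
    · rw [wasserstein_comm hp, abs_sub_comm]
      exact key s hs t ht hst
    · rw [wasserstein_self hp]; exact zero_le
    · exact key t ht s hs hst

variable [StandardBorelSpace X] [Nonempty X]

/-- Comparison of a curve with the orbit of its initial point under a Lipschitz semigroup. -/
theorem wasserstein_le_lintegral_of_semigroup {p T : ℝ} (hp : 1 ≤ p)
    {A : Set (ProbabilityMeasure X)} {S : ℝ → ProbabilityMeasure X → ProbabilityMeasure X}
    (hSA : ∀ ρ ∈ A, ∀ t ∈ Icc 0 T, S t ρ ∈ A) (hS0 : ∀ ρ ∈ A, S 0 ρ = ρ)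
    (hSadd : ∀ s t, 0 ≤ s → 0 ≤ t → s + t ≤ T → ∀ ρ ∈ A, S t (S s ρ) = S (t + s) ρ)
    (hSac : ∀ ρ ∈ A, IsAbsContCurve p T fun t => S t ρ)
    {K : ℝ → ℝ} (hKpos : ∀ t ∈ Icc 0 T, 0 < K t) (hKcont : ContinuousOn K (Icc 0 T))
    (hlip : ∀ t ∈ Icc 0 T, ∀ ρ₁ ∈ A, ∀ ρ₂ ∈ A,
      wasserstein p (S t ρ₁) (S t ρ₂) ≤ ENNReal.ofReal (K t) * wasserstein p ρ₁ ρ₂)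
    {γ : ℝ → ProbabilityMeasure X} (hγA : ∀ s ∈ Icc 0 T, γ s ∈ A) (hγ : IsAbsContCurve p T γ)
    {D : ℝ → ℝ≥0∞} (hDtop : ∀ s ∈ Ico 0 T, D s ≠ ⊤)
    (hD : ∀ s ∈ Ico 0 T, ∀ y : ℝ, D s < ENNReal.ofReal y → ∀ᶠ h in 𝓝[>] (0 : ℝ),
      wasserstein p (γ (s + h)) (S h (γ s)) ≤ ENNReal.ofReal (h * y))
    {t : ℝ} (ht : t ∈ Icc 0 T) :
    wasserstein p (γ t) (S t (γ 0)) ≤ ∫⁻ s in Icc 0 t, ENNReal.ofReal (K (t - s)) * D s := by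
  have hT : 0 ≤ T := ht.1.trans ht.2
  have h0t : (0 : ℝ) ∈ Icc 0 t := ⟨le_rfl, ht.1⟩
  have hmem : ∀ s ∈ Icc 0 t, s ∈ Icc 0 T := fun s hs => ⟨hs.1, hs.2.trans ht.2⟩
  have hmem' : ∀ s ∈ Icc 0 t, t - s ∈ Icc 0 T := fun s hs =>
    ⟨by linarith [hs.2], by linarith [hs.1, ht.2]⟩
  obtain ⟨C, hC⟩ := isCompact_Icc.bddAbove_image hKcont
  have hKC : ∀ s ∈ Icc 0 T, K s ≤ C := fun s hs => hC (mem_image_of_mem K hs)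
  have hC0 : 0 ≤ C := (hKpos 0 ⟨le_rfl, hT⟩).le.trans (hKC 0 ⟨le_rfl, hT⟩)
  obtain ⟨F, hFc, hF⟩ := hγ.exists_continuousOn_bound hp hT
  -- A modulus of continuity of `u ↦ S (t - u) (γ u)` at `s`: first move the datum at fixed
  -- duration, then change the duration at the fixed datum `γ s`. The function `F'` depends on `s`,
  -- which suffices for continuity point by point.
  have hE : ∀ s ∈ Icc 0 t, ∃ F' : ℝ → ℝ, ContinuousOn F' (Icc 0 T) ∧ ∀ u ∈ Icc 0 t,
      wasserstein p (S (t - u) (γ u)) (S (t - s) (γ s)) ≤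
        ENNReal.ofReal (C * |F u - F s| + |F' (t - u) - F' (t - s)|) := by
    intro s hs
    obtain ⟨F', hF'c, hF'⟩ := (hSac _ (hγA s (hmem s hs))).exists_continuousOn_bound hp hT
    refine ⟨F', hF'c, fun u hu => ?_⟩
    refine (wasserstein_triangle hp _ (S (t - u) (γ s)) _).trans ?_
    rw [ENNReal.ofReal_add (by positivity) (abs_nonneg _), ENNReal.ofReal_mul hC0]
    refine add_le_add ?_ (hF' _ (hmem' u hu) _ (hmem' s hs))
    refine (hlip _ (hmem' u hu) _ (hγA u (hmem u hu)) _ (hγA s (hmem s hs))).trans ?_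
    exact mul_le_mul' (ENNReal.ofReal_le_ofReal (hKC _ (hmem' u hu)))
      (hF u (hmem u hu) s (hmem s hs))
  -- The interpolation: follow `γ` up to time `s`, then the semigroup for the remaining time. It
  -- vanishes at `s = 0` and equals the desired distance at `s = t`.
  set G : ℝ → ℝ≥0∞ := fun s => wasserstein p (S (t - s) (γ s)) (S t (γ 0)) with hG
  have hGtop : ∀ s ∈ Icc 0 t, G s ≠ ⊤ := fun s hs => by
    obtain ⟨F', -, h2⟩ := hE 0 h0t
    have h3 := h2 s hs
    simp only [sub_zero] at h3
    exact (h3.trans_lt ENNReal.ofReal_lt_top).ne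
  have hGsub : ∀ u ∈ Icc 0 t, ∀ s ∈ Icc 0 t, ∀ c : ℝ, 0 ≤ c →
      wasserstein p (S (t - u) (γ u)) (S (t - s) (γ s)) ≤ ENNReal.ofReal c →
      (G u).toReal - (G s).toReal ≤ c := by
    intro u hu s hs c hc h1
    have h2 : G u ≤ ENNReal.ofReal c + G s :=
      (wasserstein_triangle hp _ (S (t - s) (γ s)) _).trans (by gcongr)
    have h3 := ENNReal.toReal_mono (ENNReal.add_ne_top.2 ⟨ENNReal.ofReal_ne_top, hGtop s hs⟩) h2
    rw [ENNReal.toReal_add ENNReal.ofReal_ne_top (hGtop s hs), ENNReal.toReal_ofReal hc] at h3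
    linarith
  have hcont : ContinuousOn (fun s => (G s).toReal) (Icc 0 t) := by
    intro s hs
    obtain ⟨F', hF'c, hF'⟩ := hE s hs
    have hlim : Tendsto (fun u => C * |F u - F s| + |F' (t - u) - F' (t - s)|) (𝓝[Icc 0 t] s)
        (𝓝 0) := by
      have h1 : ContinuousOn (fun u => C * |F u - F s| + |F' (t - u) - F' (t - s)|) (Icc 0 t) :=
        (continuousOn_const.mul ((hFc.mono hmem).sub continuousOn_const).abs).add
          (((hF'c.comp (continuousOn_const.sub continuousOn_id) hmem').sub
            continuousOn_const).abs)
      simpa using (h1 s hs).tendsto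
    refine tendsto_iff_dist_tendsto_zero.2 (squeeze_zero' (Eventually.of_forall fun _ => dist_nonneg)
      ?_ hlim)
    filter_upwards [self_mem_nhdsWithin] with u hu
    have hc : 0 ≤ C * |F u - F s| + |F' (t - u) - F' (t - s)| := by positivity
    have h1 := hF' u hu
    rw [Real.dist_eq, abs_sub_le_iff]
    exact ⟨hGsub u hu s hs _ hc h1, hGsub s hs u hu _ hc (by rwa [wasserstein_comm hp])⟩
  have hdini : ∀ s ∈ Ico 0 t, ∀ y : ℝ, ENNReal.ofReal (K (t - s)) * D s < ENNReal.ofReal y →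
      ∀ᶠ u in 𝓝[>] s, (G u).toReal - (G s).toReal ≤ (u - s) * y := by
    intro s hs y hy
    have hsT : s ∈ Ico 0 T := ⟨hs.1, hs.2.trans_le ht.2⟩
    have hsI : s ∈ Icc 0 t := ⟨hs.1, hs.2.le⟩
    have hK := hKpos _ (hmem' s hsI)
    -- The gap between `K (t - s) * y'` and `y` leaves room to replace `K (t - u)` by its limit as
    -- `u` decreases to `s`.
    obtain ⟨y', hy'1, hy'2⟩ : ∃ y', D s < ENNReal.ofReal y' ∧ K (t - s) * y' < y := by
      have h1 : K (t - s) * (D s).toReal < y := by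
        rw [← ENNReal.ofReal_toReal (hDtop s hsT), ← ENNReal.ofReal_mul hK.le] at hy
        exact (ENNReal.ofReal_lt_ofReal_iff_of_nonneg (by positivity)).1 hy
      obtain ⟨y', h2, h3⟩ := exists_between ((lt_div_iff₀' hK).2 h1)
      exact ⟨y', (ENNReal.lt_ofReal_iff_toReal_lt (hDtop s hsT)).2 h2, (lt_div_iff₀' hK).1 h3⟩
    have hy'0 : 0 < y' := ENNReal.ofReal_pos.1 (zero_le.trans_lt hy'1)
    have hsub : Tendsto (fun u => u - s) (𝓝[>] s) (𝓝[>] 0) := by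
      refine tendsto_nhdsWithin_iff.2 ⟨?_, ?_⟩
      · have : Tendsto (fun u : ℝ => u - s) (𝓝 s) (𝓝 (s - s)) := tendsto_id.sub_const s
        rw [sub_self] at this
        exact this.mono_left nhdsWithin_le_nhds
      · filter_upwards [self_mem_nhdsWithin] with u hu using sub_pos.2 (mem_Ioi.1 hu)
    have hKlim : Tendsto (fun u => K (t - u) * y') (𝓝[>] s) (𝓝 (K (t - s) * y')) := by
      have h1 : ContinuousOn (fun u => K (t - u) * y') (Icc 0 t) :=
        (hKcont.comp (continuousOn_const.sub continuousOn_id) hmem').mul continuousOn_const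
      exact (h1 s hsI).mono_left (nhdsWithin_le_of_mem (mem_of_superset (Ioc_mem_nhdsGT hs.2)
        fun u hu => ⟨hs.1.trans hu.1.le, hu.2⟩))
    filter_upwards [hsub.eventually (hD s hsT y' hy'1), hKlim.eventually_lt_const hy'2,
      Ioo_mem_nhdsGT hs.2] with u hu1 hu2 hu3
    have huI : u ∈ Icc 0 t := ⟨hs.1.trans hu3.1.le, hu3.2.le⟩
    have hus : 0 ≤ u - s := sub_nonneg.2 hu3.1.le
    have hγs := hγA s (hmem s hsI)
    have hy0 : 0 < y := (mul_pos hK hy'0).trans hy'2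
    refine hGsub u huI s hsI _ (mul_nonneg hus hy0.le) ?_
    -- Both points compared are now images under the same map `S (t - u)`, so its Lipschitz constant
    -- applies to the separation during `[s, u]`.
    have h1 : S (t - s) (γ s) = S (t - u) (S (u - s) (γ s)) := by
      rw [hSadd (u - s) (t - u) hus (by linarith [huI.2]) (by linarith [hs.1, ht.2]) _ hγs]
      congr 1; ring
    rw [add_sub_cancel] at hu1
    rw [h1]
    calc _ ≤ ENNReal.ofReal (K (t - u)) * wasserstein p (γ u) (S (u - s) (γ s)) :=
          hlip _ (hmem' u huI) _ (hγA u (hmem u huI)) _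
            (hSA _ hγs _ ⟨hus, by linarith [hs.1, huI.2, ht.2]⟩)
      _ ≤ ENNReal.ofReal (K (t - u)) * ENNReal.ofReal ((u - s) * y') := by gcongr
      _ = ENNReal.ofReal ((u - s) * (K (t - u) * y')) := by
          rw [← ENNReal.ofReal_mul (hKpos _ (hmem' u huI)).le]
          congr 1; ring
      _ ≤ _ := ENNReal.ofReal_le_ofReal (mul_le_mul_of_nonneg_left hu2.le hus)
  have hmain := sub_le_lintegral_of_dini_le ht.1 hcont
    (f := fun s => ENNReal.ofReal (K (t - s)) * D s)
    (fun s hs => ENNReal.mul_ne_top ENNReal.ofReal_ne_top (hDtop s ⟨hs.1, hs.2.trans_le ht.2⟩)) hdini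
  have hG0 : G 0 = 0 := by simp only [hG, sub_zero, wasserstein_self hp]
  have hGt : G t = wasserstein p (γ t) (S t (γ 0)) := by
    simp only [hG, sub_self, hS0 _ (hγA t ht)]
  rw [hG0, ENNReal.toReal_zero, sub_zero, ENNReal.ofReal_toReal (hGtop t ⟨ht.1, le_rfl⟩),
    hGt] at hmain
  exact hmain

theorem UniquelySolvable.eqOn {d : ℕ} {Ω : SpatialDomain d} {T : ℝ} {v : Velocity Ω}
    {A : Set (ProbabilityMeasure Ω.Pt)} (h : UniquelySolvable Ω T v A)
    {ρ : ProbabilityMeasure Ω.Pt} (hρ : ρ ∈ A) {μ μ' : ℝ → ProbabilityMeasure Ω.Pt}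
    (hμ : IsWeakSolution Ω T v A ρ μ) (hμ' : IsWeakSolution Ω T v A ρ μ') :
    EqOn μ μ' (Icc 0 T) := by
  obtain ⟨_, -, hu⟩ := h ρ hρ
  exact fun t ht => (hu μ hμ ht).trans (hu μ' hμ' ht).symm

end

end NonlinearContinuity

end

/-! ### The stability estimate -/

open NonlinearContinuity in
theorem mainTheorem2 (d : ℕ) (Ω : SpatialDomain d) (p : ℝ) (hp : 1 ≤ p) (T : ℝ) (hT : 0 < T)
    (vμ vν : Velocity Ω)
    -- regularity of the solutions and of the velocity fields
    (A₁ A₂ : Set (ProbabilityMeasure Ω.Pt))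
    (hA₁ : A₁ ⊆ Ω.PpL1 p) (hA₂ : A₂ ⊆ Ω.PpL1 p) (hA₁₂ : A₁ ⊆ A₂)
    (hμsol : UniquelySolvable Ω T vμ A₁) (hνsol : UniquelySolvable Ω T vν A₂)
    (hreg : ∀ ρ₀ ∈ A₁, ∀ μ ν, IsWeakSolution Ω T vμ A₁ ρ₀ μ → IsWeakSolution Ω T vν A₂ ρ₀ ν →
      IsRegularPair Ω p T vμ vν μ ν)
    (hdiff : ∀ ρ ∈ A₁, Continuous (fun x => ‖vμ ρ x - vν ρ x‖ ^ p) ∧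
      ∃ C : ℝ, ∀ x, ‖vμ ρ x - vν ρ x‖ ^ p ≤ C)
    -- absolute continuity in the Wasserstein distance
    (hμac : ∀ ρ₀ ∈ A₁, ∀ μ, IsWeakSolution Ω T vμ A₁ ρ₀ μ → IsAbsContCurve p T μ)
    (hνac : ∀ ρ₀ ∈ A₂, ∀ ν, IsWeakSolution Ω T vν A₂ ρ₀ ν → IsAbsContCurve p T ν)
    -- semigroups, the second one Lipschitz with continuous constant `K`
    (Sμ Sν : ℝ → ProbabilityMeasure Ω.Pt → ProbabilityMeasure Ω.Pt)
    (hSμ : GeneratesSemigroup Ω T vμ A₁ Sμ) (hSν : GeneratesSemigroup Ω T vν A₂ Sν)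
    (K : ℝ → ℝ) (hKpos : ∀ t ∈ Icc 0 T, 0 < K t) (hKcont : ContinuousOn K (Icc 0 T))
    (hSνlip : ∀ t ∈ Icc 0 T, ∀ ρ₁ ∈ A₂, ∀ ρ₂ ∈ A₂,
      wasserstein p (Sν t ρ₁) (Sν t ρ₂) ≤ ENNReal.ofReal (K t) * wasserstein p ρ₁ ρ₂)
    -- two solutions with the same initial datum
    (ρ₀ : ProbabilityMeasure Ω.Pt) (hρ₀ : ρ₀ ∈ A₁) (μ ν : ℝ → ProbabilityMeasure Ω.Pt)
    (hμ : IsWeakSolution Ω T vμ A₁ ρ₀ μ) (hν : IsWeakSolution Ω T vν A₂ ρ₀ ν)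
    (t : ℝ) (ht : t ∈ Icc 0 T) :
    wasserstein p (μ t) (ν t) ≤
      ∫⁻ s in Icc 0 t, ENNReal.ofReal (K (t - s)) *
        (∫⁻ x, ‖vν (μ s) x - vμ (μ s) x‖ₑ ^ p ∂(μ s : Measure Ω.Pt)) ^ (1 / p) := by

  have hμS := hμsol.eqOn hρ₀ hμ (hSμ.solution ρ₀ hρ₀)
  have hνS := hνsol.eqOn (hA₁₂ hρ₀) hν (hSν.solution ρ₀ (hA₁₂ hρ₀))
  have h1 : ν t = Sν t (μ 0) := by rw [hνS ht, hμ.initial]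
  have hbound : ∀ ρ ∈ A₁, (∫⁻ x, ‖vν ρ x - vμ ρ x‖ₑ ^ p ∂(ρ : Measure Ω.Pt)) ≠ ⊤ := by
    intro ρ hρ
    obtain ⟨C, hC⟩ := (hdiff ρ hρ).2
    have h2 : ∫⁻ x, ‖vν ρ x - vμ ρ x‖ₑ ^ p ∂(ρ : Measure Ω.Pt) ≤
        ∫⁻ _, ENNReal.ofReal C ∂(ρ : Measure Ω.Pt) := by
      refine lintegral_mono fun x => ?_
      rw [enorm_sub_rev, ← ofReal_norm,
        ENNReal.ofReal_rpow_of_nonneg (norm_nonneg _) (by linarith)]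
      exact ENNReal.ofReal_le_ofReal (hC x)
    refine (h2.trans_lt ?_).ne
    simp
  rw [h1]
  refine wasserstein_le_lintegral_of_semigroup hp (A := A₂) (S := Sν)
    (fun ρ hρ s hs => (hSν.solution ρ hρ).mem s hs) hSν.zero hSν.add
    (fun ρ hρ => hνac ρ hρ _ (hSν.solution ρ hρ)) hKpos hKcont hSνlip
    (fun s hs => hA₁₂ (hμ.mem s hs)) (hμac ρ₀ hρ₀ μ hμ)
    (D := fun s => (∫⁻ x, ‖vν (μ s) x - vμ (μ s) x‖ₑ ^ p ∂(μ s : Measure Ω.Pt)) ^ (1 / p))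
    (fun s hs => ENNReal.rpow_ne_top_of_nonneg (by positivity)
      (hbound _ (hμ.mem s ⟨hs.1, hs.2.le⟩))) ?_ ht
  intro s hs y hy
  have hsA : μ s ∈ A₁ := hμ.mem s ⟨hs.1, hs.2.le⟩
  have hsol1 := hSμ.solution _ hsA
  -- Both equations are restarted at `μ s`, which belongs to `A₁`. The semigroup property of (1)
  -- identifies the restarted solution with `μ (s + h)`, so the rate at time `0` applies at every
  -- `s`.
  have hsol2 := hSν.solution _ (hA₁₂ hsA)
  have hev := eventually_wasserstein_le hp hT hA₁ hsol1 hsol2 (hreg _ hsA _ _ hsol1 hsol2)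
    (hdiff _ hsA).1 (hdiff _ hsA).2 (hμac _ hsA _ hsol1) (hνac _ (hA₁₂ hsA) _ hsol2) hy
  filter_upwards [hev, Ioo_mem_nhdsGT (sub_pos.2 hs.2)] with h hh hhs
  have h3 : μ (s + h) = Sμ h (μ s) := by
    rw [hμS ⟨by linarith [hs.1, hhs.1], by linarith [hhs.2]⟩, hμS ⟨hs.1, hs.2.le⟩,
      hSμ.add s h hs.1 hhs.1.le (by linarith [hhs.2]) _ hρ₀, add_comm]
  rwa [h3]
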